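/- **Proposition 3.1.** Let $n\ge 0$, $N\ge 1$ be integers, $\tau\in\mathbb C$ with $\operatorname{Im}\tau>0$, and $x_1,\dots,x_n\in\mathbb C$ with $x_j-x_k\notin\mathbb Z+\tau\mathbb Z$ for $j\ne k$. *Notation.* Put $q=e^{2\pi i\tau}$, $\vartheta(z)=q^{1/8}\sum_{m\in\mathbb Z}(-1)^m e^{2\pi i\left(\frac{m(m+1)}2\tau+(m+\frac12)z\right)}$, $E_1=\vartheta'/\vartheta$, $E_2=-E_1'$, $\phi(u,z)=\dfrac{\vartheta(u+z)\vartheta'(0)}{\vartheta(u)\vartheta(z)}$, $\mathbf e_N(z)=e^{2\pi i z/N}$. For $\gamma=(\gamma_1,\gamma_2)\in\mathbb Z^2$ put $\breve\gamma=(\gamma_1+\gamma_2\tau)/N$, and for $\gamma\notin N\mathbb Z^2$ put $\varphi_\gamma(z)=\mathbf e_N(\gamma_2z)\phi(\breve\gamma,z)$, $f_\gamma(z)=\mathbf e_N(\gamma_2 z)\,\partial_u\phi(u,z)|_{u=\breve\gamma}$. Let $\mathbf C(\alpha,\beta)=\frac N\pi\sin\frac{\pi}{N}(\alpha_1\beta_2-\alpha_2\beta_1)$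 and $$\mathbf f_{\alpha,\beta,\gamma}=E_1(\breve\gamma)-E_1(\breve\alpha-\breve\beta-\breve\gamma)+E_1(\breve\alpha-\breve\gamma)-E_1(\breve\beta+\breve\gamma).$$ Let $T_a=\frac N{2\pi i}\mathbf e_N(\tfrac{a_1a_2}2)Q^{a_1}\Lambda^{a_2}$ for $a\in\mathbb Z^2$, where $Q=\operatorname{diag}(\mathbf e_N(1),\dots,\mathbf e_N(N))$ and $\Lambda=(\delta_{i+1,j})_{i,j\in\mathbb Z/N}$. Let $\mathcal P^{(2)}_{n,N}$ be the complex vector space with coordinates $S_0$ and $S^j_a$ ($1\le j\le n$, $a\in(\mathbb Z/N)^2$), subject to $\sum_jS^j_0=0$. For $a\in\mathbb Z^2$ let $S^j_a$ be the coordinate of the class of $a$ times the sign $e^{\pi i(a_1a_2-r_1r_2)/N}=\pm1$, where $r\in\{0,\dots,N-1\}^2$ represents this class; so $S^j_aT_a$ depends only on the class of $a$. Below, $\alpha,\beta$ run over all integer representatives of nonzero classes; sums over $\gamma$ run over representatives of the nonzero classes, further restrictions on $\gamma$ are modulo $N$, and terms whose factor $\mathbf C$ vanishes are zero. *Claim.*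 (i) There is exactly one holomorphic Poisson structure $\{\cdot,\cdot\}_2$ on the complex manifold $\mathcal P^{(2)}_{n,N}$ with $$\{S_0,S_0^j\}_2=\{S_0^j,S_0^k\}_2=\{S_\alpha^j,S_\alpha^k\}_2=0,\tag{3.3}$$ $$\{S_0,S^k_\alpha\}_2=\sum_{\gamma\ne\alpha}\mathbf C(\alpha,\gamma)\Bigl(S^k_{\alpha-\gamma}S^k_\gamma E_2(\breve\gamma)-\sum_{j\ne k}S^j_\gamma S^k_{\alpha-\gamma}f_\gamma(x_k-x_j)\Bigr),\tag{3.4}$$ $$\begin{aligned}\{S^k_\alpha,S^k_\beta\}_2={}&-\mathbf C(\alpha,\beta)S_0S^k_{\alpha+\beta}+\tfrac12\sum_{\gamma\ne\alpha,-\beta}\mathbf C(\gamma,\alpha-\beta)S^k_{\alpha-\gamma}S^k_{\beta+\gamma}\mathbf f_{\alpha,\beta,\gamma}\\&+\mathbf C(\alpha,\beta)S_0^kS^k_{\alpha+\beta}\bigl(E_1(\breve\alpha+\breve\beta)-E_1(\breve\alpha)-E_1(\breve\beta)\bigr)\\&+\mathbf C(\alpha,\beta)\sum_{j\ne k}\bigl(S^k_0S^j_{\alpha+\beta}\varphi_{\alpha+\beta}(x_k-x_j)-S^j_0S^k_{\alpha+\beta}E_1(x_k-x_j)\bigr)\\&-\sum_{j\ne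 k}\ \sum_{\gamma\ne\alpha,-\beta}\mathbf C(\gamma,\alpha-\beta)S^k_{\alpha-\gamma}S^j_{\beta+\gamma}\varphi_{\beta+\gamma}(x_k-x_j),\end{aligned}\tag{3.5}$$ for $j\ne k$ $$\begin{aligned}\{S^j_\alpha,S^k_\beta\}_2={}&\sum_{\gamma\ne\alpha,-\beta}\mathbf C(\gamma,\alpha-\beta)S^j_{\alpha-\gamma}S^k_{\beta+\gamma}\varphi_\gamma(x_j-x_k)\\&-\mathbf C(\alpha,\beta)\bigl(S^j_0S^k_{\alpha+\beta}\varphi_\alpha(x_j-x_k)-S^k_0S^j_{\alpha+\beta}\varphi_{-\beta}(x_j-x_k)\bigr),\end{aligned}\tag{3.6}$$ and $$\{S^j_0,S^k_\beta\}_2=\begin{cases}\displaystyle\sum_{\gamma\ne-\beta}\mathbf C(\gamma,-\beta)S^j_{-\gamma}S^k_{\beta+\gamma}\varphi_\gamma(x_j-x_k),&j\ne k,\\[2mm]\displaystyle-\sum_{m\ne k}\ \sum_{\gamma\ne-\beta}\mathbf C(\gamma,-\beta)S^k_{-\gamma}S^m_{\beta+\gamma}\varphi_{\beta+\gamma}(x_k-x_m),&j=k.\end{cases}\tag{3.7}$$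 (ii) These are the brackets of the classical exchange algebra: a holomorphic Poisson structure on $\mathcal P^{(2)}_{n,N}$ satisfies (3.3)–(3.7) if and only if, with the Belavin–Drinfeld elliptic $r$-matrix $r(z)=\sum_{\gamma\ne0}\varphi_\gamma(z)T_\gamma\otimes T_{-\gamma}$ and $$L(z)=\Bigl(S_0+\sum_jS^j_0E_1(z-x_j)\Bigr)T_0+\sum_j\sum_{\alpha\ne0}S^j_\alpha\varphi_\alpha(z-x_j)T_\alpha,$$ it satisfies $$\{L_1(z),L_2(w)\}_2=-\frac{2\pi i}N\,[r(z-w),L(z)\otimes L(w)]$$ for all $z,w$ with $z-w$, $z-x_j$, $w-x_j\notin\mathbb Z+\tau\mathbb Z$ (all $j$). (iii) For $n=1$ (where $S_0^1=0$, $S_\alpha:=S^1_\alpha$) a holomorphic Poisson structure satisfies (3.3)–(3.7) if and only if it has the brackets of the classical Feigin–Odesskii–Sklyanin algebra $$\{S_0,S_\alpha\}_2=\sum_{\gamma\ne\alpha}\mathbf C(\alpha,\gamma)S_{\alpha-\gamma}S_\gamma E_2(\breve\gamma),$$ $$\{S_\alpha,S_\beta\}_2=-\mathbf C(\alpha,\beta)S_0S_{\alpha+\beta}+\tfrac12\sum_{\gamma\ne\alpha,-\beta}\mathbf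 C(\gamma,\alpha-\beta)S_{\alpha-\gamma}S_{\beta+\gamma}\mathbf f_{\alpha,\beta,\gamma}.$$ -/

import Mathlib

noncomputable section

namespace ESS

/-! ### Holomorphic Poisson structures on a complex vector space -/

/-- The bracket `{F, G}(p) = π_p (dF_p, dG_p)` attached to a field `π` of bilinear forms on
covectors. It is a derivation in each argument, and local. -/
def bivectorBracket {E : Type*} [NormedAddCommGroup E] [NormedSpace ℂ E]
    (π : E → (E →L[ℂ] ℂ) →ₗ[ℂ] (E →L[ℂ] ℂ) →ₗ[ℂ] ℂ) (F G : E → ℂ) (p : E) : ℂ :=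
  π p (fderiv ℂ F p) (fderiv ℂ G p)

/-- A holomorphic Poisson structure on (the complex manifold underlying) a finite-dimensional
complex vector space: a bivector field with holomorphic coefficients whose bracket satisfies the
Jacobi identity for all holomorphic functions on all open sets. -/
structure HolomorphicPoisson (E : Type*) [NormedAddCommGroup E] [NormedSpace ℂ E]
    [FiniteDimensional ℂ E] where
  bivector : E → (E →L[ℂ] ℂ) →ₗ[ℂ] (E →L[ℂ] ℂ) →ₗ[ℂ] ℂ
  holomorphic : ∀ ξ η, Differentiable ℂ fun p => bivector p ξ η
  alternating : ∀ p ξ, bivector p ξ ξ = 0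
  jacobi : ∀ U : Set E, IsOpen U → ∀ F G H : E → ℂ,
    DifferentiableOn ℂ F U → DifferentiableOn ℂ G U → DifferentiableOn ℂ H U → ∀ p ∈ U,
      bivectorBracket bivector (bivectorBracket bivector F G) H p
        + bivectorBracket bivector (bivectorBracket bivector G H) F p
        + bivectorBracket bivector (bivectorBracket bivector H F) G p = 0

/-- The Poisson bracket of two functions. -/
def HolomorphicPoisson.bracket {E : Type*} [NormedAddCommGroup E] [NormedSpace ℂ E]
    [FiniteDimensional ℂ E] (P : HolomorphicPoisson E) (F G : E → ℂ) : E → ℂ :=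
  bivectorBracket P.bivector F G

/-! ### Elliptic functions for the curve `ℂ / (ℤ + τℤ)` -/

/-- `z` lies in the lattice `ℤ + τℤ`. -/
def InLattice (τ z : ℂ) : Prop := ∃ m l : ℤ, z = m + l * τ

/-- The odd theta function
`ϑ(z|τ) = q^{1/8} ∑ₘ (-1)^m exp (2πi (m(m+1)τ/2 + (m+1/2)z))`, with `q = exp (2πiτ)`,
written through the two-variable Jacobi theta function
`jacobiTheta₂ z τ = ∑ₘ exp (2πi m z + πi m² τ)`. -/
def theta (τ z : ℂ) : ℂ :=
  Complex.exp (Real.pi * Complex.I * τ / 4 + Real.pi * Complex.I * z)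
    * jacobiTheta₂ (z + τ / 2 + 1 / 2) τ

/-- The first Eisenstein function `E₁ = ∂_z log ϑ`. -/
def E1 (τ z : ℂ) : ℂ := deriv (theta τ) z / theta τ z

/-- The second Eisenstein function `E₂ = -∂_z E₁`. -/
def E2 (τ z : ℂ) : ℂ := -deriv (E1 τ) z

/-- `φ(u, z) = ϑ(u + z) ϑ'(0) / (ϑ(u) ϑ(z))`. -/
def phi (τ u z : ℂ) : ℂ :=
  theta τ (u + z) * deriv (theta τ) 0 / (theta τ u * theta τ z)

/-- `e_N(z) = exp (2πi z / N)`. -/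
def eN (N : ℕ) (z : ℂ) : ℂ := Complex.exp (2 * Real.pi * Complex.I / N * z)

/-- `γ̆ = (γ₁ + γ₂ τ) / N`. -/
def breve (N : ℕ) (τ : ℂ) (g : ℤ × ℤ) : ℂ := (g.1 + g.2 * τ) / N

/-- `φ_γ(z) = e_N(γ₂ z) φ(γ̆, z)`. -/
def varphi (N : ℕ) (τ : ℂ) (g : ℤ × ℤ) (z : ℂ) : ℂ :=
  eN N (g.2 * z) * phi τ (breve N τ g) z

/-- `f_γ(z) = e_N(γ₂ z) ∂_u φ(u, z)` at `u = γ̆`. -/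
def fFun (N : ℕ) (τ : ℂ) (g : ℤ × ℤ) (z : ℂ) : ℂ :=
  eN N (g.2 * z) * deriv (fun u => phi τ u z) (breve N τ g)

/-- `f_{α,β,γ} = E₁(γ̆) - E₁(ᾰ - β̆ - γ̆) + E₁(ᾰ - γ̆) - E₁(β̆ + γ̆)`. -/
def fConst (N : ℕ) (τ : ℂ) (a b g : ℤ × ℤ) : ℂ :=
  E1 τ (breve N τ g) - E1 τ (breve N τ (a - b - g))
    + E1 τ (breve N τ (a - g)) - E1 τ (breve N τ (b + g))

/-! ### The index group `ℤ_N ⊕ ℤ_N`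

Indices are handled through integer representatives. -/

/-- `ℤ_N ⊕ ℤ_N`. -/
abbrev Idx (N : ℕ) : Type := ZMod N × ZMod N

/-- The class modulo `N` of a pair of integers. -/
def cls (N : ℕ) (a : ℤ × ℤ) : Idx N := ((a.1 : ZMod N), (a.2 : ZMod N))

/-- The representative with entries in `{0, …, N - 1}`. -/
def rep {N : ℕ} (c : Idx N) : ℤ × ℤ := ((c.1.val : ℤ), (c.2.val : ℤ))

/-- `C(α, β) = (N / π) sin (π (α × β) / N)`, where `α × β = α₁ β₂ - α₂ β₁`. -/
def C (N : ℕ) (a b : ℤ × ℤ) : ℂ :=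
  (N : ℂ) / Real.pi
    * Complex.sin (Real.pi / N * ((a.1 * b.2 - a.2 * b.1 : ℤ) : ℂ))

/-! ### The matrices `T_a`

Rows and columns are indexed by `ℤ_N`; the class of `0` plays the role of the last index `N`. -/

/-- `Q = diag (e_N(1), …, e_N(N))`. -/
def Q (N : ℕ) : Matrix (ZMod N) (ZMod N) ℂ :=
  Matrix.diagonal fun j => eN N (j.val : ℂ)

/-- `Λ = (δ_{i+1,j})`, indices modulo `N`. -/
def Lam (N : ℕ) : Matrix (ZMod N) (ZMod N) ℂ :=
  Matrix.of fun i j => if j = i + 1 then 1 else 0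

/-- `T_a = N / (2πi) e_N(a₁ a₂ / 2) Q^{a₁} Λ^{a₂}`, for a pair of integers `a`. Replacing `a` by
another representative modulo `N` changes `T_a` by a sign. -/
def T (N : ℕ) [NeZero N] (a : ℤ × ℤ) : Matrix (ZMod N) (ZMod N) ℂ :=
  ((N : ℂ) / (2 * Real.pi * Complex.I) * eN N (a.1 * a.2 / 2)) • (Q N ^ a.1 * Lam N ^ a.2)

/-! ### The phase space and its coordinate functions -/

/-- `𝒫 = {(S₀, (S^j_a)_{j, a}) | ∑_j S^j_0 = 0}`, where `j = 1, …, n` and `a ∈ ℤ_N ⊕ ℤ_N`. -/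
def Phase (n N : ℕ) [NeZero N] : Submodule ℂ (ℂ × (Fin n → Idx N → ℂ)) where
  carrier := {p | ∑ j, p.2 j 0 = 0}
  add_mem' := by
    intro a b ha hb
    simp only [Set.mem_ofPred_eq, Prod.snd_add, Pi.add_apply, Finset.sum_add_distrib] at *
    rw [ha, hb, add_zero]
  zero_mem' := by simp
  smul_mem' := by
    intro c a ha
    simp only [Set.mem_ofPred_eq, Prod.smul_snd, Pi.smul_apply, smul_eq_mul,
      ← Finset.mul_sum] at *
    rw [ha, mul_zero]

/-- The coordinate function `S₀`. -/
def S0 {n N : ℕ} [NeZero N] (p : Phase n N) : ℂ := p.1.1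

/-- The coordinate function `S^j_0`. -/
def S0j {n N : ℕ} [NeZero N] (j : Fin n) (p : Phase n N) : ℂ := p.1.2 j 0

/-- The coordinate function `S^j_a` for a pair of integers `a`: the coordinate of the class of `a`,
times the sign `exp (πi (a₁ a₂ - r₁ r₂) / N)`, with `r` the representative of `a` in
`{0, …, N - 1}²`. This is the sign with `T_a = ± T_r`, so that `S^j_a T_a` depends only on
the class of `a`. -/
def S {n N : ℕ} [NeZero N] (j : Fin n) (a : ℤ × ℤ) (p : Phase n N) : ℂ :=
  Complex.exp (Real.pi * Complex.I / N
      * ((a.1 * a.2 - (rep (cls N a)).1 * (rep (cls N a)).2 : ℤ) : ℂ))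
    * p.1.2 j (cls N a)

/-! ### The quadratic brackets -/

/-- The value prescribed for `{S₀, S^k_α}`. -/
def rhsS0S {n N : ℕ} [NeZero N] (τ : ℂ) (x : Fin n → ℂ) (k : Fin n) (a : ℤ × ℤ)
    (p : Phase n N) : ℂ :=
  ∑ c : Idx N with c ≠ 0 ∧ c ≠ cls N a,
    C N a (rep c) *
      (S k (a - rep c) p * S k (rep c) p * E2 τ (breve N τ (rep c))
        - ∑ j with j ≠ k, S j (rep c) p * S k (a - rep c) p * fFun N τ (rep c) (x k - x j))

/-- The value prescribed for `{S^k_α, S^k_β}`. -/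
def rhsSame {n N : ℕ} [NeZero N] (τ : ℂ) (x : Fin n → ℂ) (k : Fin n) (a b : ℤ × ℤ)
    (p : Phase n N) : ℂ :=
  -(C N a b * S0 p * S k (a + b) p)
    + 1 / 2 * ∑ c : Idx N with c ≠ 0 ∧ c ≠ cls N a ∧ c ≠ cls N (-b),
        C N (rep c) (a - b) * S k (a - rep c) p * S k (b + rep c) p * fConst N τ a b (rep c)
    + C N a b * S0j k p * S k (a + b) p *
        (E1 τ (breve N τ a + breve N τ b) - E1 τ (breve N τ a) - E1 τ (breve N τ b))
    + C N a b * ∑ j with j ≠ k,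
        (S0j k p * S j (a + b) p * varphi N τ (a + b) (x k - x j)
          - S0j j p * S k (a + b) p * E1 τ (x k - x j))
    - ∑ j with j ≠ k, ∑ c : Idx N with c ≠ 0 ∧ c ≠ cls N a ∧ c ≠ cls N (-b),
        C N (rep c) (a - b) * S k (a - rep c) p * S j (b + rep c) p
          * varphi N τ (b + rep c) (x k - x j)

/-- The value prescribed for `{S^j_α, S^k_β}` with `j ≠ k`. -/
def rhsDiff {n N : ℕ} [NeZero N] (τ : ℂ) (x : Fin n → ℂ) (j k : Fin n) (a b : ℤ × ℤ)
    (p : Phase n N) : ℂ :=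
  ∑ c : Idx N with c ≠ 0 ∧ c ≠ cls N a ∧ c ≠ cls N (-b),
      C N (rep c) (a - b) * S j (a - rep c) p * S k (b + rep c) p
        * varphi N τ (rep c) (x j - x k)
    - C N a b * (S0j j p * S k (a + b) p * varphi N τ a (x j - x k)
        - S0j k p * S j (a + b) p * varphi N τ (-b) (x j - x k))

/-- The value prescribed for `{S^j_0, S^k_β}`. -/
def rhsS0jS {n N : ℕ} [NeZero N] (τ : ℂ) (x : Fin n → ℂ) (j k : Fin n) (b : ℤ × ℤ)
    (p : Phase n N) : ℂ :=
  if j = k then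
    -∑ m with m ≠ k, ∑ c : Idx N with c ≠ 0 ∧ c ≠ cls N (-b),
      C N (rep c) (-b) * S k (-rep c) p * S m (b + rep c) p * varphi N τ (b + rep c) (x k - x m)
  else
    ∑ c : Idx N with c ≠ 0 ∧ c ≠ cls N (-b),
      C N (rep c) (-b) * S j (-rep c) p * S k (b + rep c) p * varphi N τ (rep c) (x j - x k)

/-- The Poisson structure has the explicit quadratic brackets of the coordinate functions; here
`α`, `β` run over all integer representatives of the nonzero classes. -/
structure HasQuadraticBrackets {n N : ℕ} [NeZero N] (τ : ℂ) (x : Fin n → ℂ)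
    (P : HolomorphicPoisson (Phase n N)) : Prop where
  S0_S0j : ∀ j, P.bracket S0 (S0j j) = 0
  S0j_S0k : ∀ j k, P.bracket (S0j j) (S0j k) = 0
  S_S_eq : ∀ j k (a : ℤ × ℤ), cls N a ≠ 0 → P.bracket (S j a) (S k a) = 0
  S0_S : ∀ k (a : ℤ × ℤ), cls N a ≠ 0 → P.bracket S0 (S k a) = rhsS0S τ x k a
  S_S_same : ∀ k (a b : ℤ × ℤ), cls N a ≠ 0 → cls N b ≠ 0 →
    P.bracket (S k a) (S k b) = rhsSame τ x k a b
  S_S_diff : ∀ j k, j ≠ k → ∀ a b : ℤ × ℤ, cls N a ≠ 0 → cls N b ≠ 0 →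
    P.bracket (S j a) (S k b) = rhsDiff τ x j k a b
  S0j_S : ∀ j k (b : ℤ × ℤ), cls N b ≠ 0 → P.bracket (S0j j) (S k b) = rhsS0jS τ x j k b

/-- The brackets of the classical Feigin-Odesskii-Sklyanin algebra, in the variables `S₀` and
`S_α = S^1_α` of the phase space for `n = 1`, where `S^1_0 = 0`. -/
structure HasFOSBrackets {N : ℕ} [NeZero N] (τ : ℂ) (P : HolomorphicPoisson (Phase 1 N)) :
    Prop where
  S0_S : ∀ (a : ℤ × ℤ), cls N a ≠ 0 → P.bracket S0 (S 0 a) = fun p =>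
    ∑ c : Idx N with c ≠ 0 ∧ c ≠ cls N a,
      C N a (rep c) * S 0 (a - rep c) p * S 0 (rep c) p * E2 τ (breve N τ (rep c))
  S_S : ∀ (a b : ℤ × ℤ), cls N a ≠ 0 → cls N b ≠ 0 → P.bracket (S 0 a) (S 0 b) = fun p =>
    -(C N a b * S0 p * S 0 (a + b) p)
      + 1 / 2 * ∑ c : Idx N with c ≠ 0 ∧ c ≠ cls N a ∧ c ≠ cls N (-b),
        C N (rep c) (a - b) * S 0 (a - rep c) p * S 0 (b + rep c) p * fConst N τ a b (rep c)

/-! ### The exchange algebra -/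

/-- The Lax matrix `L(z) = (S₀ + ∑_j S^j_0 E₁(z - x_j)) T_0 + ∑_j ∑_{α ≠ 0} S^j_α φ_α(z - x_j) T_α`
at the point `p` of the phase space. -/
def Lax {n N : ℕ} [NeZero N] (τ : ℂ) (x : Fin n → ℂ) (z : ℂ) (p : Phase n N) :
    Matrix (ZMod N) (ZMod N) ℂ :=
  (S0 p + ∑ j, S0j j p * E1 τ (z - x j)) • T N 0
    + ∑ j, ∑ c : Idx N with c ≠ 0, (S j (rep c) p * varphi N τ (rep c) (z - x j)) • T N (rep c)

/-- The elliptic Belavin-Drinfeld r-matrix `r(z) = ∑_{γ ≠ 0} φ_γ(z) T_γ ⊗ T_{-γ}`. -/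
def rMatrix (N : ℕ) [NeZero N] (τ z : ℂ) : Matrix (ZMod N × ZMod N) (ZMod N × ZMod N) ℂ :=
  ∑ c : Idx N with c ≠ 0,
    varphi N τ (rep c) z • Matrix.kronecker (T N (rep c)) (T N (-rep c))

/-- The classical exchange relation `{L₁(z), L₂(w)} = -(2πi / N) [r(z - w), L(z) ⊗ L(w)]` for all
`z`, `w` off the poles. The left-hand side is the matrix of brackets of matrix entries:
its entry at `((i, k), (j, l))` is `{L(z)_{ij}, L(w)_{kl}}`. -/
def SatisfiesExchange {n N : ℕ} [NeZero N] (τ : ℂ) (x : Fin n → ℂ)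
    (P : HolomorphicPoisson (Phase n N)) : Prop :=
  ∀ z w : ℂ, (∀ j, ¬ InLattice τ (z - x j)) → (∀ j, ¬ InLattice τ (w - x j)) →
    ¬ InLattice τ (z - w) → ∀ p : Phase n N,
      (Matrix.of fun a b : ZMod N × ZMod N =>
          P.bracket (fun q => Lax τ x z q a.1 b.1) (fun q => Lax τ x w q a.2 b.2) p)
        = (-(2 * Real.pi * Complex.I / N)) •
          (rMatrix N τ (z - w) * Matrix.kronecker (Lax τ x z p) (Lax τ x w p)
            - Matrix.kronecker (Lax τ x z p) (Lax τ x w p) * rMatrix N τ (z - w))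

end ESS

end

noncomputable section

namespace ESS

open Filter Topology Complex

/-! ### The lattice -/

/-! Expand the exchange relation in the matrices `T_α ⊗ T_β`. The `T_a` multiply with a phase given
by half the symplectic form (`T_mul_T`), so the commutator with `T_γ ⊗ T_{-γ}` produces the
constants `C(γ, α - β)`. The right-hand side then has as coefficient the twisted convolution
`exchCoeff`: the sum over γ of `C(γ, α - β) L_{α-γ}(z) L_{β+γ}(w) φ_γ(z - w)`. Fay's identities
separate `z` from `w`. The pole at `z = w` and the double poles come with factors independent of γ,
and the involution `γ ↦ α - β - γ` annihilates the convolution of a function with itself against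
such a factor (`twConv_one_self`). The relation `∑ S^j_0 = 0` removes the remaining unwanted terms.
What is left is a combination of the functions `φ_α(z - x_j) φ_β(w - x_k)`, with `E₁` and `1` in
place of `φ_0`. Its coefficients are quadratic in `S`, and once the terms `γ = α` and `γ = -β` are
split off they are the prescribed brackets (`rhsSame_eq`, `rhsDiff_eq`, `rhsS0jS_eq`, `rhsS0S_eq`).

The functions `1` and `φ_a(z - x_j)` are linearly independent because of their poles, so the
coefficients of `L(z)` for generic `z` span the dual of the phase space (`eq_zero_of_laxForm`).
Hence at each point exactly one bilinear form satisfies the exchange relation, namely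
`quadBivector`. The list of brackets and the exchange relation both say that the bivector is this
one, which gives their equivalence and the uniqueness.

For existence, antisymmetry and the Jacobi identity are checked on coefficients of `L`, not on the
explicit formulas. Minus the transpose of `quadBivector` satisfies the same exchange relation, hence
equals it. For Jacobi, the cyclic sum at three generic parameters breaks up into monomials in the
entries of `L`. Each of them vanishes by the addition theorem of the sine and one Fay identity
(`nest_cyclic`), which is the classical Yang-Baxter equation in components. Symmetry of second
derivatives carries the identity from linear functionals to all holomorphic functions
(`jacobi_of_linear`).

The elliptic input rests on Liouville's theorem. It identifies theta with its product up to a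
constant, so the zeros are simple and are exactly the lattice points. It then yields Weierstrass'
three-term identity, from which the Fay identity follows by substitution and the degenerate ones by
differentiation. For one marked point `S^1_0` vanishes and all sums over other points are empty. -/

lemma inLattice_zero (τ : ℂ) : InLattice τ 0 := ⟨0, 0, by simp⟩

lemma InLattice.neg {τ z : ℂ} (h : InLattice τ z) : InLattice τ (-z) := by
  obtain ⟨m, l, rfl⟩ := h
  exact ⟨-m, -l, by push_cast; ring⟩

lemma InLattice.add {τ z w : ℂ} (h : InLattice τ z) (h' : InLattice τ w) :
    InLattice τ (z + w) := by
  obtain ⟨m, l, rfl⟩ := h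
  obtain ⟨m', l', rfl⟩ := h'
  exact ⟨m + m', l + l', by push_cast; ring⟩

lemma InLattice.sub {τ z w : ℂ} (h : InLattice τ z) (h' : InLattice τ w) :
    InLattice τ (z - w) := by
  rw [sub_eq_add_neg]; exact h.add h'.neg

lemma inLattice_neg_iff {τ z : ℂ} : InLattice τ (-z) ↔ InLattice τ z :=
  ⟨fun h => by simpa using h.neg, fun h => h.neg⟩

lemma inLattice_sub_comm {τ z w : ℂ} : InLattice τ (z - w) ↔ InLattice τ (w - z) := by
  rw [← inLattice_neg_iff, neg_sub]

lemma countable_inLattice (τ : ℂ) : {z | InLattice τ z}.Countable := by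
  have : {z | InLattice τ z} = Set.range fun p : ℤ × ℤ => (p.1 + p.2 * τ : ℂ) := by
    ext z
    simp [InLattice, eq_comm]
  rw [this]
  exact Set.countable_range _

/-- The solutions `z` of `f z ∈ ℤ + τℤ` are countably many when `f` is injective. -/
lemma countable_inLattice_of_injective (τ : ℂ) {f : ℂ → ℂ} (hf : Function.Injective f) :
    {z | InLattice τ (f z)}.Countable :=
  (countable_inLattice τ).preimage hf

/-! ### Liouville's theorem for elliptic functions -/

/-- An entire function with periods `1` and `τ` is constant. -/
lemma apply_eq_of_doubly_periodic {τ : ℂ} (hτ : 0 < τ.im) {f : ℂ → ℂ} (hf : Differentiable ℂ f)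
    (h1 : ∀ z, f (z + 1) = f z) (h2 : ∀ z, f (z + τ) = f z) (z w : ℂ) : f z = f w := by
  have hz1 : ∀ (m : ℤ) z, f (z + m) = f z := fun m z => by
    simpa using (Function.Periodic.int_mul h1 m) z
  have hz2 : ∀ (m : ℤ) z, f (z + m * τ) = f z := fun m z => by
    simpa using (Function.Periodic.int_mul h2 m) z
  refine hf.apply_eq_apply_of_bounded ?_ z w
  -- The closed period parallelogram is compact, and taking fractional parts of the real coordinates
  -- of `z` in the basis `1, τ` moves `z` into it.
  let K : Set ℂ := (fun p : ℝ × ℝ => (p.1 : ℂ) + p.2 * τ) '' (Set.Icc 0 1 ×ˢ Set.Icc 0 1)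
  have hK : IsCompact K := (isCompact_Icc.prod isCompact_Icc).image (by fun_prop)
  refine ((hK.image hf.continuous).isBounded).subset ?_
  rintro _ ⟨z, rfl⟩
  set t : ℝ := z.im / τ.im
  set s : ℝ := z.re - t * τ.re
  have hz : z = s + t * τ := by
    apply Complex.ext
    · simp [s]
    · simp [t, hτ.ne']
  refine ⟨(Int.fract s : ℝ) + (Int.fract t : ℝ) * τ, ⟨(Int.fract s, Int.fract t),
    ⟨⟨Int.fract_nonneg _, (Int.fract_lt_one _).le⟩, ⟨Int.fract_nonneg _, (Int.fract_lt_one _).le⟩⟩,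
    rfl⟩, ?_⟩
  rw [← hz1 ⌊s⌋, ← hz2 ⌊t⌋]
  congr 1
  rw [hz]
  nth_rewrite 3 [← Int.fract_add_floor s]
  nth_rewrite 3 [← Int.fract_add_floor t]
  push_cast
  ring

/-- A quotient of entire functions is entire if the zeros of the denominator are simple and
are zeros of the numerator. -/
lemma exists_entire_mul_eq {F G : ℂ → ℂ} (hF : Differentiable ℂ F) (hG : Differentiable ℂ G)
    (h : ∀ z, G z = 0 → deriv G z ≠ 0 ∧ F z = 0) :
    ∃ H : ℂ → ℂ, Differentiable ℂ H ∧ ∀ z, F z = H z * G z := by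
  classical
  -- Near a common zero the quotient is that of the two divided slopes, whose value there is the
  -- ratio of derivatives; the slope of `G` does not vanish since the zero is simple.
  refine ⟨fun z => if G z = 0 then deriv F z / deriv G z else F z / G z, fun z => ?_, fun z => ?_⟩
  · by_cases hz : G z = 0
    · obtain ⟨hd, hFz⟩ := h z hz
      have hFd : DifferentiableAt ℂ (dslope F z) z :=
        ((Complex.differentiableOn_dslope (s := Set.univ) univ_mem).2
          hF.differentiableOn).differentiableAt univ_mem
      have hGd : DifferentiableAt ℂ (dslope G z) z :=
        ((Complex.differentiableOn_dslope (s := Set.univ) univ_mem).2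
          hG.differentiableOn).differentiableAt univ_mem
      have h0 : dslope G z z ≠ 0 := by rwa [dslope_same]
      refine (hFd.div hGd h0).congr_of_eventuallyEq ?_
      filter_upwards [hGd.continuousAt.eventually_ne h0] with w hw
      rcases eq_or_ne w z with rfl | hwz
      · simp [hz, dslope_same]
      · have hGw : G w = (w - z) * dslope G z w := by
          have := sub_smul_dslope G z w
          rw [hz, sub_zero] at this
          exact this.symm
        have hFw : F w = (w - z) * dslope F z w := by
          have := sub_smul_dslope F z w
          rw [hFz, sub_zero] at this
          exact this.symm
        have hwz' := sub_ne_zero.2 hwz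
        have : G w ≠ 0 := by rw [hGw]; exact mul_ne_zero hwz' hw
        simp only [this, if_false, Pi.div_apply]
        rw [hGw, hFw, mul_div_mul_left _ _ hwz']
    · refine ((hF z).div (hG z) hz).congr_of_eventuallyEq ?_
      filter_upwards [(hG z).continuousAt.eventually_ne hz] with w hw
      simp [hw]
  · by_cases hz : G z = 0
    · simp [hz, (h z hz).2]
    · simp [hz]

/-- Two entire functions with the same multipliers under `1` and `τ` are proportional if the
zeros of one of them are simple and are zeros of the other. -/
lemma exists_const_mul_eq {τ : ℂ} (hτ : 0 < τ.im) {F G a b : ℂ → ℂ} (hF : Differentiable ℂ F)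
    (hG : Differentiable ℂ G) (h : ∀ z, G z = 0 → deriv G z ≠ 0 ∧ F z = 0)
    (ha : ∀ z, a z ≠ 0) (hb : ∀ z, b z ≠ 0)
    (hF1 : ∀ z, F (z + 1) = a z * F z) (hG1 : ∀ z, G (z + 1) = a z * G z)
    (hF2 : ∀ z, F (z + τ) = b z * F z) (hG2 : ∀ z, G (z + τ) = b z * G z) :
    ∃ c, ∀ z, F z = c * G z := by
  obtain ⟨H, hH, hFH⟩ := exists_entire_mul_eq hF hG h
  have key : ∀ (t : ℂ) (m : ℂ → ℂ), (∀ z, m z ≠ 0) → (∀ z, F (z + t) = m z * F z) →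
      (∀ z, G (z + t) = m z * G z) → ∀ z, H (z + t) = H z := by
    intro t m hm h1 h2
    have hne : ∀ z, G z ≠ 0 → H (z + t) = H z := by
      intro z hz
      have e := h1 z
      rw [hFH, h2, hFH z] at e
      have := mul_ne_zero (hm z) hz
      apply mul_right_cancel₀ this
      rw [e]; ring
    intro z
    -- Simple zeros of `G` are isolated, so the periodicity of `H` extends to them by continuity.
    by_cases hz : G z = 0
    · have hev : ∀ᶠ w in 𝓝[≠] z, G w ≠ 0 := by
        have := (hG z).hasDerivAt.eventually_ne (c := 0) (h z hz).1
        simpa using this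
      have l1 : Tendsto (fun w => H (w + t)) (𝓝[≠] z) (𝓝 (H (z + t))) :=
        ((hH.continuous.comp (continuous_id.add continuous_const)).tendsto z).mono_left
          nhdsWithin_le_nhds
      have l2 : Tendsto H (𝓝[≠] z) (𝓝 (H z)) := (hH.continuous.tendsto z).mono_left
        nhdsWithin_le_nhds
      exact tendsto_nhds_unique (l1.congr' (hev.mono fun w hw => hne w hw)) l2
    · exact hne z hz
  refine ⟨H 0, fun z => ?_⟩
  rw [hFH, apply_eq_of_doubly_periodic hτ hH (key 1 a ha hF1 hG1) (key τ b hb hF2 hG2) z 0]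

/-! ### The product `∏ (1 - qⁿ t)` -/

/-- The infinite product `∏_{n ≥ 0} (1 - qⁿ t)`. -/
def qProd (q t : ℂ) : ℂ := ∏' n : ℕ, (1 - q ^ n * t)

lemma hasProdLocallyUniformlyOn_qProd {q : ℂ} (hq : ‖q‖ < 1) :
    HasProdLocallyUniformlyOn (fun (n : ℕ) t => 1 + -(q ^ n * t)) (qProd q) Set.univ := by
  have hQ : qProd q = fun t => ∏' n : ℕ, (1 + -(q ^ n * t)) := by
    funext t
    simp only [qProd, sub_eq_add_neg]
  rw [hQ]
  refine hasProdLocallyUniformlyOn_of_forall_compact (f := fun (n : ℕ) t => 1 + -(q ^ n * t))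
    (g := fun t => ∏' n : ℕ, (1 + -(q ^ n * t))) isOpen_univ fun K _ hcK => ?_
  obtain ⟨R, hR⟩ := hcK.isBounded.exists_norm_le
  have hs : Summable fun n : ℕ => ‖q‖ ^ n * R :=
    (summable_geometric_of_lt_one (norm_nonneg _) hq).mul_right R
  refine hs.hasProdUniformlyOn_nat_one_add hcK (.of_forall fun n x hx => ?_)
    (fun _ => by fun_prop)
  rw [norm_neg, norm_mul, norm_pow]
  exact mul_le_mul_of_nonneg_left (hR x hx) (pow_nonneg (norm_nonneg q) n)

lemma differentiable_qProd {q : ℂ} (hq : ‖q‖ < 1) : Differentiable ℂ (qProd q) := by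
  rw [← differentiableOn_univ]
  exact (hasProdLocallyUniformlyOn_qProd hq).differentiableOn
    (.of_forall fun _ => by simpa [Finset.prod_fn] using
      DifferentiableOn.finsetProd (fun _ _ => by fun_prop)) isOpen_univ

lemma summable_norm_qProd {q : ℂ} (hq : ‖q‖ < 1) (t : ℂ) :
    Summable fun n : ℕ => ‖-(q ^ n * t)‖ := by
  simpa using (summable_geometric_of_lt_one (norm_nonneg _) hq).mul_right ‖t‖

lemma multipliable_qProd {q : ℂ} (hq : ‖q‖ < 1) (t : ℂ) :
    Multipliable fun n : ℕ => 1 - q ^ n * t := by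
  simp_rw [sub_eq_add_neg]
  exact multipliable_one_add_of_summable (summable_norm_qProd hq t)

lemma qProd_eq {q : ℂ} (hq : ‖q‖ < 1) (t : ℂ) : qProd q t = (1 - t) * qProd q (q * t) := by
  have e : (fun n : ℕ => 1 - q ^ (n + 1) * t) = fun n : ℕ => 1 - q ^ n * (q * t) := by
    funext n
    rw [pow_succ, mul_assoc]
  have hm : Multipliable fun n : ℕ => 1 - q ^ (n + 1) * t := by
    rw [e]
    exact multipliable_qProd hq (q * t)
  have h := tprod_eq_zero_mul' (f := fun n : ℕ => 1 - q ^ n * t) hm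
  have h' : ∏' n : ℕ, (1 - q ^ (n + 1) * t) = qProd q (q * t) := congrArg tprod e
  rw [h', pow_zero, one_mul] at h
  exact h

lemma qProd_ne_zero {q : ℂ} (hq : ‖q‖ < 1) {t : ℂ} (h : ∀ n : ℕ, q ^ n * t ≠ 1) :
    qProd q t ≠ 0 := by
  unfold qProd
  simp_rw [sub_eq_add_neg]
  refine tprod_one_add_ne_zero_of_summable (fun n => ?_) (summable_norm_qProd hq t)
  rw [← sub_eq_add_neg, sub_ne_zero]
  exact (h n).symm

/-! ### The theta function -/

lemma exp_pi_mul_I' : Complex.exp (Real.pi * I) = -1 := Complex.exp_pi_mul_I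

lemma theta_add_one (τ z : ℂ) : theta τ (z + 1) = -theta τ z := by
  unfold theta
  rw [show z + 1 + τ / 2 + 1 / 2 = (z + τ / 2 + 1 / 2) + 1 by ring, jacobiTheta₂_add_left,
    show (Real.pi * I * τ / 4 + Real.pi * I * (z + 1) : ℂ)
      = (Real.pi * I * τ / 4 + Real.pi * I * z) + Real.pi * I by ring, Complex.exp_add _ (_ * I),
    Complex.exp_pi_mul_I]
  ring

lemma theta_add_tau (τ z : ℂ) :
    theta τ (z + τ) = -Complex.exp (-(Real.pi * I * τ) - 2 * Real.pi * I * z) * theta τ z := by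
  unfold theta
  rw [show z + τ + τ / 2 + 1 / 2 = (z + τ / 2 + 1 / 2) + τ by ring, jacobiTheta₂_add_left']
  have e : Complex.exp (Real.pi * I * τ / 4 + Real.pi * I * (z + τ))
      * Complex.exp (-Real.pi * I * (τ + 2 * (z + τ / 2 + 1 / 2)))
      = -Complex.exp (-(Real.pi * I * τ) - 2 * Real.pi * I * z)
        * Complex.exp (Real.pi * I * τ / 4 + Real.pi * I * z) := by
    rw [← Complex.exp_add, neg_mul (Complex.exp _), ← Complex.exp_add,
      show Real.pi * I * τ / 4 + Real.pi * I * (z + τ)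
        + -Real.pi * I * (τ + 2 * (z + τ / 2 + 1 / 2))
        = -(Real.pi * I * τ) - 2 * Real.pi * I * z + (Real.pi * I * τ / 4 + Real.pi * I * z)
          - Real.pi * I by ring, Complex.exp_sub _ (_ * I), exp_pi_mul_I', div_neg, div_one]
  rw [← mul_assoc, e, mul_assoc]

/-- The half-period shift in the definition makes `z + τ/2 + 1/2` and the opposite of `-z + τ/2 +
1/2` differ by the lattice vector `1 + τ`, so evenness of `jacobiTheta₂` and its two quasi-periods
give oddness. -/
lemma theta_neg (τ z : ℂ) : theta τ (-z) = -theta τ z := by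
  have e2 : jacobiTheta₂ (z + τ / 2 + 1 / 2) τ
      = Complex.exp (-Real.pi * I * (τ + 2 * (z - τ / 2 + 1 / 2)))
        * jacobiTheta₂ (-z + τ / 2 + 1 / 2) τ := by
    rw [show z + τ / 2 + 1 / 2 = (z - τ / 2 + 1 / 2) + τ by ring, jacobiTheta₂_add_left',
      show z - τ / 2 + 1 / 2 = -(-z + τ / 2 + 1 / 2) + 1 by ring, jacobiTheta₂_add_left,
      jacobiTheta₂_neg_left]
  unfold theta
  rw [e2, ← mul_assoc, ← Complex.exp_add, ← neg_mul]
  congr 1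
  rw [← neg_one_mul (Complex.exp _), ← exp_pi_mul_I', ← Complex.exp_add]
  congr 1
  ring

lemma theta_zero (τ : ℂ) : theta τ 0 = 0 := by
  have := theta_neg τ 0
  rw [neg_zero] at this
  linear_combination this / 2

lemma differentiable_theta {τ : ℂ} (hτ : 0 < τ.im) : Differentiable ℂ (theta τ) := by
  intro z
  unfold theta
  refine DifferentiableAt.mul (by fun_prop) ?_
  have := differentiableAt_jacobiTheta₂_fst (z + τ / 2 + 1 / 2) hτ
  exact this.comp z (f := fun z => z + τ / 2 + 1 / 2) (by fun_prop)

/-- The zeroth Fourier coefficient of `jacobiTheta₂ · τ` is `1`. -/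
lemma integral_jacobiTheta₂ {τ : ℂ} (hτ : 0 < τ.im) :
    ∫ x in (0 : ℝ)..1, jacobiTheta₂ x τ = 1 := by
  let f : ℤ → C(ℝ, ℂ) := fun m =>
    ⟨fun x => jacobiTheta₂_term m x τ, by unfold jacobiTheta₂_term; fun_prop⟩
  -- On the real axis every term has constant norm, so the series can be integrated termwise and
  -- only `m = 0` survives.
  have hnorm : ∀ (m : ℤ) (x : ℝ), ‖jacobiTheta₂_term m x τ‖ = ‖jacobiTheta₂_term m 0 τ‖ := by
    intro m x
    simp [norm_jacobiTheta₂_term]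
  have hsum : Summable fun m => ‖(f m).restrict
      (⟨Set.uIcc 0 1, isCompact_uIcc⟩ : TopologicalSpace.Compacts ℝ)‖ := by
    refine Summable.of_nonneg_of_le (fun _ => norm_nonneg _) (fun m => ?_)
      ((summable_jacobiTheta₂_term_iff 0 τ).2 hτ).norm
    rw [ContinuousMap.norm_le _ (norm_nonneg _)]
    intro x
    exact (hnorm m x).le
  have h := intervalIntegral.hasSum_intervalIntegral_of_summable_norm hsum
  have hint : ∀ m : ℤ, ∫ x in (0 : ℝ)..1, f m x = if m = 0 then 1 else 0 := by
    intro m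
    split_ifs with hm
    · simp [f, jacobiTheta₂_term, hm]
    · have hc : (2 * Real.pi * I * m : ℂ) ≠ 0 := by
        simp [Real.pi_ne_zero, I_ne_zero, hm]
      have : ∀ x : ℝ, f m x
          = Complex.exp (Real.pi * I * m ^ 2 * τ) * Complex.exp ((2 * Real.pi * I * m) * x) := by
        intro x
        simp only [f, jacobiTheta₂_term, ContinuousMap.coe_mk]
        rw [← Complex.exp_add, add_comm]
      simp_rw [this]
      rw [intervalIntegral.integral_const_mul, integral_exp_mul_complex hc]
      have : Complex.exp (2 * Real.pi * I * m * (1 : ℝ)) = 1 := by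
        rw [Complex.exp_eq_one_iff]
        exact ⟨m, by push_cast; ring⟩
      rw [this]
      simp
  simp_rw [hint] at h
  have h1 := h.unique (hasSum_ite_eq (0 : ℤ) (1 : ℂ))
  rw [← h1]
  rfl

/-- Otherwise the zeroth Fourier coefficient would be `0` instead of `1`. This excludes the constant
`0` in the comparison with the product. -/
lemma exists_theta_ne_zero {τ : ℂ} (hτ : 0 < τ.im) : ∃ z, theta τ z ≠ 0 := by
  by_contra! h
  have : ∀ x : ℝ, jacobiTheta₂ x τ = 0 := by
    intro x
    have := h (x - τ / 2 - 1 / 2)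
    unfold theta at this
    rw [show (x : ℂ) - τ / 2 - 1 / 2 + τ / 2 + 1 / 2 = x by ring] at this
    exact (mul_eq_zero.1 this).resolve_left (Complex.exp_ne_zero _)
  have h1 := integral_jacobiTheta₂ hτ
  simp [this] at h1

/-! ### The zeros of the theta function -/

/-- The product `exp (-πiz) ∏ (1 - qⁿ e^{2πiz}) ∏ (1 - qⁿ⁺¹ e^{-2πiz})`. -/
def thetaProd (τ z : ℂ) : ℂ :=
  Complex.exp (-(Real.pi * I * z))
    * (qProd (Complex.exp (2 * Real.pi * I * τ)) (Complex.exp (2 * Real.pi * I * z))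
      * qProd (Complex.exp (2 * Real.pi * I * τ))
        (Complex.exp (2 * Real.pi * I * τ) * Complex.exp (-(2 * Real.pi * I * z))))

lemma norm_nome_lt_one {τ : ℂ} (hτ : 0 < τ.im) : ‖Complex.exp (2 * Real.pi * I * τ)‖ < 1 := by
  rw [Complex.norm_exp, Real.exp_lt_one_iff]
  have : (2 * Real.pi * I * τ : ℂ).re = -(2 * Real.pi * τ.im) := by simp
  rw [this]
  have := Real.pi_pos
  have : 0 < 2 * Real.pi * τ.im := by positivity
  linarith

lemma differentiable_thetaProd {τ : ℂ} (hτ : 0 < τ.im) : Differentiable ℂ (thetaProd τ) := by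
  have h := differentiable_qProd (norm_nome_lt_one hτ)
  unfold thetaProd
  refine Differentiable.mul (by fun_prop) (Differentiable.mul (h.comp ?_) (h.comp ?_))
  · fun_prop
  · fun_prop

lemma thetaProd_add_one (τ z : ℂ) : thetaProd τ (z + 1) = -thetaProd τ z := by
  unfold thetaProd
  have e1 : Complex.exp (2 * Real.pi * I * (z + 1)) = Complex.exp (2 * Real.pi * I * z) := by
    rw [mul_add, mul_one, Complex.exp_add, Complex.exp_two_pi_mul_I, mul_one]
  have e2 : Complex.exp (-(2 * Real.pi * I * (z + 1))) = Complex.exp (-(2 * Real.pi * I * z)) := by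
    rw [Complex.exp_neg, e1, Complex.exp_neg]
  have e3 : Complex.exp (-(Real.pi * I * (z + 1))) = -Complex.exp (-(Real.pi * I * z)) := by
    rw [mul_add, mul_one, neg_add, Complex.exp_add, Complex.exp_neg (_ * I), exp_pi_mul_I']
    ring
  rw [e1, e2, e3]
  ring

lemma thetaProd_eq {τ : ℂ} (hτ : 0 < τ.im) (z : ℂ) :
    thetaProd τ z = (Complex.exp (-(Real.pi * I * z)) * (1 - Complex.exp (2 * Real.pi * I * z)))
      * (qProd (Complex.exp (2 * Real.pi * I * τ))
          (Complex.exp (2 * Real.pi * I * τ) * Complex.exp (2 * Real.pi * I * z))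
        * qProd (Complex.exp (2 * Real.pi * I * τ))
          (Complex.exp (2 * Real.pi * I * τ) * Complex.exp (-(2 * Real.pi * I * z)))) := by
  unfold thetaProd
  rw [qProd_eq (norm_nome_lt_one hτ) (Complex.exp (2 * Real.pi * I * z))]
  ring

lemma thetaProd_add_tau {τ : ℂ} (hτ : 0 < τ.im) (z : ℂ) : thetaProd τ (z + τ)
    = -Complex.exp (-(Real.pi * I * τ) - 2 * Real.pi * I * z) * thetaProd τ z := by
  rw [thetaProd_eq hτ z]
  unfold thetaProd
  set q := Complex.exp (2 * Real.pi * I * τ) with hq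
  have hq0 : q ≠ 0 := Complex.exp_ne_zero _
  have e1 : Complex.exp (2 * Real.pi * I * (z + τ)) = q * Complex.exp (2 * Real.pi * I * z) := by
    rw [hq, ← Complex.exp_add]; ring_nf
  have e2 : q * Complex.exp (-(2 * Real.pi * I * (z + τ)))
      = Complex.exp (-(2 * Real.pi * I * z)) := by
    rw [hq, ← Complex.exp_add]; ring_nf
  have e3 : Complex.exp (-(Real.pi * I * (z + τ)))
      = Complex.exp (-(Real.pi * I * z)) * Complex.exp (-(Real.pi * I * τ)) := by
    rw [← Complex.exp_add]; ring_nf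
  have e4 : Complex.exp (-(Real.pi * I * τ) - 2 * Real.pi * I * z)
      = Complex.exp (-(Real.pi * I * τ)) * Complex.exp (-(2 * Real.pi * I * z)) := by
    rw [← Complex.exp_add]; ring_nf
  have e5 : Complex.exp (-(2 * Real.pi * I * z)) * Complex.exp (2 * Real.pi * I * z) = 1 := by
    rw [← Complex.exp_add]; simp
  rw [e1, e2, e3, e4, qProd_eq (norm_nome_lt_one hτ) (Complex.exp (-(2 * Real.pi * I * z))), ← hq]
  linear_combination (Complex.exp (-(Real.pi * I * z)) * Complex.exp (-(Real.pi * I * τ))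
    * qProd q (q * Complex.exp (2 * Real.pi * I * z))
    * qProd q (q * Complex.exp (-(2 * Real.pi * I * z)))) * (-e5)

lemma inLattice_of_exp {τ z : ℂ} (n : ℤ)
    (h : Complex.exp (2 * Real.pi * I * (z + n * τ)) = 1) : InLattice τ z := by
  obtain ⟨m, hm⟩ := Complex.exp_eq_one_iff.1 h
  have hc : (2 * Real.pi * I : ℂ) ≠ 0 := by simp [Real.pi_ne_zero, I_ne_zero]
  have : z + n * τ = m := by
    apply mul_left_cancel₀ hc
    rw [hm]; ring
  exact ⟨m, -n, by push_cast; linear_combination this⟩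

/-- A convergent product vanishes only if a factor does. The factors of the first product test `z +
nτ` with `n ≥ 0`, those of the second `n < 0`. -/
lemma inLattice_of_thetaProd_eq_zero {τ : ℂ} (hτ : 0 < τ.im) {z : ℂ} (h : thetaProd τ z = 0) :
    InLattice τ z := by
  by_contra hz
  have hne : ∀ (n : ℤ), Complex.exp (2 * Real.pi * I * (z + n * τ)) ≠ 1 := fun n hn =>
    hz (inLattice_of_exp n hn)
  revert h
  unfold thetaProd
  refine mul_ne_zero (Complex.exp_ne_zero _) (mul_ne_zero ?_ ?_)
  · refine qProd_ne_zero (norm_nome_lt_one hτ) fun n hn => hne n ?_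
    rw [← hn, ← Complex.exp_nat_mul, ← Complex.exp_add]
    congr 1
    push_cast
    ring
  · refine qProd_ne_zero (norm_nome_lt_one hτ) fun n hn => hne (-(n + 1)) ?_
    have : Complex.exp (2 * Real.pi * I * (z + ((-(n + 1) : ℤ) : ℂ) * τ))
        = (Complex.exp (2 * Real.pi * I * τ) ^ n
          * (Complex.exp (2 * Real.pi * I * τ) * Complex.exp (-(2 * Real.pi * I * z))))⁻¹ := by
      rw [← Complex.exp_nat_mul, ← Complex.exp_add, ← Complex.exp_add, ← Complex.exp_neg]
      congr 1
      push_cast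
      ring
    rw [this, hn, inv_one]

/-- Zeros are transported by quasi-periodicity. -/
lemma lattice_zero_of_quasiperiodic {τ : ℂ} {F : ℂ → ℂ} (hF : Differentiable ℂ F)
    (h1 : ∀ z, F (z + 1) = -F z)
    (h2 : ∀ z, F (z + τ) = -Complex.exp (-(Real.pi * I * τ) - 2 * Real.pi * I * z) * F z)
    (h0 : F 0 = 0) {z : ℂ} (hz : InLattice τ z) :
    F z = 0 ∧ (deriv F 0 ≠ 0 → deriv F z ≠ 0) := by
  -- At a zero of `F`, differentiating `F(z + t) = m(z) F(z)` leaves only `m(z) F'(z)`; as `m` has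
  -- no zeros, the property passes between `z` and `z + t` in both directions.
  have key : ∀ (t : ℂ) (m : ℂ → ℂ), Differentiable ℂ m → (∀ z, m z ≠ 0) →
      (∀ z, F (z + t) = m z * F z) →
      ∀ z, (F z = 0 ∧ (deriv F 0 ≠ 0 → deriv F z ≠ 0)) ↔
        (F (z + t) = 0 ∧ (deriv F 0 ≠ 0 → deriv F (z + t) ≠ 0)) := by
    intro t m hmd hm h z
    have e0 : F (z + t) = 0 ↔ F z = 0 := by
      rw [h, mul_eq_zero]
      simp [hm]
    rw [e0]
    refine and_congr_right fun hFz => ?_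
    have hd : HasDerivAt (fun z => F (z + t)) (deriv F (z + t)) z := by
      simpa using (hF (z + t)).hasDerivAt.comp_add_const z t
    have hd' : HasDerivAt (fun z => F (z + t)) (m z * deriv F z) z := by
      have := (hmd z).hasDerivAt.mul (hF z).hasDerivAt
      rw [hFz, mul_zero, zero_add] at this
      exact this.congr_of_eventuallyEq (.of_forall fun w => h w)
    rw [hd.unique hd', mul_ne_zero_iff]
    simp [hm]
  have k1 := key 1 (fun _ => -1) (by fun_prop) (by simp) (fun z => by rw [h1]; ring)
  have k2 := key τ (fun z => -Complex.exp (-(Real.pi * I * τ) - 2 * Real.pi * I * z)) (by fun_prop)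
    (fun z => neg_ne_zero.2 (Complex.exp_ne_zero _)) h2
  obtain ⟨m, l, rfl⟩ := hz
  have step1 : ∀ m : ℤ, F m = 0 ∧ (deriv F 0 ≠ 0 → deriv F m ≠ 0) := by
    intro m
    induction m with
    | zero => simpa using h0
    | succ i ih => push_cast; exact (k1 _).1 ih
    | pred i ih =>
      refine (k1 _).2 ?_
      push_cast at ih ⊢
      rwa [sub_add_cancel]
  induction l with
  | zero => simpa using step1 m
  | succ i ih =>
    have := (k2 _).1 ih
    push_cast at this ⊢
    rwa [show (m : ℂ) + (i + 1) * τ = m + i * τ + τ by ring]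
  | pred i ih =>
    refine (k2 _).2 ?_
    push_cast at ih ⊢
    rwa [show (m : ℂ) + (-i - 1) * τ + τ = m + -i * τ by ring]

lemma thetaProd_zero {τ : ℂ} (hτ : 0 < τ.im) : thetaProd τ 0 = 0 := by
  rw [thetaProd_eq hτ]; simp

/-- Only the factor `1 - exp(2πiz)` vanishes at the origin, so the derivative there is `-2πi` times
the value `M 0` of the other factors. -/
lemma deriv_thetaProd_zero {τ : ℂ} (hτ : 0 < τ.im) : deriv (thetaProd τ) 0 ≠ 0 := by
  set q := Complex.exp (2 * Real.pi * I * τ) with hq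
  have hA := differentiable_qProd (norm_nome_lt_one hτ)
  set M : ℂ → ℂ := fun z => qProd q (q * Complex.exp (2 * Real.pi * I * z))
        * qProd q (q * Complex.exp (-(2 * Real.pi * I * z))) with hM
  have hMd : Differentiable ℂ M :=
    Differentiable.mul (hA.comp (by fun_prop)) (hA.comp (by fun_prop))
  have hM0 : M 0 ≠ 0 := by
    have hq1 : qProd q q ≠ 0 := by
      refine qProd_ne_zero (norm_nome_lt_one hτ) fun n hn => ?_
      have : ‖q ^ n * q‖ < 1 := by
        rw [← pow_succ, norm_pow]
        exact pow_lt_one₀ (norm_nonneg _) (norm_nome_lt_one hτ) (Nat.succ_ne_zero n)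
      rw [hn] at this
      simp at this
    simp only [hM, mul_zero, neg_zero, Complex.exp_zero, mul_one]
    exact mul_ne_zero hq1 hq1
  have hd1 : HasDerivAt (fun z : ℂ => Complex.exp (-(Real.pi * I * z))
      * (1 - Complex.exp (2 * Real.pi * I * z))) (-(2 * Real.pi * I)) 0 := by
    have a : HasDerivAt (fun z : ℂ => Complex.exp (-(Real.pi * I * z))) (-(Real.pi * I)) 0 := by
      have := ((hasDerivAt_id (0 : ℂ)).const_mul (-(Real.pi * I))).cexp
      simpa using this
    have b : HasDerivAt (fun z : ℂ => 1 - Complex.exp (2 * Real.pi * I * z))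
        (-(2 * Real.pi * I)) 0 := by
      have := (((hasDerivAt_id (0 : ℂ)).const_mul (2 * Real.pi * I)).cexp).const_sub 1
      simpa using this
    simpa using a.fun_mul b
  have hd2 := hd1.mul (hMd 0).hasDerivAt
  have : thetaProd τ = (fun z : ℂ => Complex.exp (-(Real.pi * I * z))
      * (1 - Complex.exp (2 * Real.pi * I * z))) * M := by
    funext z
    rw [thetaProd_eq hτ]
    rfl
  rw [this, hd2.deriv]
  simp [hM0, Real.pi_ne_zero, I_ne_zero]

/-- The Jacobi triple product up to its constant, by Liouville: both functions have the same
multipliers, and the zeros of the product are simple lattice points, where theta vanishes by oddness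
and quasi-periodicity. -/
lemma exists_theta_eq_mul_thetaProd {τ : ℂ} (hτ : 0 < τ.im) :
    ∃ c : ℂ, c ≠ 0 ∧ ∀ z, theta τ z = c * thetaProd τ z := by
  obtain ⟨c, hc⟩ := exists_const_mul_eq hτ (a := fun _ => -1)
    (b := fun z => -Complex.exp (-(Real.pi * I * τ) - 2 * Real.pi * I * z))
    (differentiable_theta hτ) (differentiable_thetaProd hτ)
    (fun z hz => ⟨(lattice_zero_of_quasiperiodic (differentiable_thetaProd hτ)
      (thetaProd_add_one τ) (thetaProd_add_tau hτ) (thetaProd_zero hτ)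
      (inLattice_of_thetaProd_eq_zero hτ hz)).2 (deriv_thetaProd_zero hτ),
      (lattice_zero_of_quasiperiodic (differentiable_theta hτ) (theta_add_one τ)
        (theta_add_tau τ) (theta_zero τ) (inLattice_of_thetaProd_eq_zero hτ hz)).1⟩)
    (by simp) (fun z => neg_ne_zero.2 (Complex.exp_ne_zero _))
    (fun z => by rw [theta_add_one]; ring) (fun z => by rw [thetaProd_add_one]; ring)
    (theta_add_tau τ) (thetaProd_add_tau hτ)
  refine ⟨c, ?_, hc⟩
  rintro rfl
  obtain ⟨z, hz⟩ := exists_theta_ne_zero hτ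
  exact hz (by rw [hc, zero_mul])

lemma theta_eq_zero_iff {τ : ℂ} (hτ : 0 < τ.im) {z : ℂ} : theta τ z = 0 ↔ InLattice τ z := by
  refine ⟨fun h => ?_, fun h => (lattice_zero_of_quasiperiodic (differentiable_theta hτ)
    (theta_add_one τ) (theta_add_tau τ) (theta_zero τ) h).1⟩
  obtain ⟨c, hc, h'⟩ := exists_theta_eq_mul_thetaProd hτ
  rw [h'] at h
  exact inLattice_of_thetaProd_eq_zero hτ ((mul_eq_zero.1 h).resolve_left hc)

lemma theta_ne_zero {τ : ℂ} (hτ : 0 < τ.im) {z : ℂ} (hz : ¬ InLattice τ z) : theta τ z ≠ 0 :=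
  fun h => hz ((theta_eq_zero_iff hτ).1 h)

lemma deriv_theta_zero_ne_zero {τ : ℂ} (hτ : 0 < τ.im) : deriv (theta τ) 0 ≠ 0 := by
  obtain ⟨c, hc, h'⟩ := exists_theta_eq_mul_thetaProd hτ
  rw [funext h', deriv_const_mul _ (differentiable_thetaProd hτ 0)]
  exact mul_ne_zero hc (deriv_thetaProd_zero hτ)

lemma deriv_theta_ne_zero {τ : ℂ} (hτ : 0 < τ.im) {z : ℂ} (hz : InLattice τ z) :
    deriv (theta τ) z ≠ 0 :=
  (lattice_zero_of_quasiperiodic (differentiable_theta hτ) (theta_add_one τ) (theta_add_tau τ)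
    (theta_zero τ) hz).2 (deriv_theta_zero_ne_zero hτ)

/-- The constant `b` can stay unspecified: only the part of the exponent linear in `z` matters for
logarithmic derivatives and for ratios of theta functions. -/
lemma theta_add_int_add_int_mul (τ : ℂ) (m l : ℤ) :
    ∃ b : ℂ, ∀ z, theta τ (z + (m + l * τ)) = Complex.exp (-(2 * Real.pi * I * l) * z + b)
      * theta τ z := by
  have h1 : ∀ m : ℤ, ∃ b : ℂ, ∀ z, theta τ (z + m) = Complex.exp b * theta τ z := by
    intro m
    induction m with
    | zero => exact ⟨0, by simp⟩
    | succ i ih =>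
      obtain ⟨b, hb⟩ := ih
      refine ⟨b + Real.pi * I, fun z => ?_⟩
      push_cast at hb ⊢
      rw [← add_assoc, theta_add_one, hb, Complex.exp_add, exp_pi_mul_I']
      ring
    | pred i ih =>
      obtain ⟨b, hb⟩ := ih
      refine ⟨b + Real.pi * I, fun z => ?_⟩
      push_cast at hb ⊢
      have := theta_add_one τ (z + (-i - 1))
      rw [show z + (-i - 1) + 1 = z + -(i : ℂ) by ring, hb] at this
      rw [Complex.exp_add, exp_pi_mul_I']
      linear_combination this
  have h2 : ∀ l : ℤ, ∃ b : ℂ, ∀ z, theta τ (z + l * τ)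
      = Complex.exp (-(2 * Real.pi * I * l) * z + b) * theta τ z := by
    intro l
    induction l with
    | zero => exact ⟨0, by simp⟩
    | succ i ih =>
      obtain ⟨b, hb⟩ := ih
      refine ⟨b + Real.pi * I - Real.pi * I * τ - 2 * Real.pi * I * i * τ, fun z => ?_⟩
      push_cast at hb ⊢
      rw [show z + (i + 1) * τ = z + i * τ + τ by ring, theta_add_tau, hb,
        ← neg_one_mul (Complex.exp _), ← exp_pi_mul_I', ← mul_assoc, ← Complex.exp_add,
        ← Complex.exp_add]
      congr 2
      ring
    | pred i ih =>
      obtain ⟨b, hb⟩ := ih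
      refine ⟨b - Real.pi * I + Real.pi * I * τ + 2 * Real.pi * I * (-i - 1) * τ, fun z => ?_⟩
      push_cast at hb ⊢
      have := theta_add_tau τ (z + (-i - 1) * τ)
      rw [show z + (-i - 1) * τ + τ = z + -(i : ℂ) * τ by ring, hb, ← neg_one_mul (Complex.exp _),
        ← exp_pi_mul_I', ← Complex.exp_add] at this
      apply mul_left_cancel₀ (Complex.exp_ne_zero _)
      rw [← this, ← mul_assoc, ← Complex.exp_add]
      congr 2
      ring
  obtain ⟨b, hb⟩ := h1 m
  obtain ⟨b', hb'⟩ := h2 l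
  refine ⟨b + b', fun z => ?_⟩
  rw [show z + (m + l * τ) = z + l * τ + m by ring, hb, hb', ← mul_assoc, ← Complex.exp_add]
  congr 2
  ring

/-! ### Three-term identities -/

section ThreeTerm

variable {τ : ℂ}

/-- The sum in Weierstrass' three-term identity. -/
def thetaThreeTerm (τ x y z w : ℂ) : ℂ :=
  theta τ (x + y) * theta τ (x - y) * (theta τ (z + w) * theta τ (z - w))
    + theta τ (y + z) * theta τ (y - z) * (theta τ (x + w) * theta τ (x - w))
    + theta τ (z + x) * theta τ (z - x) * (theta τ (y + w) * theta τ (y - w))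

/-- The contributions of `y` to the two multipliers are opposite. The common multiplier is thus free
of `y`, which gives all terms of the three-term identity the same behaviour in `x`. -/
lemma theta_mul_add_tau (x y : ℂ) : theta τ (x + τ + y) * theta τ (x + τ - y)
    = Complex.exp (-(2 * Real.pi * I * τ) - 4 * Real.pi * I * x)
      * (theta τ (x + y) * theta τ (x - y)) := by
  rw [show x + τ + y = x + y + τ by ring, show x + τ - y = x - y + τ by ring, theta_add_tau,
    theta_add_tau]
  have : Complex.exp (-(2 * Real.pi * I * τ) - 4 * Real.pi * I * x)
      = Complex.exp (-(Real.pi * I * τ) - 2 * Real.pi * I * (x + y))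
        * Complex.exp (-(Real.pi * I * τ) - 2 * Real.pi * I * (x - y)) := by
    rw [← Complex.exp_add]; ring_nf
  rw [this]
  ring

lemma theta_mul_add_one (x y : ℂ) : theta τ (x + 1 + y) * theta τ (x + 1 - y)
    = theta τ (x + y) * theta τ (x - y) := by
  rw [show x + 1 + y = x + y + 1 by ring, show x + 1 - y = x - y + 1 by ring, theta_add_one,
    theta_add_one]
  ring

/-- Oddness brings `x` into the form `θ(x + u) θ(x - u)` in each of the three terms. -/
lemma thetaThreeTerm_eq (x y z w : ℂ) : thetaThreeTerm τ x y z w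
    = theta τ (x + y) * theta τ (x - y) * (theta τ (z + w) * theta τ (z - w))
    + theta τ (y + z) * theta τ (y - z) * (theta τ (x + w) * theta τ (x - w))
    - theta τ (x + z) * theta τ (x - z) * (theta τ (y + w) * theta τ (y - w)) := by
  unfold thetaThreeTerm
  rw [← neg_sub x z, theta_neg, add_comm z x]
  ring

lemma exists_theta_mul_add_lattice {l : ℂ} (hl : InLattice τ l) (x : ℂ) :
    ∃ m : ℂ, ∀ u, theta τ (x + l + u) * theta τ (x + l - u)
      = m * (theta τ (x + u) * theta τ (x - u)) := by
  obtain ⟨m, n, rfl⟩ := hl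
  obtain ⟨b, hb⟩ := theta_add_int_add_int_mul τ m n
  refine ⟨Complex.exp (-(2 * Real.pi * I * n) * (2 * x) + 2 * b), fun u => ?_⟩
  rw [show x + (m + n * τ) + u = x + u + (m + n * τ) by ring,
    show x + (m + n * τ) - u = x - u + (m + n * τ) by ring, hb, hb]
  have : Complex.exp (-(2 * Real.pi * I * n) * (2 * x) + 2 * b)
      = Complex.exp (-(2 * Real.pi * I * n) * (x + u) + b)
        * Complex.exp (-(2 * Real.pi * I * n) * (x - u) + b) := by
    rw [← Complex.exp_add]; ring_nf
  rw [this]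
  ring

/-- When `x` is congruent to `y` or `-y`, the pairs `θ(x + u) θ(x - u)` and `θ(y + u) θ(y - u)` are
proportional with a factor independent of `u`, so the last two terms cancel while the first one
vanishes. -/
lemma thetaThreeTerm_eq_zero_of_inLattice {x y : ℂ} (hθ : theta τ (x + y) * theta τ (x - y) = 0)
    (h : InLattice τ (x + y) ∨ InLattice τ (x - y)) (z w : ℂ) :
    thetaThreeTerm τ x y z w = 0 := by
  have key : ∃ m : ℂ, ∀ u, theta τ (x + u) * theta τ (x - u)
      = m * (theta τ (y + u) * theta τ (y - u)) := by
    rcases h with h | h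
    · obtain ⟨m, hm⟩ := exists_theta_mul_add_lattice h (-y)
      refine ⟨m, fun u => ?_⟩
      have := hm u
      rw [show -y + (x + y) = x by ring, show -y + u = -(y - u) by ring,
        show -y - u = -(y + u) by ring, theta_neg, theta_neg] at this
      rw [this]; ring
    · obtain ⟨m, hm⟩ := exists_theta_mul_add_lattice h y
      refine ⟨m, fun u => ?_⟩
      have := hm u
      rwa [show y + (x - y) = x by ring] at this
  obtain ⟨m, hm⟩ := key
  rw [thetaThreeTerm_eq, hθ, hm w, hm z]
  ring

/-- As a function of `x` the sum has the multipliers of `θ(x + y) θ(x - y)`, whose zeros are simple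
because `2y` is not a lattice point. So it is a constant multiple of that product. The constant is
`0`, since at `x = z` the sum vanishes by oddness while the product does not. -/
lemma thetaThreeTerm_of_generic (hτ : 0 < τ.im) {y z : ℂ} (w : ℂ) (h2y : ¬ InLattice τ (2 * y))
    (hyz : ¬ InLattice τ (z + y)) (hyz' : ¬ InLattice τ (z - y)) (x : ℂ) :
    thetaThreeTerm τ x y z w = 0 := by
  have hθ := differentiable_theta hτ
  have hprod : ∀ u, Differentiable ℂ fun x => theta τ (x + u) * theta τ (x - u) := fun u =>
    (hθ.comp (by fun_prop)).mul (hθ.comp (by fun_prop))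
  obtain ⟨c, hc⟩ := exists_const_mul_eq hτ (F := fun x => thetaThreeTerm τ x y z w)
    (G := fun x => theta τ (x + y) * theta τ (x - y)) (a := fun _ => 1)
    (b := fun x => Complex.exp (-(2 * Real.pi * I * τ) - 4 * Real.pi * I * x))
    (by
      simp_rw [thetaThreeTerm_eq]
      exact (((hprod y).mul_const _).add ((hprod w).const_mul _)).sub ((hprod z).mul_const _))
    (hprod y)
    (by
      intro x hx
      have hd : deriv (fun x => theta τ (x + y) * theta τ (x - y)) x
          = deriv (theta τ) (x + y) * theta τ (x - y)
            + theta τ (x + y) * deriv (theta τ) (x - y) :=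
        (((hθ _).hasDerivAt.comp_add_const x y).fun_mul
          ((hθ _).hasDerivAt.comp_sub_const x y)).deriv
      have hnot : InLattice τ (x + y) → ¬ InLattice τ (x - y) := fun h h' => h2y (by
        have := h.sub h'
        rwa [show x + y - (x - y) = 2 * y by ring] at this)
      rw [hd]
      rcases mul_eq_zero.1 hx with h | h
      · have hl := (theta_eq_zero_iff hτ).1 h
        refine ⟨?_, thetaThreeTerm_eq_zero_of_inLattice hx (.inl hl) z w⟩
        rw [h, zero_mul, add_zero]
        exact mul_ne_zero (deriv_theta_ne_zero hτ hl) (theta_ne_zero hτ (hnot hl))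
      · have hl := (theta_eq_zero_iff hτ).1 h
        refine ⟨?_, thetaThreeTerm_eq_zero_of_inLattice hx (.inr hl) z w⟩
        rw [h, mul_zero, zero_add]
        exact mul_ne_zero (theta_ne_zero hτ fun h' => hnot h' hl) (deriv_theta_ne_zero hτ hl))
    (by simp) (fun _ => Complex.exp_ne_zero _)
    (fun x => by simp_rw [thetaThreeTerm_eq, theta_mul_add_one, one_mul])
    (fun x => by rw [theta_mul_add_one, one_mul])
    (fun x => by simp_rw [thetaThreeTerm_eq, theta_mul_add_tau]; ring)
    (fun x => theta_mul_add_tau x y)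
  have hz : thetaThreeTerm τ z y z w = 0 := by
    unfold thetaThreeTerm
    rw [sub_self, theta_zero, ← neg_sub z y, theta_neg, add_comm y z]
    ring
  have h0 := hc z
  rw [hz] at h0
  have hc0 : c = 0 := (mul_eq_zero.1 h0.symm).resolve_right
    (mul_ne_zero (theta_ne_zero hτ hyz) (theta_ne_zero hτ hyz'))
  rw [hc x, hc0, zero_mul]

/-- Weierstrass' three-term identity. -/
theorem thetaThreeTerm_eq_zero (hτ : 0 < τ.im) (x y z w : ℂ) : thetaThreeTerm τ x y z w = 0 := by
  -- The excluded values of `y` are countably many, hence have dense complement, and the identity is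
  -- continuous in `y`.
  have hcount : ({y | InLattice τ (2 * y)} ∪ ({y | InLattice τ (z + y)}
      ∪ {y | InLattice τ (z - y)})).Countable :=
    (countable_inLattice_of_injective τ (mul_right_injective₀ two_ne_zero)).union
      ((countable_inLattice_of_injective τ (add_right_injective z)).union
        (countable_inLattice_of_injective τ sub_right_injective))
  have hθ := (differentiable_theta hτ).continuous
  have hcont : Continuous fun y => thetaThreeTerm τ x y z w := by
    unfold thetaThreeTerm
    fun_prop
  have := hcont.ext_on (hcount.dense_compl ℝ) continuous_const (g := fun _ => 0) ?_
  · exact congrFun this y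
  · intro y hy
    simp only [Set.mem_compl_iff, Set.mem_union, Set.mem_ofPred_eq, not_or] at hy
    exact thetaThreeTerm_of_generic hτ w hy.1 hy.2.1 hy.2.2 x

end ThreeTerm

/-! ### The functions `E₁`, `E₂` and `φ` -/

section Eisenstein

variable {τ : ℂ}

lemma deriv_theta_neg (z : ℂ) : deriv (theta τ) (-z) = deriv (theta τ) z := by
  have h : (fun z => theta τ (-z)) = fun z => -theta τ z := funext (theta_neg τ)
  have h1 := congrArg (fun f => deriv f z) h
  simp only [deriv.fun_neg] at h1
  rw [deriv_comp_neg] at h1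
  exact neg_injective h1

lemma E1_neg (z : ℂ) : E1 τ (-z) = -E1 τ z := by
  unfold E1
  rw [deriv_theta_neg, theta_neg, div_neg]

lemma deriv_theta_eq (hτ : 0 < τ.im) {z : ℂ} (hz : ¬ InLattice τ z) :
    deriv (theta τ) z = E1 τ z * theta τ z := by
  unfold E1
  rw [div_mul_cancel₀ _ (theta_ne_zero hτ hz)]

lemma E1_add_lattice (hτ : 0 < τ.im) {z : ℂ} (hz : ¬ InLattice τ z) (m l : ℤ) :
    E1 τ (z + (m + l * τ)) = E1 τ z - 2 * Real.pi * I * l := by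
  obtain ⟨b, hb⟩ := theta_add_int_add_int_mul τ m l
  have hθ := differentiable_theta hτ
  have h1 : HasDerivAt (fun z => theta τ (z + (m + l * τ)))
      (deriv (theta τ) (z + (m + l * τ))) z := (hθ _).hasDerivAt.comp_add_const z _
  have h2 : HasDerivAt (fun z => Complex.exp (-(2 * Real.pi * I * l) * z + b) * theta τ z)
      (Complex.exp (-(2 * Real.pi * I * l) * z + b) * (-(2 * Real.pi * I * l)) * theta τ z
        + Complex.exp (-(2 * Real.pi * I * l) * z + b) * deriv (theta τ) z) z := by
    refine HasDerivAt.fun_mul ?_ (hθ z).hasDerivAt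
    simpa using (((hasDerivAt_id z).const_mul (-(2 * Real.pi * I * l))).add_const b).cexp
  rw [← funext hb] at h2
  unfold E1
  have hz0 := theta_ne_zero hτ hz
  have he := Complex.exp_ne_zero (-(2 * Real.pi * I * l) * z + b)
  rw [h1.unique h2, hb]
  field_simp
  ring

lemma differentiableAt_E1 (hτ : 0 < τ.im) {z : ℂ} (hz : ¬ InLattice τ z) :
    DifferentiableAt ℂ (E1 τ) z := by
  have hθ := differentiable_theta hτ
  exact ((hθ.contDiff (n := 2)).differentiable_deriv_two z).div (hθ z) (theta_ne_zero hτ hz)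

lemma hasDerivAt_E1 (hτ : 0 < τ.im) {z : ℂ} (hz : ¬ InLattice τ z) :
    HasDerivAt (E1 τ) (-E2 τ z) z := by
  have := (differentiableAt_E1 hτ hz).hasDerivAt
  rwa [E2, neg_neg]

lemma isClosed_inLattice (hτ : 0 < τ.im) : IsClosed {z | InLattice τ z} := by
  have : {z | InLattice τ z} = theta τ ⁻¹' {0} := by
    ext z
    simp [theta_eq_zero_iff hτ]
  rw [this]
  exact isClosed_singleton.preimage (differentiable_theta hτ).continuous

/-- Differentiate the three-term identity in `x` at `x = y`: the factor `θ(x - y)` vanishes there,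
so its term contributes only through `θ'(0)`. Keeping `θ(a + b + c)` as a factor allows `a + b + c`
to be a lattice point, as the Fay identities below require. -/
lemma E1_sum_mul_theta (hτ : 0 < τ.im) {a b c : ℂ} (ha : ¬ InLattice τ a)
    (hb : ¬ InLattice τ b) (hc : ¬ InLattice τ c) :
    (E1 τ a + E1 τ b + E1 τ c) * theta τ (a + b + c) - deriv (theta τ) (a + b + c)
      = deriv (theta τ) 0 * (theta τ (a + b) * theta τ (a + c) * theta τ (b + c))
        / (theta τ a * theta τ b * theta τ c) := by
  have hθ := differentiable_theta hτ
  -- Chosen so that `y ± w` are `a, b`, while `y + z = -c` and `y - z = a + b + c`.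
  set y := (a + b) / 2 with hy
  set z := -(c + (a + b) / 2) with hz
  set w := (a - b) / 2 with hw
  have hD : ∀ u, HasDerivAt (fun x => theta τ (x + u)) (deriv (theta τ) (y + u)) y := fun u =>
    (hθ _).hasDerivAt.comp_add_const y u
  have hD' : ∀ u, HasDerivAt (fun x => theta τ (x - u)) (deriv (theta τ) (y - u)) y := fun u =>
    (hθ _).hasDerivAt.comp_sub_const y u
  have h1 := (((hD y).fun_mul (hD' y)).mul_const (theta τ (z + w) * theta τ (z - w))).add
    ((((hD w).fun_mul (hD' w)).const_mul (theta τ (y + z) * theta τ (y - z))))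
  have h2 := h1.fun_sub (((hD z).fun_mul (hD' z)).mul_const (theta τ (y + w) * theta τ (y - w)))
  have h0 : HasDerivAt (fun x => thetaThreeTerm τ x y z w) 0 y := by
    simp_rw [thetaThreeTerm_eq_zero hτ]
    exact hasDerivAt_const y 0
  simp_rw [thetaThreeTerm_eq] at h0
  have h3 := h2.unique h0
  rw [sub_self, theta_zero, show y + y = a + b by rw [hy]; ring, show y + w = a by rw [hy, hw]; ring,
    show y - w = b by rw [hy, hw]; ring, show y + z = -c by rw [hy, hz]; ring,
    show y - z = a + b + c by rw [hy, hz]; ring, show z + w = -(b + c) by rw [hz, hw]; ring,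
    show z - w = -(a + c) by rw [hz, hw]; ring, theta_neg, theta_neg, theta_neg,
    deriv_theta_neg, deriv_theta_eq hτ ha, deriv_theta_eq hτ hb, deriv_theta_eq hτ hc] at h3
  have ha' := theta_ne_zero hτ ha
  have hb' := theta_ne_zero hτ hb
  have hc' := theta_ne_zero hτ hc
  rw [eq_div_iff (by simp [ha', hb', hc'])]
  linear_combination -h3

lemma E1_sum_eq (hτ : 0 < τ.im) {a b c : ℂ} (ha : ¬ InLattice τ a) (hb : ¬ InLattice τ b)
    (hc : ¬ InLattice τ c) (habc : ¬ InLattice τ (a + b + c)) :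
    E1 τ a + E1 τ b + E1 τ c - E1 τ (a + b + c)
      = deriv (theta τ) 0 * (theta τ (a + b) * theta τ (a + c) * theta τ (b + c))
        / (theta τ a * theta τ b * theta τ c * theta τ (a + b + c)) := by
  have h := E1_sum_mul_theta hτ ha hb hc
  rw [deriv_theta_eq hτ habc, ← sub_mul] at h
  rw [← div_div, ← h, mul_div_cancel_right₀ _ (theta_ne_zero hτ habc)]

/-- The derivative of `φ` in its first argument. -/
lemma deriv_phi (hτ : 0 < τ.im) {u : ℂ} (hu : ¬ InLattice τ u) (z : ℂ) :
    deriv (fun u => phi τ u z) u = (deriv (theta τ) (u + z) - E1 τ u * theta τ (u + z))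
      * deriv (theta τ) 0 / (theta τ u * theta τ z) := by
  have hθ := differentiable_theta hτ
  have h1 := theta_ne_zero hτ hu
  -- For a lattice point `z` the denominator is `0`, and both sides are `0` by the convention for
  -- division.
  by_cases hz : InLattice τ z
  · have hz0 := (theta_eq_zero_iff hτ).2 hz
    have : ∀ u, phi τ u z = 0 := fun u => by
      unfold phi
      rw [hz0, mul_zero, div_zero]
    simp [this, hz0]
  have h2 := theta_ne_zero hτ hz
  have h := (((hθ _).hasDerivAt.comp_add_const u z).mul_const (deriv (theta τ) 0)).fun_div
    ((hθ u).hasDerivAt.mul_const (theta τ z)) (mul_ne_zero h1 h2)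
  refine h.deriv.trans ?_
  unfold E1
  field_simp

/-- The degenerate Fay identity. -/
lemma phi_mul_phi (hτ : 0 < τ.im) {u z w : ℂ} (hu : ¬ InLattice τ u) (hz : ¬ InLattice τ z)
    (hw : ¬ InLattice τ w) (hzw : ¬ InLattice τ (z + w)) :
    phi τ u z * phi τ u w
      = phi τ u (z + w) * (E1 τ z + E1 τ w) - deriv (fun u => phi τ u (z + w)) u := by
  have h := E1_sum_mul_theta hτ hz hw hu
  rw [deriv_phi hτ hu]
  rw [show z + w + u = u + (z + w) by ring] at h
  have h1 := theta_ne_zero hτ hu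
  have h2 := theta_ne_zero hτ hz
  have h3 := theta_ne_zero hτ hw
  have h4 := theta_ne_zero hτ hzw
  have h5 : phi τ u (z + w) * (E1 τ z + E1 τ w)
      - (deriv (theta τ) (u + (z + w)) - E1 τ u * theta τ (u + (z + w)))
      * deriv (theta τ) 0 / (theta τ u * theta τ (z + w))
      = ((E1 τ z + E1 τ w + E1 τ u) * theta τ (u + (z + w)) - deriv (theta τ) (u + (z + w)))
        * deriv (theta τ) 0 / (theta τ u * theta τ (z + w)) := by
    unfold phi
    ring
  rw [h5, h]
  unfold phi
  rw [add_comm z u, add_comm w u]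
  field_simp

/-- The product of two `φ` with the same second argument. -/
lemma phi_mul_phi' (hτ : 0 < τ.im) {u v t : ℂ} (hu : ¬ InLattice τ u) (hv : ¬ InLattice τ v)
    (huv : ¬ InLattice τ (u + v)) (ht : ¬ InLattice τ t) :
    phi τ u t * phi τ v t
      = phi τ (u + v) t * (E1 τ u + E1 τ v - E1 τ (u + v) + E1 τ t)
        - deriv (fun u => phi τ u t) (u + v) := by
  have h := E1_sum_mul_theta hτ hu hv ht
  rw [deriv_phi hτ huv]
  have h1 := theta_ne_zero hτ hu
  have h2 := theta_ne_zero hτ hv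
  have h3 := theta_ne_zero hτ ht
  have h4 := theta_ne_zero hτ huv
  have h5 : phi τ (u + v) t * (E1 τ u + E1 τ v - E1 τ (u + v) + E1 τ t)
      - (deriv (theta τ) (u + v + t) - E1 τ (u + v) * theta τ (u + v + t))
      * deriv (theta τ) 0 / (theta τ (u + v) * theta τ t)
      = ((E1 τ u + E1 τ v + E1 τ t) * theta τ (u + v + t) - deriv (theta τ) (u + v + t))
        * deriv (theta τ) 0 / (theta τ (u + v) * theta τ t) := by
    unfold phi
    ring
  rw [h5, h]
  unfold phi
  field_simp

lemma phi_neg_neg (u z : ℂ) : phi τ (-u) (-z) = -phi τ u z := by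
  unfold phi
  rw [← neg_add, theta_neg, theta_neg, theta_neg]
  ring

/-- The Fay identity. -/
lemma phi_mul_phi_eq (hτ : 0 < τ.im) {u v z w : ℂ} (hu : ¬ InLattice τ u) (hv : ¬ InLattice τ v)
    (huv : ¬ InLattice τ (u + v)) (hz : ¬ InLattice τ z) (hw : ¬ InLattice τ w)
    (hzw : ¬ InLattice τ (z - w)) :
    phi τ u z * phi τ v w
      = phi τ (u + v) z * phi τ v (w - z) + phi τ (u + v) w * phi τ u (z - w) := by
  -- These half-sums make the twelve sums and differences equal, up to sign, to the theta arguments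
  -- left after clearing denominators.
  have h := thetaThreeTerm_eq_zero hτ ((2 * u + v + z) / 2) ((v + z) / 2) ((v + 2 * w - z) / 2)
    ((v - z) / 2)
  unfold thetaThreeTerm at h
  rw [show (2 * u + v + z) / 2 + (v + z) / 2 = u + v + z by ring,
    show (2 * u + v + z) / 2 - (v + z) / 2 = u by ring,
    show (v + 2 * w - z) / 2 + (v - z) / 2 = v + (w - z) by ring,
    show (v + 2 * w - z) / 2 - (v - z) / 2 = w by ring,
    show (v + z) / 2 + (v + 2 * w - z) / 2 = v + w by ring,
    show (v + z) / 2 - (v + 2 * w - z) / 2 = z - w by ring,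
    show (2 * u + v + z) / 2 + (v - z) / 2 = u + v by ring,
    show (2 * u + v + z) / 2 - (v - z) / 2 = u + z by ring,
    show (v + 2 * w - z) / 2 + (2 * u + v + z) / 2 = u + v + w by ring,
    show (v + 2 * w - z) / 2 - (2 * u + v + z) / 2 = -(u + (z - w)) by ring,
    show (v + z) / 2 + (v - z) / 2 = v by ring,
    show (v + z) / 2 - (v - z) / 2 = z by ring, theta_neg] at h
  have h1 := theta_ne_zero hτ hu
  have h2 := theta_ne_zero hτ hv
  have h3 := theta_ne_zero hτ huv
  have h4 := theta_ne_zero hτ hz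
  have h5 := theta_ne_zero hτ hw
  have h6 := theta_ne_zero hτ hzw
  unfold phi
  rw [← neg_sub z w, theta_neg τ (z - w), neg_sub z w]
  field_simp
  linear_combination deriv (theta τ) 0 ^ 2 * h

/-- Differentiate `E1_sum_eq` for the triple `x, b, u` in `b` at `b = -x`. The factor `θ(x + b)` on
the right vanishes there, so only its derivative `θ'(0)` contributes; on the left the derivatives of
`E₁` give the two values of `E₂`. -/
lemma E2_sub_E2 (hτ : 0 < τ.im) {x u : ℂ} (hx : ¬ InLattice τ x) (hu : ¬ InLattice τ u) :
    phi τ u x * phi τ (-u) x = E2 τ x - E2 τ u := by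
  have hθ := differentiable_theta hτ
  have hx' : ¬ InLattice τ (-x) := fun h => hx (inLattice_neg_iff.1 h)
  have hcomp : ∀ v, Differentiable ℂ fun b => theta τ (b + v) := fun v =>
    hθ.comp (by fun_prop)
  have ev : ∀ᶠ b in 𝓝 (-x), ¬ InLattice τ b ∧ ¬ InLattice τ (x + b + u) := by
    refine ((isClosed_inLattice hτ).isOpen_compl.eventually_mem hx').and ?_
    have hc : ContinuousAt (fun b => x + b + u) (-x) := by fun_prop
    refine hc.eventually ((isClosed_inLattice hτ).isOpen_compl.eventually_mem ?_)
    simpa using hu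
  have hl : HasDerivAt (fun b => E1 τ x + E1 τ b + E1 τ u - E1 τ (x + b + u))
      (-E2 τ (-x) - -E2 τ (x + -x + u)) (-x) := by
    refine (((hasDerivAt_E1 hτ hx').const_add _).add_const _).sub ?_
    have : HasDerivAt (E1 τ) (-E2 τ (x + -x + u)) (x + -x + u) :=
      hasDerivAt_E1 hτ (by simpa using hu)
    have h2 : HasDerivAt (fun b => x + b + u) 1 (-x) :=
      ((hasDerivAt_id (-x)).const_add x).add_const u
    simpa [Function.comp_def] using this.comp (-x) h2
  have hθ1 : HasDerivAt (fun b => theta τ (x + b)) (deriv (theta τ) 0) (-x) := by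
    have := (hθ (x + -x)).hasDerivAt.comp_const_add x (-x)
    simpa using this
  set g : ℂ → ℂ := fun b => deriv (theta τ) 0 * (theta τ (x + u) * theta τ (b + u))
        / (theta τ x * theta τ b * theta τ u * theta τ (x + b + u)) with hg
  have hgd : DifferentiableAt ℂ g (-x) := by
    refine DifferentiableAt.div ?_ ?_ ?_
    · exact ((hcomp u (-x)).const_mul _).const_mul _
    · refine (((hθ _).const_mul _).mul_const _).mul ?_
      have : (fun b => theta τ (x + b + u)) = fun b => theta τ (b + (x + u)) := by
        funext b; congr 1; ring
      rw [this]
      exact hcomp (x + u) (-x)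
    · have : theta τ (x + -x + u) ≠ 0 := by
        rw [add_neg_cancel, zero_add]; exact theta_ne_zero hτ hu
      exact mul_ne_zero (mul_ne_zero (mul_ne_zero (theta_ne_zero hτ hx) (theta_ne_zero hτ hx'))
        (theta_ne_zero hτ hu)) this
  have hr := hθ1.fun_mul hgd.hasDerivAt
  have heq : (fun b => E1 τ x + E1 τ b + E1 τ u - E1 τ (x + b + u))
      =ᶠ[𝓝 (-x)] fun b => theta τ (x + b) * g b := by
    filter_upwards [ev] with b hb
    rw [E1_sum_eq hτ hx hb.1 hu hb.2, hg]
    ring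
  have hE2 : E2 τ (-x) = E2 τ x := by
    have h := funext (E1_neg (τ := τ))
    have h1 := congrArg (fun f => deriv f x) h
    simp only [deriv.fun_neg] at h1
    rw [deriv_comp_neg] at h1
    unfold E2
    linear_combination h1
  have h := hl.unique (hr.congr_of_eventuallyEq heq)
  rw [add_neg_cancel, theta_zero, zero_mul, add_zero, zero_add, hE2, hg] at h
  simp only [add_neg_cancel, zero_add] at h
  have h1 := theta_ne_zero hτ hu
  have h2 := theta_ne_zero hτ hx
  have h3 : phi τ u x * phi τ (-u) x = -(E2 τ u - E2 τ x) := by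
    rw [show E2 τ u - E2 τ x = -E2 τ x - -E2 τ u by ring, h]
    unfold phi
    rw [theta_neg τ u, theta_neg τ x, add_comm x u, show -u + x = -(-x + u) by ring,
      theta_neg τ (-x + u)]
    field_simp
  rw [h3]; ring

end Eisenstein

/-! ### Indices modulo `N` -/

section Indices

variable {N : ℕ}

lemma cls_add (a b : ℤ × ℤ) : cls N (a + b) = cls N a + cls N b := by
  simp [cls]

lemma cls_neg (a : ℤ × ℤ) : cls N (-a) = -cls N a := by
  simp [cls]

lemma cls_sub (a b : ℤ × ℤ) : cls N (a - b) = cls N a - cls N b := by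
  simp [cls]

lemma cls_zero : cls N 0 = 0 := by
  simp [cls]

lemma cls_shift (a v : ℤ × ℤ) : cls N (a + (N : ℤ) • v) = cls N a := by
  simp [cls]

lemma exists_shift_of_cls_eq {a b : ℤ × ℤ} (h : cls N a = cls N b) :
    ∃ v : ℤ × ℤ, a = b + (N : ℤ) • v := by
  simp only [cls, Prod.mk.injEq] at h
  obtain ⟨h1, h2⟩ := h
  have h1' := (ZMod.intCast_eq_intCast_iff_dvd_sub _ _ _).1 h1.symm
  have h2' := (ZMod.intCast_eq_intCast_iff_dvd_sub _ _ _).1 h2.symm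
  obtain ⟨m, hm⟩ := h1'
  obtain ⟨l, hl⟩ := h2'
  refine ⟨(m, l), Prod.ext ?_ ?_⟩
  · simp; linarith
  · simp; linarith

lemma cls_rep [NeZero N] (c : Idx N) : cls N (rep c) = c := by
  simp [cls, rep]

lemma rep_zero [NeZero N] : rep (0 : Idx N) = 0 := by
  simp [rep]

/-- Functions of a pair of integers that depend on its class modulo `N` only. -/
def ClassFun (N : ℕ) (k : ℤ × ℤ → ℂ) : Prop := ∀ a v : ℤ × ℤ, k (a + (N : ℤ) • v) = k a

lemma ClassFun.congr {k : ℤ × ℤ → ℂ} (hk : ClassFun N k) {a b : ℤ × ℤ} (h : cls N a = cls N b) :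
    k a = k b := by
  obtain ⟨v, rfl⟩ := exists_shift_of_cls_eq h
  exact hk b v

/-- The exponent of the sign by which `T_a` changes under `a ↦ a + N v`. -/
def shiftExp (N : ℕ) (a v : ℤ × ℤ) : ℤ := v.1 * a.2 + v.2 * a.1 + N * v.1 * v.2

/-- Functions of a pair of integers that change under translations by `N ℤ²` like `T_a`. -/
def Twisted (N : ℕ) (f : ℤ × ℤ → ℂ) : Prop :=
  ∀ a v : ℤ × ℤ, f (a + (N : ℤ) • v) = (-1) ^ shiftExp N a v * f a

lemma Twisted.mul_classFun {f k : ℤ × ℤ → ℂ} (hf : Twisted N f) (hk : ClassFun N k) :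
    Twisted N fun a => f a * k a := fun a v => by
  simp only [hf a v, hk a v, mul_assoc]

lemma Twisted.const_mul {f : ℤ × ℤ → ℂ} (hf : Twisted N f) (c : ℂ) :
    Twisted N fun a => c * f a := fun a v => by
  simp only [hf a v]; ring

lemma Twisted.add {f g : ℤ × ℤ → ℂ} (hf : Twisted N f) (hg : Twisted N g) :
    Twisted N fun a => f a + g a := fun a v => by
  simp only [hf a v, hg a v, mul_add]

lemma Twisted.sum {ι : Type*} (s : Finset ι) {f : ι → ℤ × ℤ → ℂ} (hf : ∀ i, Twisted N (f i)) :
    Twisted N fun a => ∑ i ∈ s, f i a := fun a v => by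
  simp_rw [fun i => hf i a v, Finset.mul_sum]

/-- Twisted functions with the same values on the representatives are equal. -/
lemma Twisted.ext_rep [NeZero N] {f g : ℤ × ℤ → ℂ} (hf : Twisted N f) (hg : Twisted N g)
    (h : ∀ c : Idx N, f (rep c) = g (rep c)) (a : ℤ × ℤ) : f a = g a := by
  obtain ⟨v, hv⟩ := exists_shift_of_cls_eq (N := N) (a := a) (b := rep (cls N a)) (cls_rep _).symm
  rw [hv, hf, hg, h]

/-- The sign `exp (πi (a₁ a₂ - r₁ r₂) / N)`. -/
def sgn (N : ℕ) (a : ℤ × ℤ) : ℂ :=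
  Complex.exp (Real.pi * I / N
      * ((a.1 * a.2 - (rep (cls N a)).1 * (rep (cls N a)).2 : ℤ) : ℂ))

lemma exp_pi_mul_int (k : ℤ) : Complex.exp (Real.pi * I * k) = (-1) ^ k := by
  rw [mul_comm, Complex.exp_int_mul, Complex.exp_pi_mul_I]

lemma neg_one_zpow_congr {k l : ℤ} (h : Even (k - l)) : (-1 : ℂ) ^ k = (-1) ^ l := by
  have : k = (k - l) + l := by ring
  rw [this, zpow_add₀ (by norm_num), h.neg_one_zpow, one_mul]

lemma twisted_sgn [NeZero N] : Twisted N (sgn N) := by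
  intro a v
  have hN : (N : ℂ) ≠ 0 := Nat.cast_ne_zero.2 (NeZero.ne N)
  unfold sgn
  rw [cls_shift, ← exp_pi_mul_int, ← Complex.exp_add]
  congr 1
  simp only [shiftExp, Prod.fst_add, Prod.snd_add, Prod.smul_fst, Prod.smul_snd, smul_eq_mul]
  push_cast
  field_simp
  ring

lemma sgn_rep [NeZero N] (c : Idx N) : sgn N (rep c) = 1 := by
  simp [sgn, cls_rep]

lemma twisted_sgn_mul [NeZero N] (g : Idx N → ℂ) : Twisted N fun a => sgn N a * g (cls N a) :=
  twisted_sgn.mul_classFun fun a v => by rw [cls_shift]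

/-! ### Sums over representatives -/

/-- The individual factors of the sums below change sign with the representative, so indices stay
integral; only the full summand descends to classes, and then any map inducing a bijection of
classes reindexes the sum. -/
lemma sum_rep_congr [NeZero N] {k : ℤ × ℤ → ℂ} (hk : ClassFun N k) (e : Idx N ≃ Idx N)
    (h : ℤ × ℤ → ℤ × ℤ) (he : ∀ c, cls N (h (rep c)) = e c) :
    ∑ c : Idx N, k (h (rep c)) = ∑ c : Idx N, k (rep c) := by
  refine (Finset.sum_congr rfl fun c _ => hk.congr ?_).trans (e.sum_comp fun c => k (rep c))
  rw [he, cls_rep]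

lemma sum_rep_sub_left [NeZero N] {k : ℤ × ℤ → ℂ} (hk : ClassFun N k) (d : ℤ × ℤ) :
    ∑ c : Idx N, k (d - rep c) = ∑ c : Idx N, k (rep c) :=
  sum_rep_congr hk (Equiv.subLeft (cls N d)) (fun g => d - g) fun c => by
    simp [cls_sub, cls_rep]

lemma sum_rep_neg [NeZero N] {k : ℤ × ℤ → ℂ} (hk : ClassFun N k) :
    ∑ c : Idx N, k (-rep c) = ∑ c : Idx N, k (rep c) :=
  sum_rep_congr hk (Equiv.neg _) (fun g => -g) fun c => by simp [cls_neg, cls_rep]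

lemma sum_rep_add_right [NeZero N] {k : ℤ × ℤ → ℂ} (hk : ClassFun N k) (d : ℤ × ℤ) :
    ∑ c : Idx N, k (rep c + d) = ∑ c : Idx N, k (rep c) :=
  sum_rep_congr hk (Equiv.addRight (cls N d)) (fun g => g + d) fun c => by
    simp [cls_add, cls_rep]

/-! ### The structure constants -/

/-- `α × β = α₁ β₂ - α₂ β₁`. -/
def cross (a b : ℤ × ℤ) : ℤ := a.1 * b.2 - a.2 * b.1

/-- `sin (π t / N)`. -/
def sinN (N : ℕ) (t : ℤ) : ℂ := Complex.sin (Real.pi / N * (t : ℂ))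

lemma C_eq (a b : ℤ × ℤ) : C N a b = N / Real.pi * sinN N (cross a b) := rfl

lemma sinN_neg (t : ℤ) : sinN N (-t) = -sinN N t := by
  unfold sinN
  rw [← Complex.sin_neg]
  push_cast
  ring_nf

lemma sinN_add_mul [NeZero N] (t k : ℤ) : sinN N (t + N * k) = (-1) ^ k * sinN N t := by
  have hN : (N : ℂ) ≠ 0 := Nat.cast_ne_zero.2 (NeZero.ne N)
  unfold sinN
  rw [show (Real.pi / N * ((t + N * k : ℤ) : ℂ) : ℂ) = Real.pi / N * t + k * Real.pi by
    push_cast; field_simp, Complex.sin_add, Complex.sin_int_mul_pi]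
  have : Complex.cos (k * Real.pi) = (-1) ^ k := by
    have h := exp_pi_mul_int k
    rw [show (Real.pi * I * k : ℂ) = k * Real.pi * I by ring, Complex.exp_mul_I,
      Complex.sin_int_mul_pi, zero_mul, add_zero] at h
    exact h
  rw [this]
  ring

lemma sinN_mul [NeZero N] (k : ℤ) : sinN N (N * k) = 0 := by
  have := sinN_add_mul (N := N) 0 k
  simpa [sinN] using this

lemma C_swap (a b : ℤ × ℤ) : C N b a = -C N a b := by
  rw [C_eq, C_eq, show cross b a = -cross a b by simp only [cross]; ring, sinN_neg]
  ring

lemma C_neg_left (a b : ℤ × ℤ) : C N (-a) b = -C N a b := by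
  rw [C_eq, C_eq, show cross (-a) b = -cross a b by simp [cross]; ring, sinN_neg]
  ring

lemma C_neg_right (a b : ℤ × ℤ) : C N a (-b) = -C N a b := by
  rw [C_swap, C_neg_left, C_swap a b, neg_neg]

lemma C_congr {a b a' b' : ℤ × ℤ} (h : cross a b = cross a' b') : C N a b = C N a' b' := by
  rw [C_eq, C_eq, h]

lemma C_congr_neg {a b a' b' : ℤ × ℤ} (h : cross a b = -cross a' b') : C N a b = -C N a' b' := by
  rw [C_eq, C_eq, h, sinN_neg]; ring

lemma C_sub_left (a d : ℤ × ℤ) : C N (d - a) d = -C N a d :=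
  C_congr_neg (by simp [cross]; ring)

lemma C_self_sub (a b : ℤ × ℤ) : C N a (a - b) = -C N a b :=
  C_congr_neg (by simp [cross]; ring)

lemma C_neg_sub (a b : ℤ × ℤ) : C N (-b) (a - b) = C N a b :=
  C_congr (by simp [cross]; ring)

lemma C_shift_left [NeZero N] (a v b : ℤ × ℤ) :
    C N (a + (N : ℤ) • v) b = (-1) ^ cross v b * C N a b := by
  rw [C_eq, C_eq, show cross (a + (N : ℤ) • v) b = cross a b + N * cross v b by
    simp [cross]; ring, sinN_add_mul]
  ring

lemma C_shift_right [NeZero N] (a v b : ℤ × ℤ) :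
    C N b (a + (N : ℤ) • v) = (-1) ^ cross v b * C N b a := by
  rw [C_swap, C_shift_left, C_swap a b]
  ring

lemma C_zero_left (b : ℤ × ℤ) : C N 0 b = 0 := by simp [C]

lemma C_self (a : ℤ × ℤ) : C N a a = 0 := by
  rw [C, show a.1 * a.2 - a.2 * a.1 = 0 by ring]; simp

lemma C_of_cls_eq [NeZero N] {a b : ℤ × ℤ} (h : cls N a = cls N b) : C N a b = 0 := by
  obtain ⟨v, rfl⟩ := exists_shift_of_cls_eq h
  rw [C_shift_left, C_self, mul_zero]

lemma C_of_cls_eq_zero [NeZero N] {a : ℤ × ℤ} (h : cls N a = 0) (b : ℤ × ℤ) : C N a b = 0 := by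
  obtain ⟨v, rfl⟩ := exists_shift_of_cls_eq (N := N) (a := a) (b := 0) (by rw [h, cls_zero])
  rw [C_shift_left, C_zero_left, mul_zero]

/-! ### The twisted convolution -/

/-- The summand of `twConv`. -/
def twTerm (N : ℕ) (s t k : ℤ × ℤ → ℂ) (a b g : ℤ × ℤ) : ℂ :=
  C N g (a - b) * s (a - g) * t (b + g) * k g

/-- `∑_γ C(γ, α - β) s_{α - γ} t_{β + γ} k_γ`. -/
def twConv (N : ℕ) [NeZero N] (s t k : ℤ × ℤ → ℂ) (a b : ℤ × ℤ) : ℂ :=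
  ∑ c : Idx N, twTerm N s t k a b (rep c)

variable [NeZero N] {s t k : ℤ × ℤ → ℂ}

/-- The signs of `C`, `s` and `t` have an even total exponent, whose half is the explicit witness in
the proof. -/
lemma classFun_twTerm (hs : Twisted N s) (ht : Twisted N t) (hk : ClassFun N k) (a b : ℤ × ℤ) :
    ClassFun N (twTerm N s t k a b) := by
  intro g v
  unfold twTerm
  rw [C_shift_left, hk, show a - (g + (N : ℤ) • v) = (a - g) + (N : ℤ) • (-v) by
    rw [smul_neg]; abel, show b + (g + (N : ℤ) • v) = (b + g) + (N : ℤ) • v by abel, hs, ht]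
  have h : (-1 : ℂ) ^ cross v (a - b) * (-1) ^ shiftExp N (a - g) (-v)
      * (-1) ^ shiftExp N (b + g) v = 1 := by
    rw [← zpow_add₀ (by norm_num), ← zpow_add₀ (by norm_num)]
    refine Even.neg_one_zpow ?_
    refine ⟨v.1 * g.2 + v.2 * (b.1 + g.1 - a.1) + N * v.1 * v.2, ?_⟩
    simp only [cross, shiftExp, Prod.fst_sub, Prod.snd_sub, Prod.fst_add, Prod.snd_add,
      Prod.fst_neg, Prod.snd_neg]
    ring
  linear_combination (C N g (a - b) * s (a - g) * t (b + g) * k g) * h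

/-- Holds termwise with γ fixed: the signs of `C` and `s` combine, modulo an even exponent, to that
of the translation of `a`. -/
lemma twisted_twConv_left (hs : Twisted N s) (b : ℤ × ℤ) :
    Twisted N fun a => twConv N s t k a b := by
  intro a v
  simp only [twConv, Finset.mul_sum]
  refine Finset.sum_congr rfl fun c _ => ?_
  generalize rep c = g
  unfold twTerm
  rw [show a + (N : ℤ) • v - b = a - b + (N : ℤ) • v by abel, C_shift_right,
    show a + (N : ℤ) • v - g = a - g + (N : ℤ) • v by abel, hs]
  have h : (-1 : ℂ) ^ cross v g * (-1) ^ shiftExp N (a - g) v = (-1) ^ shiftExp N a v := by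
    rw [← zpow_add₀ (by norm_num)]
    refine neg_one_zpow_congr ⟨-(v.2 * g.1), ?_⟩
    simp only [cross, shiftExp, Prod.fst_sub, Prod.snd_sub]
    ring
  linear_combination (C N g (a - b) * s (a - g) * t (b + g) * k g) * h

/-- The symmetry `γ ↦ -γ`. -/
lemma twConv_swap (hs : Twisted N s) (ht : Twisted N t) (hk : ClassFun N k) (a b : ℤ × ℤ) :
    twConv N s t k a b = twConv N t s (fun g => k (-g)) b a := by
  unfold twConv
  rw [← sum_rep_neg (classFun_twTerm hs ht hk a b)]
  refine Finset.sum_congr rfl fun c _ => ?_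
  unfold twTerm
  rw [show a - b = -(b - a) by abel, C_neg_left, C_neg_right, neg_neg, sub_neg_eq_add,
    ← sub_eq_add_neg]
  ring

lemma twisted_twConv_right (hs : Twisted N s) (ht : Twisted N t) (hk : ClassFun N k)
    (a : ℤ × ℤ) : Twisted N fun b => twConv N s t k a b := by
  intro b v
  simp only [twConv_swap hs ht hk a]
  exact twisted_twConv_left ht a b v

/-- The symmetry `γ ↦ α - β - γ`. -/
lemma twConv_flip (hs : Twisted N s) (ht : Twisted N t) (hk : ClassFun N k) (a b : ℤ × ℤ) :
    twConv N s t k a b = -twConv N t s (fun g => k (a - b - g)) a b := by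
  unfold twConv
  rw [← sum_rep_sub_left (classFun_twTerm hs ht hk a b) (a - b), ← Finset.sum_neg_distrib]
  refine Finset.sum_congr rfl fun c _ => ?_
  unfold twTerm
  rw [C_sub_left, show a - (a - b - rep c) = b + rep c by abel,
    show b + (a - b - rep c) = a - rep c by abel]
  ring

/-- With constant weight, `γ ↦ α - β - γ` only exchanges the factors `s_{α-γ}`, `t_{β+γ}` and
reverses the sign of `C`. -/
lemma twConv_one_antisymm (hs : Twisted N s) (ht : Twisted N t) (a b : ℤ × ℤ) :
    twConv N s t (fun _ => 1) a b = -twConv N t s (fun _ => 1) a b :=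
  twConv_flip hs ht (fun _ _ => rfl) a b

end Indices

/-! ### The functions `φ_γ`, `f_γ` and `E₁(γ̆)` -/

section Varphi

variable {N : ℕ} {τ : ℂ}

lemma breve_add (a b : ℤ × ℤ) : breve N τ (a + b) = breve N τ a + breve N τ b := by
  simp only [breve, Prod.fst_add, Prod.snd_add]
  push_cast
  ring

lemma breve_neg (a : ℤ × ℤ) : breve N τ (-a) = -breve N τ a := by
  simp only [breve, Prod.fst_neg, Prod.snd_neg]
  push_cast
  ring

lemma breve_shift [NeZero N] (a v : ℤ × ℤ) :
    breve N τ (a + (N : ℤ) • v) = breve N τ a + (v.1 + v.2 * τ) := by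
  have hN : (N : ℂ) ≠ 0 := Nat.cast_ne_zero.2 (NeZero.ne N)
  simp only [breve, Prod.fst_add, Prod.snd_add, Prod.smul_fst, Prod.smul_snd, smul_eq_mul]
  push_cast
  field_simp
  ring

lemma inLattice_breve [NeZero N] (hτ : 0 < τ.im) {a : ℤ × ℤ} :
    InLattice τ (breve N τ a) ↔ cls N a = 0 := by
  constructor
  · rintro ⟨m, l, h⟩
    have hN : (N : ℂ) ≠ 0 := Nat.cast_ne_zero.2 (NeZero.ne N)
    unfold breve at h
    rw [div_eq_iff hN] at h
    have h2 := congrArg Complex.im h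
    have h1 := congrArg Complex.re h
    simp at h1 h2
    have h3 : (a.2 : ℝ) = N * l := by
      apply mul_right_cancel₀ hτ.ne'
      linarith
    rw [h3] at h1
    have h4 : (a.1 : ℝ) = N * m := by linarith
    have h3' : a.2 = N * l := by exact_mod_cast h3
    have h4' : a.1 = N * m := by exact_mod_cast h4
    simp [cls, h3', h4']
  · intro h
    obtain ⟨v, rfl⟩ := exists_shift_of_cls_eq (N := N) (a := a) (b := 0) (by rw [h, cls_zero])
    rw [breve_shift]
    exact ⟨v.1, v.2, by simp [breve]⟩

lemma not_inLattice_breve [NeZero N] (hτ : 0 < τ.im) {a : ℤ × ℤ} (ha : cls N a ≠ 0) :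
    ¬ InLattice τ (breve N τ a) := fun h => ha ((inLattice_breve hτ).1 h)

lemma phi_add_lattice (u z : ℂ) (m l : ℤ) :
    phi τ (u + (m + l * τ)) z = Complex.exp (-(2 * Real.pi * I * l) * z) * phi τ u z := by
  obtain ⟨b, hb⟩ := theta_add_int_add_int_mul τ m l
  unfold phi
  rw [show u + (m + l * τ) + z = u + z + (m + l * τ) by ring, hb, hb,
    show -(2 * Real.pi * I * l) * (u + z) + b
      = -(2 * Real.pi * I * l) * z + (-(2 * Real.pi * I * l) * u + b) by ring,
    Complex.exp_add (-(2 * Real.pi * I * l) * z)]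
  have := Complex.exp_ne_zero (-(2 * Real.pi * I * l) * u + b)
  field_simp

lemma eN_shift [NeZero N] (a v : ℤ × ℤ) (z : ℂ) : eN N ((a + (N : ℤ) • v).2 * z)
    * Complex.exp (-(2 * Real.pi * I * v.2) * z) = eN N (a.2 * z) := by
  have hN : (N : ℂ) ≠ 0 := Nat.cast_ne_zero.2 (NeZero.ne N)
  unfold eN
  rw [← Complex.exp_add]
  congr 1
  simp only [Prod.snd_add, Prod.smul_snd, smul_eq_mul]
  push_cast
  field_simp
  ring

lemma eN_add (z w : ℂ) : eN N (z + w) = eN N z * eN N w := by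
  unfold eN
  rw [← Complex.exp_add, mul_add]

/-- The factor `e_N(γ₂ z)` is there for this purpose: it compensates the multiplier that `φ(u, z)`
acquires under a lattice translation of `u`. -/
lemma classFun_varphi [NeZero N] (z : ℂ) : ClassFun N fun g => varphi N τ g z := by
  intro a v
  simp only [varphi]
  rw [breve_shift, phi_add_lattice, ← mul_assoc, eN_shift]

lemma varphi_neg_neg (g : ℤ × ℤ) (z : ℂ) : varphi N τ (-g) (-z) = -varphi N τ g z := by
  simp only [varphi]
  rw [breve_neg, phi_neg_neg, Prod.snd_neg, Int.cast_neg, neg_mul_neg, mul_neg]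

/-- `φ_γ`, extended by `0` to `γ = 0`. -/
def varphi0 (N : ℕ) (τ : ℂ) (g : ℤ × ℤ) (z : ℂ) : ℂ :=
  if cls N g = 0 then 0 else varphi N τ g z

/-- `φ_γ`, extended by `E₁` to `γ = 0`. -/
def varphiE (N : ℕ) (τ : ℂ) (g : ℤ × ℤ) (z : ℂ) : ℂ :=
  if cls N g = 0 then E1 τ z else varphi N τ g z

/-- The constant term of `φ_γ` at the origin. -/
def varphiConst (N : ℕ) (τ : ℂ) (g : ℤ × ℤ) : ℂ :=
  if cls N g = 0 then 0 else E1 τ (breve N τ g) + 2 * Real.pi * I * g.2 / N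

lemma varphi0_of_ne {g : ℤ × ℤ} (h : cls N g ≠ 0) (z : ℂ) :
    varphi0 N τ g z = varphi N τ g z := if_neg h

lemma varphiE_of_ne {g : ℤ × ℤ} (h : cls N g ≠ 0) (z : ℂ) :
    varphiE N τ g z = varphi N τ g z := if_neg h

lemma varphiE_of_eq {g : ℤ × ℤ} (h : cls N g = 0) (z : ℂ) :
    varphiE N τ g z = E1 τ z := if_pos h

lemma varphiConst_of_ne {g : ℤ × ℤ} (h : cls N g ≠ 0) :
    varphiConst N τ g = E1 τ (breve N τ g) + 2 * Real.pi * I * g.2 / N := if_neg h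

lemma varphiConst_of_eq {g : ℤ × ℤ} (h : cls N g = 0) : varphiConst N τ g = 0 := if_pos h

lemma classFun_varphi0 [NeZero N] (z : ℂ) : ClassFun N fun g => varphi0 N τ g z := by
  intro a v
  have h := classFun_varphi (N := N) (τ := τ) z a v
  simp only at h
  simp only [varphi0, cls_shift, h]

lemma classFun_varphiE [NeZero N] (z : ℂ) : ClassFun N fun g => varphiE N τ g z := by
  intro a v
  have h := classFun_varphi (N := N) (τ := τ) z a v
  simp only at h
  simp only [varphiE, cls_shift, h]

/-- The jump `-2πi v₂` of `E₁` under a lattice translation is undone by the term `2πi γ₂ / N`. -/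
lemma classFun_varphiConst [NeZero N] (hτ : 0 < τ.im) : ClassFun N (varphiConst N τ) := by
  intro a v
  have hN : (N : ℂ) ≠ 0 := Nat.cast_ne_zero.2 (NeZero.ne N)
  by_cases ha : cls N a = 0
  · rw [varphiConst_of_eq ha, varphiConst_of_eq (by rw [cls_shift, ha])]
  · rw [varphiConst_of_ne ha, varphiConst_of_ne (by rwa [cls_shift]), breve_shift,
      E1_add_lattice hτ (not_inLattice_breve hτ ha)]
    simp only [Prod.snd_add, Prod.smul_snd, smul_eq_mul]
    push_cast
    field_simp
    ring

lemma varphi0_neg_neg (g : ℤ × ℤ) (z : ℂ) : varphi0 N τ (-g) (-z) = -varphi0 N τ g z := by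
  simp only [varphi0, cls_neg, neg_eq_zero, varphi_neg_neg]
  split_ifs <;> simp

lemma varphiConst_neg (g : ℤ × ℤ) : varphiConst N τ (-g) = -varphiConst N τ g := by
  simp only [varphiConst, cls_neg, neg_eq_zero, breve_neg, E1_neg, Prod.snd_neg]
  split_ifs
  · simp
  · push_cast
    ring

/-- The Fay identity for `φ_γ`. -/
lemma varphi_mul_varphi [NeZero N] (hτ : 0 < τ.im) {a b : ℤ × ℤ} (ha : cls N a ≠ 0)
    (hb : cls N b ≠ 0) (hab : cls N (a + b) ≠ 0) {z w : ℂ} (hz : ¬ InLattice τ z)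
    (hw : ¬ InLattice τ w) (hzw : ¬ InLattice τ (z - w)) :
    varphi N τ a z * varphi N τ b w
      = varphi N τ (a + b) z * varphi N τ b (w - z)
        + varphi N τ (a + b) w * varphi N τ a (z - w) := by
  have h := phi_mul_phi_eq hτ (not_inLattice_breve hτ ha) (not_inLattice_breve hτ hb)
    (by rw [← breve_add]; exact not_inLattice_breve hτ hab) hz hw hzw
  have e1 : eN N ((a + b).2 * z) * eN N (b.2 * (w - z)) = eN N (a.2 * z) * eN N (b.2 * w) := by
    rw [← eN_add, ← eN_add, Prod.snd_add]; push_cast; ring_nf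
  have e2 : eN N ((a + b).2 * w) * eN N (a.2 * (z - w)) = eN N (a.2 * z) * eN N (b.2 * w) := by
    rw [← eN_add, ← eN_add, Prod.snd_add]; push_cast; ring_nf
  simp only [varphi]
  rw [breve_add]
  linear_combination eN N (a.2 * z) * eN N (b.2 * w) * h
    - phi τ (breve N τ a + breve N τ b) z * phi τ (breve N τ b) (w - z) * e1
    - phi τ (breve N τ a + breve N τ b) w * phi τ (breve N τ a) (z - w) * e2

lemma varphi_mul_varphi_same [NeZero N] (hτ : 0 < τ.im) {a : ℤ × ℤ} (ha : cls N a ≠ 0) {z w : ℂ}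
    (hz : ¬ InLattice τ z) (hw : ¬ InLattice τ w) (hzw : ¬ InLattice τ (z + w)) :
    varphi N τ a z * varphi N τ a w
      = varphi N τ a (z + w) * (E1 τ z + E1 τ w) - fFun N τ a (z + w) := by
  have h := phi_mul_phi hτ (not_inLattice_breve hτ ha) hz hw hzw
  have e1 : eN N (a.2 * (z + w)) = eN N (a.2 * z) * eN N (a.2 * w) := by
    rw [← eN_add]; ring_nf
  simp only [varphi, fFun]
  rw [e1]
  linear_combination eN N (a.2 * z) * eN N (a.2 * w) * h

/-- Passing from `E₁` at the points of order `N` to `varphiConst` costs nothing, because the added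
terms are linear in the index and cancel in this combination. -/
lemma varphi_mul_varphi_same_arg [NeZero N] (hτ : 0 < τ.im) {a b : ℤ × ℤ} (ha : cls N a ≠ 0)
    (hb : cls N b ≠ 0) (hab : cls N (a + b) ≠ 0) {t : ℂ} (ht : ¬ InLattice τ t) :
    varphi N τ a t * varphi N τ b t
      = varphi N τ (a + b) t
          * (varphiConst N τ a + varphiConst N τ b - varphiConst N τ (a + b) + E1 τ t)
        - fFun N τ (a + b) t := by
  have h := phi_mul_phi' hτ (not_inLattice_breve hτ ha) (not_inLattice_breve hτ hb)
    (by rw [← breve_add]; exact not_inLattice_breve hτ hab) ht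
  have e1 : eN N ((a + b).2 * t) = eN N (a.2 * t) * eN N (b.2 * t) := by
    rw [← eN_add, Prod.snd_add]; push_cast; ring_nf
  rw [varphiConst_of_ne ha, varphiConst_of_ne hb, varphiConst_of_ne hab]
  simp only [varphi, fFun]
  rw [e1, breve_add, Prod.snd_add]
  push_cast
  linear_combination eN N (a.2 * t) * eN N (b.2 * t) * h

lemma varphi_mul_varphi_neg [NeZero N] (hτ : 0 < τ.im) {a : ℤ × ℤ} (ha : cls N a ≠ 0) {t : ℂ}
    (ht : ¬ InLattice τ t) :
    varphi N τ a t * varphi N τ (-a) t = E2 τ t - E2 τ (breve N τ a) := by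
  have h := E2_sub_E2 hτ ht (not_inLattice_breve hτ ha)
  have e1 : eN N (a.2 * t) * eN N ((-a).2 * t) = 1 := by
    rw [← eN_add, Prod.snd_neg]; push_cast; simp [eN]
  simp only [varphi]
  rw [breve_neg]
  linear_combination h + phi τ (breve N τ a) t * phi τ (-breve N τ a) t * e1

open Classical in
/-- The Fay identity for the extended functions. -/
lemma varphiE_mul_varphiE [NeZero N] (hτ : 0 < τ.im) {a b : ℤ × ℤ} (hab : cls N (a + b) ≠ 0)
    {z w : ℂ} (hz : ¬ InLattice τ z) (hw : ¬ InLattice τ w) (hzw : ¬ InLattice τ (z - w)) :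
    varphiE N τ a z * varphiE N τ b w
      = varphi N τ (a + b) z * varphiE N τ b (w - z)
        + varphi N τ (a + b) w * varphiE N τ a (z - w)
        + (if cls N a = 0 then fFun N τ (a + b) w else 0)
        + (if cls N b = 0 then fFun N τ (a + b) z else 0) := by
  have hwz : ¬ InLattice τ (w - z) := fun h => hzw (inLattice_sub_comm.1 h)
  by_cases ha : cls N a = 0
  · have hb : cls N b ≠ 0 := fun hb => hab (by rw [cls_add, ha, hb, add_zero])
    have hc : cls N b = cls N (a + b) := by rw [cls_add, ha, zero_add]
    rw [varphiE_of_eq ha, varphiE_of_ne hb, varphiE_of_ne hb, varphiE_of_eq ha, if_pos ha,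
      if_neg hb, (classFun_varphi w).congr hc, (classFun_varphi (w - z)).congr hc]
    -- The degenerate Fay identity for the arguments `z` and `w - z`, whose sum is `w`, solved for
    -- the product with `E₁`.
    have h := varphi_mul_varphi_same hτ hab hz hwz (by simpa using hw)
    rw [add_sub_cancel, ← neg_sub z w, E1_neg, neg_sub] at h
    linear_combination -h
  · by_cases hb : cls N b = 0
    · have hc : cls N a = cls N (a + b) := by rw [cls_add, hb, add_zero]
      rw [varphiE_of_ne ha, varphiE_of_eq hb, varphiE_of_eq hb, varphiE_of_ne ha, if_neg ha,
        if_pos hb, (classFun_varphi z).congr hc, (classFun_varphi (z - w)).congr hc]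
      have h := varphi_mul_varphi_same hτ hab hw hzw (by simpa using hz)
      rw [add_sub_cancel, ← neg_sub w z, E1_neg, neg_sub] at h
      linear_combination -h
    · rw [varphiE_of_ne ha, varphiE_of_ne hb, varphiE_of_ne hb, varphiE_of_ne ha, if_neg ha,
        if_neg hb, varphi_mul_varphi hτ ha hb hab hz hw hzw]
      ring

-- When one index is in the zero class the product is literally `E₁(t) φ_{α+β}(t)`, and the
-- conditional terms cancel the `f` of the generic formula.
open Classical in
lemma varphiE_mul_varphiE_same_arg [NeZero N] (hτ : 0 < τ.im) {a b : ℤ × ℤ}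
    (hab : cls N (a + b) ≠ 0) {t : ℂ} (ht : ¬ InLattice τ t) :
    varphiE N τ a t * varphiE N τ b t
      = varphi N τ (a + b) t
          * (varphiConst N τ a + varphiConst N τ b - varphiConst N τ (a + b) + E1 τ t)
        - fFun N τ (a + b) t + (if cls N a = 0 then fFun N τ (a + b) t else 0)
        + (if cls N b = 0 then fFun N τ (a + b) t else 0) := by
  by_cases ha : cls N a = 0
  · have hb : cls N b ≠ 0 := fun hb => hab (by rw [cls_add, ha, hb, add_zero])
    have hc : cls N b = cls N (a + b) := by rw [cls_add, ha, zero_add]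
    rw [varphiE_of_eq ha, varphiE_of_ne hb, varphiConst_of_eq ha, if_pos ha, if_neg hb,
      (classFun_varphi t).congr hc, (classFun_varphiConst hτ).congr hc]
    ring
  · by_cases hb : cls N b = 0
    · have hc : cls N a = cls N (a + b) := by rw [cls_add, hb, add_zero]
      rw [varphiE_of_ne ha, varphiE_of_eq hb, varphiConst_of_eq hb, if_neg ha, if_pos hb,
        (classFun_varphi t).congr hc, (classFun_varphiConst hτ).congr hc]
      ring
    · rw [varphiE_of_ne ha, varphiE_of_ne hb, if_neg ha, if_neg hb,
        varphi_mul_varphi_same_arg hτ ha hb hab ht]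
      ring

end Varphi

lemma sum_eq_add_sum_ne {n : ℕ} (k : Fin n) (f : Fin n → ℂ) :
    ∑ j, f j = f k + ∑ j with j ≠ k, f j := by
  rw [← Finset.add_sum_erase Finset.univ f (Finset.mem_univ k)]
  congr 1
  refine Finset.sum_congr ?_ fun _ _ => rfl
  ext j
  simp

/-! ### Coefficients of the exchange relation and their partial fractions -/

section Coefficients

open Classical

variable {n N : ℕ} [NeZero N] {τ : ℂ} {x : Fin n → ℂ} {s0 : ℂ} {s : Fin n → ℤ × ℤ → ℂ}

/-- The coefficient of `T_a` in the Lax matrix. -/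
def laxCoeff (N : ℕ) (τ : ℂ) (x : Fin n → ℂ) (s0 : ℂ) (s : Fin n → ℤ × ℤ → ℂ) (z : ℂ)
    (a : ℤ × ℤ) : ℂ :=
  (if cls N a = 0 then sgn N a * s0 else 0) + ∑ j, s j a * varphiE N τ a (z - x j)

lemma twisted_zeroPart (s0 : ℂ) : Twisted N fun a => if cls N a = 0 then sgn N a * s0 else 0 := by
  have h : Twisted N fun a => sgn N a * (fun c : Idx N => if c = 0 then s0 else 0) (cls N a) :=
    twisted_sgn_mul (N := N) fun c => if c = 0 then s0 else 0
  simpa only [mul_ite, mul_zero] using h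

lemma twisted_laxCoeff (hs : ∀ j, Twisted N (s j)) (z : ℂ) :
    Twisted N (laxCoeff N τ x s0 s z) :=
  (twisted_zeroPart s0).add (Twisted.sum _ fun j => (hs j).mul_classFun (classFun_varphiE _))

/-- The coefficient of `T_α ⊗ T_β` in the right-hand side of the exchange relation. -/
def exchCoeff (N : ℕ) [NeZero N] (τ : ℂ) (x : Fin n → ℂ) (s0 : ℂ) (s : Fin n → ℤ × ℤ → ℂ)
    (z w : ℂ) (a b : ℤ × ℤ) : ℂ :=
  twConv N (laxCoeff N τ x s0 s z) (laxCoeff N τ x s0 s w) (fun g => varphi0 N τ g (z - w)) a b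

/-- Antisymmetry of the r-matrix, `φ_{-γ}(-z) = -φ_γ(z)`, combined with the symmetry `γ ↦ -γ` of the
convolution. -/
lemma exchCoeff_swap (hs : ∀ j, Twisted N (s j)) (z w : ℂ) (a b : ℤ × ℤ) :
    exchCoeff N τ x s0 s z w a b = -exchCoeff N τ x s0 s w z b a := by
  unfold exchCoeff
  rw [twConv_swap (twisted_laxCoeff hs z) (twisted_laxCoeff hs w) (classFun_varphi0 _)]
  simp only [twConv, ← Finset.sum_neg_distrib]
  refine Finset.sum_congr rfl fun c _ => ?_
  unfold twTerm
  have h : varphi0 N τ (-rep c) (z - w) = -varphi0 N τ (rep c) (w - z) := by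
    rw [← neg_sub w z, varphi0_neg_neg]
  simp only [h]
  ring

/-- The part of the bracket of `S^j` with itself that is attached to its second factor. -/
def selfPart (N : ℕ) (τ : ℂ) (x : Fin n → ℂ) (s0 : ℂ) (s : Fin n → ℤ × ℤ → ℂ) (j : Fin n)
    (a : ℤ × ℤ) : ℂ :=
  -((if cls N a = 0 then sgn N a * s0 else 0)
    + (∑ k with k ≠ j, s k a * varphiE N τ a (x j - x k) + s j a * varphiConst N τ a))

/-- The bracket `{S^j_α, S^k_β}` for `α, β ≠ 0`. -/
def coeffSS (N : ℕ) [NeZero N] (τ : ℂ) (x : Fin n → ℂ) (s0 : ℂ) (s : Fin n → ℤ × ℤ → ℂ)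
    (j k : Fin n) (a b : ℤ × ℤ) : ℂ :=
  if j = k then
    twConv N (s j) (selfPart N τ x s0 s j) (fun _ => 1) a b
      + twConv N (s j) (s j) (varphiConst N τ) a b
  else twConv N (s j) (s k) (fun g => varphi0 N τ g (x j - x k)) a b

/-- The sum in the bracket `{S^m_0, S^k_β}`. -/
def coeffPair (N : ℕ) [NeZero N] (τ : ℂ) (x : Fin n → ℂ) (s : Fin n → ℤ × ℤ → ℂ)
    (m k : Fin n) (b : ℤ × ℤ) : ℂ :=
  twConv N (s k) (s m) (fun g => varphi0 N τ g (x k - x m)) b 0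

/-- The bracket `{S^j_0, S^k_β}` for `β ≠ 0`. -/
def coeffS0jS (N : ℕ) [NeZero N] (τ : ℂ) (x : Fin n → ℂ) (s : Fin n → ℤ × ℤ → ℂ)
    (j k : Fin n) (b : ℤ × ℤ) : ℂ :=
  if j = k then ∑ m with m ≠ k, coeffPair N τ x s m k b else -coeffPair N τ x s j k b

/-- The bracket `{S_0, S^k_β}` for `β ≠ 0`. -/
def coeffS0S (N : ℕ) [NeZero N] (τ : ℂ) (x : Fin n → ℂ) (s : Fin n → ℤ × ℤ → ℂ)
    (k : Fin n) (b : ℤ × ℤ) : ℂ :=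
  -twConv N (s k) (s k) (fun g => E2 τ (breve N τ g)) b 0
    + ∑ m with m ≠ k, twConv N (s k) (s m) (fun g => fFun N τ g (x k - x m)) b 0

/-- Compatibility with the relation `∑ S^j_0 = 0`, needed for the brackets to define a bivector on
the phase space. -/
lemma sum_coeffS0jS (k : Fin n) (b : ℤ × ℤ) : ∑ j, coeffS0jS N τ x s j k b = 0 := by
  rw [sum_eq_add_sum_ne k]
  unfold coeffS0jS
  rw [if_pos rfl, ← sub_neg_eq_add, ← Finset.sum_neg_distrib, sub_eq_zero]
  refine Finset.sum_congr rfl fun m hm => ?_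
  rw [if_neg (Finset.mem_filter.1 hm).2, neg_neg]

/-- `∑_j S^j_a = 0` for `a` in the zero class. -/
def SumZero (N : ℕ) (s : Fin n → ℤ × ℤ → ℂ) : Prop := ∀ a, cls N a = 0 → ∑ j, s j a = 0

/-- The cancellation behind the partial fractions: it removes the pole at `z = w` and all double
poles. -/
lemma twConv_one_self {f : ℤ × ℤ → ℂ} (hf : Twisted N f) (a b : ℤ × ℤ) :
    twConv N f f (fun _ => 1) a b = 0 := by
  have := twConv_one_antisymm hf hf a b
  linear_combination this / 2

/-- Fay's identity for each marked point moves the dependence on `z` into factors free of γ. The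
terms with `f_α` occur only for `γ` in the class of `α`, where they share one factor and vanish by
`SumZero`; the `S_0` part agrees on both sides because then `φ_γ = φ_α`. -/
lemma varphi_mul_laxCoeff (hτ : 0 < τ.im) (h0 : SumZero N s) {z w : ℂ}
    (hz : ∀ j, ¬ InLattice τ (z - x j)) (hw : ∀ j, ¬ InLattice τ (w - x j))
    (hzw : ¬ InLattice τ (z - w)) {a g : ℤ × ℤ} (ha : cls N a ≠ 0) (hg : cls N g ≠ 0) :
    varphi N τ g (z - w) * laxCoeff N τ x s0 s z (a - g)
      = varphi N τ a (z - w) * laxCoeff N τ x s0 s w (a - g)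
        + ∑ j, varphi N τ a (z - x j) * (s j (a - g) * varphi N τ g (x j - w)) := by
  have hj : ∀ j, varphi N τ g (z - w) * (s j (a - g) * varphiE N τ (a - g) (z - x j))
      = varphi N τ a (z - w) * (s j (a - g) * varphiE N τ (a - g) (w - x j))
        + varphi N τ a (z - x j) * (s j (a - g) * varphi N τ g (x j - w))
        + s j (a - g) * (if cls N (a - g) = 0 then fFun N τ a (z - w) else 0) := by
    intro j
    have e1 : z - w - (z - x j) = x j - w := by ring
    have e2 : z - x j - (z - w) = w - x j := by ring
    have h := varphiE_mul_varphiE (N := N) hτ (a := g) (b := a - g) (z := z - w) (w := z - x j)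
      (by rwa [add_sub_cancel]) hzw (hz j)
      (by rw [e1, inLattice_sub_comm]; exact hw j)
    rw [add_sub_cancel, varphiE_of_ne hg, varphiE_of_ne hg, if_neg hg, e1, e2] at h
    linear_combination s j (a - g) * h
  unfold laxCoeff
  rw [mul_add, mul_add, Finset.mul_sum, Finset.sum_congr rfl fun j _ => hj j,
    Finset.sum_add_distrib, Finset.sum_add_distrib, ← Finset.sum_mul, ← Finset.mul_sum]
  by_cases hag : cls N (a - g) = 0
  · have hc : cls N g = cls N a := by
      rw [cls_sub, sub_eq_zero] at hag
      exact hag.symm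
    rw [h0 _ hag, (classFun_varphi (z - w)).congr hc]
    ring
  · simp only [if_neg hag]
    ring

/-- Partial fractions in `z` of the right-hand side of the exchange relation. -/
lemma exchCoeff_eq_sum (hτ : 0 < τ.im) (hs : ∀ j, Twisted N (s j)) (h0 : SumZero N s) {z w : ℂ}
    (hz : ∀ j, ¬ InLattice τ (z - x j)) (hw : ∀ j, ¬ InLattice τ (w - x j))
    (hzw : ¬ InLattice τ (z - w)) {a : ℤ × ℤ} (ha : cls N a ≠ 0) (b : ℤ × ℤ) :
    exchCoeff N τ x s0 s z w a b = ∑ j, varphi N τ a (z - x j)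
      * twConv N (s j) (laxCoeff N τ x s0 s w) (fun g => varphi0 N τ g (x j - w)) a b := by
  have hL := twisted_laxCoeff (τ := τ) (x := x) (s0 := s0) hs w
  have key : ∀ g, twTerm N (laxCoeff N τ x s0 s z) (laxCoeff N τ x s0 s w)
      (fun g => varphi0 N τ g (z - w)) a b g
      = varphi N τ a (z - w) * twTerm N (laxCoeff N τ x s0 s w) (laxCoeff N τ x s0 s w)
          (fun _ => 1) a b g
        + ∑ j, varphi N τ a (z - x j)
          * twTerm N (s j) (laxCoeff N τ x s0 s w) (fun g => varphi0 N τ g (x j - w)) a b g := by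
    intro g
    unfold twTerm
    by_cases hg : cls N g = 0
    · simp [C_of_cls_eq_zero hg]
    · have h := varphi_mul_laxCoeff (s0 := s0) hτ h0 hz hw hzw ha hg
      simp only [varphi0_of_ne hg]
      have e : ∑ j, varphi N τ a (z - x j) * (C N g (a - b) * s j (a - g)
          * laxCoeff N τ x s0 s w (b + g) * varphi N τ g (x j - w))
          = C N g (a - b) * laxCoeff N τ x s0 s w (b + g)
            * ∑ j, varphi N τ a (z - x j) * (s j (a - g) * varphi N τ g (x j - w)) := by
        rw [Finset.mul_sum]
        exact Finset.sum_congr rfl fun j _ => by ring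
      rw [e]
      linear_combination C N g (a - b) * laxCoeff N τ x s0 s w (b + g) * h
  unfold exchCoeff twConv
  simp_rw [key]
  rw [Finset.sum_add_distrib, ← Finset.mul_sum]
  -- The terms with the factor `φ_α(z - w)` add up to the convolution of `L(w)` with itself.
  have h1 := twConv_one_self hL a b
  unfold twConv at h1
  rw [h1, mul_zero, zero_add, Finset.sum_comm]
  simp_rw [Finset.mul_sum]

/-- For `k ≠ j` Fay's identity separates the poles at `x_j` and `x_k`. For `k = j` both factors have
the same argument and a double pole arises; its factor, the bracket multiplying `s_j(b + g)`, does
not involve γ and so drops out after convolution. `SumZero` again removes the `f` terms, which occur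
only for `b + g` in the zero class. -/
lemma varphi_mul_laxCoeff_self (hτ : 0 < τ.im) (hx : ∀ j k, j ≠ k → ¬ InLattice τ (x j - x k))
    (h0 : SumZero N s) {w : ℂ} (hw : ∀ j, ¬ InLattice τ (w - x j)) {b g : ℤ × ℤ}
    (hb : cls N b ≠ 0) (hg : cls N g ≠ 0) (j : Fin n) :
    varphi N τ g (x j - w) * laxCoeff N τ x s0 s w (b + g)
      = varphi N τ b (w - x j) * selfPart N τ x s0 s j (b + g)
        + varphi N τ b (w - x j) * s j (b + g) * varphiConst N τ g
        + s j (b + g) * (varphi N τ b (w - x j) * (varphiConst N τ b - E1 τ (w - x j))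
            + fFun N τ b (w - x j))
        + ∑ k with k ≠ j, varphi N τ b (w - x k) * (s k (b + g) * varphi N τ g (x j - x k)) := by
  have hng : cls N (-g) ≠ 0 := by rwa [cls_neg, neg_ne_zero]
  have hbg : -g + (b + g) = b := by abel
  have hneg : varphi N τ g (x j - w) = -varphi N τ (-g) (w - x j) := by
    rw [← neg_sub (x j) w, varphi_neg_neg, neg_neg]
  have hsame := varphiE_mul_varphiE_same_arg (N := N) hτ (a := -g) (b := b + g) (t := w - x j)
    (by rwa [hbg]) (hw j)
  rw [hbg, varphiE_of_ne hng, if_neg hng, varphiConst_neg] at hsame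
  have hk : ∀ k ∈ Finset.univ.filter (fun k => k ≠ j),
      varphi N τ (-g) (w - x j) * (s k (b + g) * varphiE N τ (b + g) (w - x k))
      = varphi N τ b (w - x j) * (s k (b + g) * varphiE N τ (b + g) (x j - x k))
        - varphi N τ b (w - x k) * (s k (b + g) * varphi N τ g (x j - x k))
        + s k (b + g) * (if cls N (b + g) = 0 then fFun N τ b (w - x j) else 0) := by
    intro k hk
    have hkj := (Finset.mem_filter.1 hk).2
    have e1 : w - x j - (w - x k) = x k - x j := by ring
    have e2 : w - x k - (w - x j) = x j - x k := by ring
    have h := varphiE_mul_varphiE (N := N) hτ (a := -g) (b := b + g) (z := w - x j)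
      (w := w - x k) (by rwa [hbg]) (hw j) (hw k) (by rw [e1]; exact hx k j hkj)
    rw [hbg, varphiE_of_ne hng, varphiE_of_ne hng, if_neg hng, e1, e2, ← neg_sub (x j) (x k),
      varphi_neg_neg] at h
    linear_combination s k (b + g) * h
  unfold laxCoeff selfPart
  have hz : (∑ k, s k (b + g)) * (if cls N (b + g) = 0 then fFun N τ b (w - x j) else 0) = 0 := by
    split_ifs with h
    · rw [h0 _ h, zero_mul]
    · rw [mul_zero]
  rw [sum_eq_add_sum_ne j, add_mul] at hz
  have h0' : varphi N τ (-g) (w - x j) * (if cls N (b + g) = 0 then sgn N (b + g) * s0 else 0)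
      = varphi N τ b (w - x j) * (if cls N (b + g) = 0 then sgn N (b + g) * s0 else 0) := by
    split_ifs with h
    · have hc : cls N (-g) = cls N b := by
        rw [cls_add, add_eq_zero_iff_eq_neg] at h
        rw [cls_neg, h]
      rw [(classFun_varphi (w - x j)).congr hc]
    · simp
  have hsum := Finset.sum_congr rfl hk
  rw [Finset.sum_add_distrib, Finset.sum_sub_distrib, ← Finset.mul_sum, ← Finset.mul_sum,
    ← Finset.sum_mul] at hsum
  rw [hneg, sum_eq_add_sum_ne j]
  linear_combination -hsum - h0' - s j (b + g) * hsame - hz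

/-- Partial fractions in `w`. -/
lemma twConv_laxCoeff_eq_sum (hτ : 0 < τ.im) (hx : ∀ j k, j ≠ k → ¬ InLattice τ (x j - x k))
    (hs : ∀ j, Twisted N (s j)) (h0 : SumZero N s) {w : ℂ}
    (hw : ∀ j, ¬ InLattice τ (w - x j)) (a : ℤ × ℤ) {b : ℤ × ℤ} (hb : cls N b ≠ 0) (j : Fin n) :
    twConv N (s j) (laxCoeff N τ x s0 s w) (fun g => varphi0 N τ g (x j - w)) a b
      = ∑ k, varphi N τ b (w - x k) * coeffSS N τ x s0 s j k a b := by
  have key : ∀ g, twTerm N (s j) (laxCoeff N τ x s0 s w) (fun g => varphi0 N τ g (x j - w)) a b g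
      = varphi N τ b (w - x j) * (twTerm N (s j) (selfPart N τ x s0 s j) (fun _ => 1) a b g
          + twTerm N (s j) (s j) (varphiConst N τ) a b g)
        + (varphi N τ b (w - x j) * (varphiConst N τ b - E1 τ (w - x j)) + fFun N τ b (w - x j))
          * twTerm N (s j) (s j) (fun _ => 1) a b g
        + ∑ k with k ≠ j, varphi N τ b (w - x k)
          * twTerm N (s j) (s k) (fun g => varphi0 N τ g (x j - x k)) a b g := by
    intro g
    unfold twTerm
    by_cases hg : cls N g = 0
    · simp [C_of_cls_eq_zero hg]
    · have h := varphi_mul_laxCoeff_self (s0 := s0) hτ hx h0 hw hb hg j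
      simp only [varphi0_of_ne hg]
      have e : ∑ k with k ≠ j, varphi N τ b (w - x k) * (C N g (a - b) * s j (a - g)
          * s k (b + g) * varphi N τ g (x j - x k))
          = C N g (a - b) * s j (a - g)
            * ∑ k with k ≠ j, varphi N τ b (w - x k)
              * (s k (b + g) * varphi N τ g (x j - x k)) := by
        rw [Finset.mul_sum]
        exact Finset.sum_congr rfl fun k _ => by ring
      rw [e]
      linear_combination C N g (a - b) * s j (a - g) * h
  rw [sum_eq_add_sum_ne j]
  have e2 : ∑ k with k ≠ j, varphi N τ b (w - x k) * coeffSS N τ x s0 s j k a b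
      = ∑ k with k ≠ j, varphi N τ b (w - x k)
          * twConv N (s j) (s k) (fun g => varphi0 N τ g (x j - x k)) a b := by
    refine Finset.sum_congr rfl fun k hk => ?_
    rw [coeffSS, if_neg (Finset.mem_filter.1 hk).2.symm]
  rw [e2, coeffSS, if_pos rfl]
  -- The double pole at `x_j` multiplies the convolution of `S^j` with itself.
  have h1 := twConv_one_self (hs j) a b
  unfold twConv at h1 ⊢
  simp_rw [key]
  rw [Finset.sum_add_distrib, Finset.sum_add_distrib, ← Finset.mul_sum, ← Finset.mul_sum, h1,
    Finset.sum_add_distrib, Finset.sum_comm]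
  simp_rw [Finset.mul_sum]
  ring

/-- The exchange relation for the coefficients of `T_α ⊗ T_β`, `α, β ≠ 0`. -/
theorem exchCoeff_eq_sum_coeffSS (hτ : 0 < τ.im)
    (hx : ∀ j k, j ≠ k → ¬ InLattice τ (x j - x k)) (hs : ∀ j, Twisted N (s j))
    (h0 : SumZero N s) {z w : ℂ} (hz : ∀ j, ¬ InLattice τ (z - x j))
    (hw : ∀ j, ¬ InLattice τ (w - x j)) (hzw : ¬ InLattice τ (z - w)) {a b : ℤ × ℤ}
    (ha : cls N a ≠ 0) (hb : cls N b ≠ 0) :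
    exchCoeff N τ x s0 s z w a b = ∑ j, ∑ k, varphi N τ a (z - x j) * varphi N τ b (w - x k)
      * coeffSS N τ x s0 s j k a b := by
  rw [exchCoeff_eq_sum hτ hs h0 hz hw hzw ha]
  refine Finset.sum_congr rfl fun j _ => ?_
  rw [twConv_laxCoeff_eq_sum hτ hx hs h0 hw a hb, Finset.mul_sum]
  exact Finset.sum_congr rfl fun k _ => by ring

/-- Both factors now carry the same index γ, so only degenerate identities apply: the point `x_k`
contributes the difference of two values of `E₂`, the other points contribute `f_γ` and differences
of `E₁`. -/
lemma varphi_mul_laxCoeff_of_ne (hτ : 0 < τ.im) (hx : ∀ j k, j ≠ k → ¬ InLattice τ (x j - x k))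
    {z : ℂ} (hz : ∀ j, ¬ InLattice τ (z - x j)) {g : ℤ × ℤ}
    (hg : cls N g ≠ 0) (k : Fin n) :
    varphi N τ g (x k - z) * laxCoeff N τ x s0 s z g
      = s k g * E2 τ (breve N τ g) - E2 τ (z - x k) * s k g
        - ∑ m with m ≠ k, s m g * fFun N τ g (x k - x m)
        + ∑ m with m ≠ k,
          (E1 τ (z - x m) - E1 τ (z - x k)) * (s m g * varphi N τ g (x k - x m)) := by
  have hng : cls N (-g) ≠ 0 := by rwa [cls_neg, neg_ne_zero]
  have hsame := varphi_mul_varphi_neg hτ hg (hz k)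
  have hneg : varphi N τ g (x k - z) = -varphi N τ (-g) (z - x k) := by
    rw [← neg_sub (x k) z, varphi_neg_neg, neg_neg]
  unfold laxCoeff
  rw [if_neg hg, zero_add, sum_eq_add_sum_ne k, mul_add, Finset.mul_sum, varphiE_of_ne hg]
  have hm : ∑ m with m ≠ k, varphi N τ g (x k - z) * (s m g * varphiE N τ g (z - x m))
      = ∑ m with m ≠ k, ((E1 τ (z - x m) - E1 τ (z - x k)) * (s m g * varphi N τ g (x k - x m))
        - s m g * fFun N τ g (x k - x m)) := by
    refine Finset.sum_congr rfl fun m hm => ?_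
    have hmk := (Finset.mem_filter.1 hm).2
    have e : x k - z + (z - x m) = x k - x m := by ring
    have h := varphi_mul_varphi_same hτ hg (z := x k - z) (w := z - x m)
      (by rw [inLattice_sub_comm]; exact hz k) (hz m) (by rw [e]; exact hx k m hmk.symm)
    rw [e, ← neg_sub z (x k), E1_neg, neg_sub] at h
    rw [varphiE_of_ne hg]
    linear_combination s m g * h
  rw [hm, Finset.sum_sub_distrib, hneg]
  linear_combination -s k g * hsame

/-- The exchange relation for the coefficients of `T_0 ⊗ T_β`, `β ≠ 0`. -/
theorem exchCoeff_zero_eq_sum (hτ : 0 < τ.im)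
    (hx : ∀ j k, j ≠ k → ¬ InLattice τ (x j - x k)) (hs : ∀ j, Twisted N (s j))
    (h0 : SumZero N s) {z w : ℂ} (hz : ∀ j, ¬ InLattice τ (z - x j))
    (hw : ∀ j, ¬ InLattice τ (w - x j)) (hzw : ¬ InLattice τ (z - w)) {b : ℤ × ℤ}
    (hb : cls N b ≠ 0) :
    exchCoeff N τ x s0 s z w 0 b = ∑ k, varphi N τ b (w - x k)
      * (coeffS0S N τ x s k b + ∑ j, E1 τ (z - x j) * coeffS0jS N τ x s j k b) := by
  have hwz : ¬ InLattice τ (w - z) := fun h => hzw (inLattice_sub_comm.1 h)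
  -- The expansion needs a nonzero first index, so the two tensor factors are exchanged and the
  -- expansion is made in `w`.
  rw [exchCoeff_swap hs, exchCoeff_eq_sum hτ hs h0 hw hz hwz hb, ← Finset.sum_neg_distrib]
  refine Finset.sum_congr rfl fun k _ => ?_
  rw [← mul_neg]
  congr 1
  have key : ∀ g, twTerm N (s k) (laxCoeff N τ x s0 s z) (fun g => varphi0 N τ g (x k - z)) b 0 g
      = twTerm N (s k) (s k) (fun g => E2 τ (breve N τ g)) b 0 g
        - E2 τ (z - x k) * twTerm N (s k) (s k) (fun _ => 1) b 0 g
        - ∑ m with m ≠ k, twTerm N (s k) (s m) (fun g => fFun N τ g (x k - x m)) b 0 g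
        + ∑ m with m ≠ k, (E1 τ (z - x m) - E1 τ (z - x k))
          * twTerm N (s k) (s m) (fun g => varphi0 N τ g (x k - x m)) b 0 g := by
    intro g
    unfold twTerm
    by_cases hg : cls N g = 0
    · simp [C_of_cls_eq_zero hg]
    · have h := varphi_mul_laxCoeff_of_ne (s0 := s0) (s := s) hτ hx hz hg k
      simp only [varphi0_of_ne hg, zero_add]
      have e1 : ∑ m with m ≠ k, C N g (b - 0) * s k (b - g) * s m g * fFun N τ g (x k - x m)
          = C N g (b - 0) * s k (b - g) * ∑ m with m ≠ k, s m g * fFun N τ g (x k - x m) := by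
        rw [Finset.mul_sum]
        exact Finset.sum_congr rfl fun k _ => by ring
      have e2 : ∑ m with m ≠ k, (E1 τ (z - x m) - E1 τ (z - x k))
          * (C N g (b - 0) * s k (b - g) * s m g * varphi N τ g (x k - x m))
          = C N g (b - 0) * s k (b - g) * ∑ m with m ≠ k, (E1 τ (z - x m) - E1 τ (z - x k))
            * (s m g * varphi N τ g (x k - x m)) := by
        rw [Finset.mul_sum]
        exact Finset.sum_congr rfl fun k _ => by ring
      rw [e1, e2]
      linear_combination C N g (b - 0) * s k (b - g) * h
  -- The diagonal coefficient is minus the sum of the others, which turns the `E₁` into differences.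
  have hq : ∑ j, E1 τ (z - x j) * coeffS0jS N τ x s j k b
      = -∑ m with m ≠ k, (E1 τ (z - x m) - E1 τ (z - x k)) * coeffPair N τ x s m k b := by
    rw [sum_eq_add_sum_ne k, coeffS0jS, if_pos rfl, Finset.mul_sum, ← Finset.sum_add_distrib,
      ← Finset.sum_neg_distrib]
    refine Finset.sum_congr rfl fun m hm => ?_
    rw [coeffS0jS, if_neg (Finset.mem_filter.1 hm).2]
    ring
  rw [hq]
  have h1 := twConv_one_self (hs k) b 0
  unfold coeffS0S coeffPair
  unfold twConv at h1 ⊢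
  simp_rw [key]
  rw [Finset.sum_add_distrib, Finset.sum_sub_distrib, Finset.sum_sub_distrib, ← Finset.mul_sum, h1,
    Finset.sum_comm (t := Finset.univ.filter (fun m => m ≠ k)),
    Finset.sum_comm (t := Finset.univ.filter (fun m => m ≠ k))]
  simp_rw [Finset.mul_sum]
  ring

/-- The exchange relation for the coefficient of `T_0 ⊗ T_0`. -/
lemma exchCoeff_zero_zero (z w : ℂ) : exchCoeff N τ x s0 s z w 0 0 = 0 := by
  unfold exchCoeff twConv twTerm
  refine Finset.sum_eq_zero fun c _ => ?_
  rw [sub_self, C_swap, C_zero_left]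
  ring

end Coefficients

/-! ### Comparison with the prescribed brackets -/

section Compare

open Classical

variable {n N : ℕ} [NeZero N] {τ : ℂ} {x : Fin n → ℂ}

lemma twisted_S (p : Phase n N) (j : Fin n) : Twisted N fun a => S j a p :=
  twisted_sgn_mul (N := N) fun c => p.1.2 j c

lemma sumZero_S (p : Phase n N) : SumZero N fun j a => S j a p := by
  intro a ha
  have : ∀ j : Fin n, S j a p = sgn N a * p.1.2 j 0 := fun j => by rw [← ha]; rfl
  simp_rw [this, ← Finset.mul_sum]
  rw [show ∑ j, p.1.2 j 0 = 0 from p.2, mul_zero]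

lemma S_zero (p : Phase n N) (j : Fin n) : S j 0 p = S0j j p := by
  simp [S, S0j, cls_zero, rep_zero]

lemma S_rep (p : Phase n N) (j : Fin n) (c : Idx N) : S j (rep c) p = p.1.2 j c := by
  simp [S, cls_rep]

lemma sgn_zero : sgn N 0 = 1 := by
  simp [sgn, cls_zero, rep_zero]

/-- The hypothesis `hab` covers coinciding classes of `a` and `-b`, where the two split-off terms
would be one term counted twice. -/
lemma sum_rep_eq_filter {g : ℤ × ℤ → ℂ} (hg : ClassFun N g) (h0 : g 0 = 0) {a b : ℤ × ℤ}
    (ha : cls N a ≠ 0) (hb : cls N b ≠ 0) (hab : cls N a = cls N (-b) → g a = 0) :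
    ∑ c : Idx N, g (rep c)
      = ∑ c : Idx N with c ≠ 0 ∧ c ≠ cls N a ∧ c ≠ cls N (-b), g (rep c) + g a + g (-b) := by
  have hb' : cls N (-b) ≠ 0 := by rwa [cls_neg, neg_ne_zero]
  have key : ∀ c : Idx N, g (rep c)
      = (if c ≠ 0 ∧ c ≠ cls N a ∧ c ≠ cls N (-b) then g (rep c) else 0)
        + (if c = cls N a then g a else 0) + (if c = cls N (-b) then g (-b) else 0) := by
    intro c
    by_cases h1 : c = 0
    · subst h1
      simp [rep_zero, h0, ha.symm, hb'.symm]
    · by_cases h2 : c = cls N a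
      · have e : g (rep c) = g a := hg.congr (by rw [cls_rep, h2])
        by_cases h3 : c = cls N (-b)
        · have h4 : g a = 0 := hab (h2.symm.trans h3)
          have h5 : g (-b) = g a := hg.congr (by rw [← h3, h2])
          simp [e, h5, h4]
        · rw [e, if_neg (fun h => h.2.1 h2), if_pos h2, if_neg h3]
          ring
      · by_cases h3 : c = cls N (-b)
        · have e : g (rep c) = g (-b) := hg.congr (by rw [cls_rep, h3])
          rw [e, if_neg (fun h => h.2.2 h3), if_neg h2, if_pos h3]
          ring
        · simp [h1, h2, h3]
  rw [Finset.sum_congr rfl fun c _ => key c, Finset.sum_add_distrib, Finset.sum_add_distrib,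
    ← Finset.sum_filter]
  simp

lemma C_eq_zero_of_add {a b : ℤ × ℤ} (h : cls N (a + b) = 0) : C N a b = 0 := by
  have : cls N (-a) = cls N b := by
    rw [cls_add] at h
    rw [cls_neg, neg_eq_iff_add_eq_zero, h]
  rw [← neg_neg a, C_neg_left, C_of_cls_eq this, neg_zero]

/-- Splitting off the terms `γ = α` and `γ = -β` of a convolution. -/
lemma twConv_eq_filter {s t k : ℤ × ℤ → ℂ} (hs : Twisted N s) (ht : Twisted N t)
    (hk : ClassFun N k) {a b : ℤ × ℤ} (ha : cls N a ≠ 0) (hb : cls N b ≠ 0) :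
    twConv N s t k a b
      = ∑ c : Idx N with c ≠ 0 ∧ c ≠ cls N a ∧ c ≠ cls N (-b), twTerm N s t k a b (rep c)
        - C N a b * s 0 * t (a + b) * k a + C N a b * s (a + b) * t 0 * k (-b) := by
  unfold twConv
  rw [sum_rep_eq_filter (classFun_twTerm hs ht hk a b) (by simp [twTerm, C_zero_left]) ha hb]
  · unfold twTerm
    rw [C_self_sub, C_neg_sub, sub_self, sub_neg_eq_add, add_neg_cancel, add_comm b a]
    ring
  · intro h
    unfold twTerm
    rw [C_self_sub, C_eq_zero_of_add (by rw [cls_add, h, cls_neg, neg_add_cancel])]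
    ring

/-- The terms of the convolution at `γ = α` and `γ = -β` are the ones containing `S^j_0` and
`S^k_0`. -/
lemma rhsDiff_eq {j k : Fin n} (hjk : j ≠ k) {a b : ℤ × ℤ} (ha : cls N a ≠ 0)
    (hb : cls N b ≠ 0) (p : Phase n N) :
    rhsDiff τ x j k a b p = coeffSS N τ x (S0 p) (fun j a => S j a p) j k a b := by
  unfold coeffSS
  rw [if_neg hjk, twConv_eq_filter (twisted_S p j) (twisted_S p k) (classFun_varphi0 _) ha hb]
  have hb' : cls N (-b) ≠ 0 := by rwa [cls_neg, neg_ne_zero]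
  rw [varphi0_of_ne ha, varphi0_of_ne hb', S_zero, S_zero]
  unfold rhsDiff
  have e : ∑ c : Idx N with c ≠ 0 ∧ c ≠ cls N a ∧ c ≠ cls N (-b),
      twTerm N (fun a => S j a p) (fun a => S k a p) (fun g => varphi0 N τ g (x j - x k)) a b
        (rep c)
      = ∑ c : Idx N with c ≠ 0 ∧ c ≠ cls N a ∧ c ≠ cls N (-b),
      C N (rep c) (a - b) * S j (a - rep c) p * S k (b + rep c) p
        * varphi N τ (rep c) (x j - x k) := by
    refine Finset.sum_congr rfl fun c hc => ?_
    unfold twTerm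
    simp only
    rw [varphi0_of_ne (by rw [cls_rep]; exact (Finset.mem_filter.1 hc).2.1)]
  rw [e]
  ring

/-- The linear parts of the four `varphiConst` cancel. For `γ` in the class of `α - β`, where one of
the values of `E₁` is taken at a pole, the factor `C` vanishes. -/
lemma C_mul_fConst {a b g : ℤ × ℤ} (hg : cls N g ≠ 0) (hga : cls N g ≠ cls N a)
    (hgb : cls N g ≠ cls N (-b)) :
    C N g (a - b) * fConst N τ a b g = C N g (a - b) * (varphiConst N τ g
      - varphiConst N τ (a - b - g) + varphiConst N τ (a - g) - varphiConst N τ (b + g)) := by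
  by_cases h : cls N (a - b - g) = 0
  · have : cls N g = cls N (a - b) := by
      rw [cls_sub, sub_eq_zero] at h
      exact h.symm
    rw [C_of_cls_eq this, zero_mul, zero_mul]
  · have h1 : cls N (a - g) ≠ 0 := by
      rw [cls_sub, sub_ne_zero]; exact hga.symm
    have h2 : cls N (b + g) ≠ 0 := by
      rw [cls_add]
      intro h
      exact hgb (by rw [cls_neg, eq_neg_iff_add_eq_zero, add_comm, h])
    rw [varphiConst_of_ne hg, varphiConst_of_ne h, varphiConst_of_ne h1, varphiConst_of_ne h2]
    simp only [fConst, Prod.snd_sub, Prod.snd_add]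
    push_cast
    ring

lemma C_mul_varphiConst {a b : ℤ × ℤ} (ha : cls N a ≠ 0) (hb : cls N b ≠ 0) :
    C N a b * (varphiConst N τ (a + b) - varphiConst N τ a - varphiConst N τ b)
      = C N a b * (E1 τ (breve N τ a + breve N τ b) - E1 τ (breve N τ a) - E1 τ (breve N τ b)) := by
  by_cases h : cls N (a + b) = 0
  · rw [C_eq_zero_of_add h, zero_mul, zero_mul]
  · rw [varphiConst_of_ne ha, varphiConst_of_ne hb, varphiConst_of_ne h, breve_add, Prod.snd_add]
    push_cast
    ring

/-- The symmetrized form of the terms with `E₁(γ̆)`. -/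
lemma twConv_varphiConst {s : ℤ × ℤ → ℂ} (hτ : 0 < τ.im) (hs : Twisted N s) {a b : ℤ × ℤ}
    (ha : cls N a ≠ 0) (hb : cls N b ≠ 0) :
    twConv N s s (varphiConst N τ) a b
        - twConv N s (fun g => s g * varphiConst N τ g) (fun _ => 1) a b
      = 1 / 2 * ∑ c : Idx N with c ≠ 0 ∧ c ≠ cls N a ∧ c ≠ cls N (-b),
        C N (rep c) (a - b) * s (a - rep c) * s (b + rep c) * fConst N τ a b (rep c)
        + C N a b * s 0 * s (a + b) *
        (E1 τ (breve N τ a + breve N τ b) - E1 τ (breve N τ a) - E1 τ (breve N τ b)) := by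
  have he := classFun_varphiConst (N := N) hτ
  have hse := hs.mul_classFun he
  have h1 := twConv_flip hs hs he a b
  have h2 := twConv_one_antisymm hs hse a b
  have hk : ClassFun N fun g => varphiConst N τ (a - b - g) := fun g v => by
    simp only
    rw [show a - b - (g + (N : ℤ) • v) = a - b - g + (N : ℤ) • (-v) by rw [smul_neg]; abel]
    exact he _ _
  -- Averaging each convolution with its image under `γ ↦ α - β - γ` produces the four values of
  -- `E₁` in `fConst` and the factor `1/2`.
  have h3 : twConv N s s (varphiConst N τ) a b
        - twConv N s (fun g => s g * varphiConst N τ g) (fun _ => 1) a b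
      = 1 / 2 * (twConv N s s (varphiConst N τ) a b
        - twConv N s s (fun g => varphiConst N τ (a - b - g)) a b
        + twConv N (fun g => s g * varphiConst N τ g) s (fun _ => 1) a b
        - twConv N s (fun g => s g * varphiConst N τ g) (fun _ => 1) a b) := by
    linear_combination 1 / 2 * h1 - 1 / 2 * h2
  have h1c : ClassFun N fun _ => (1 : ℂ) := fun _ _ => rfl
  rw [h3, twConv_eq_filter hs hs he ha hb, twConv_eq_filter hs hs hk ha hb,
    twConv_eq_filter hse hs h1c ha hb, twConv_eq_filter hs hse h1c ha hb]
  have h0 : varphiConst N τ 0 = 0 := varphiConst_of_eq cls_zero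
  have hab : a - b - a = -b := by abel
  have hab' : a - b - -b = a := by abel
  have hsum : ∑ c : Idx N with c ≠ 0 ∧ c ≠ cls N a ∧ c ≠ cls N (-b),
        C N (rep c) (a - b) * s (a - rep c) * s (b + rep c) * fConst N τ a b (rep c)
      = ∑ c : Idx N with c ≠ 0 ∧ c ≠ cls N a ∧ c ≠ cls N (-b),
          twTerm N s s (varphiConst N τ) a b (rep c)
        - ∑ c : Idx N with c ≠ 0 ∧ c ≠ cls N a ∧ c ≠ cls N (-b),
          twTerm N s s (fun g => varphiConst N τ (a - b - g)) a b (rep c)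
        + ∑ c : Idx N with c ≠ 0 ∧ c ≠ cls N a ∧ c ≠ cls N (-b),
          twTerm N (fun g => s g * varphiConst N τ g) s (fun _ => 1) a b (rep c)
        - ∑ c : Idx N with c ≠ 0 ∧ c ≠ cls N a ∧ c ≠ cls N (-b),
          twTerm N s (fun g => s g * varphiConst N τ g) (fun _ => 1) a b (rep c) := by
    rw [← Finset.sum_sub_distrib, ← Finset.sum_add_distrib, ← Finset.sum_sub_distrib]
    refine Finset.sum_congr rfl fun c hc => ?_
    obtain ⟨hc0, hca, hcb⟩ := (Finset.mem_filter.1 hc).2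
    have h := C_mul_fConst (τ := τ) (a := a) (b := b) (g := rep c) (by rwa [cls_rep])
      (by rwa [cls_rep]) (by rwa [cls_rep])
    unfold twTerm
    linear_combination s (a - rep c) * s (b + rep c) * h
  rw [hsum, hab, hab', h0, varphiConst_neg]
  linear_combination s 0 * s (a + b) * C_mul_varphiConst (τ := τ) ha hb

/-- Linearity in the second factor separates `S_0`, the other marked points and the constant term.
The last is kept as a convolution, to be symmetrized together with `twConv s s varphiConst`. -/
lemma twConv_selfPart (s0 : ℂ) {s : Fin n → ℤ × ℤ → ℂ} (hs : ∀ j, Twisted N (s j)) (j : Fin n)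
    {a b : ℤ × ℤ} (ha : cls N a ≠ 0) (hb : cls N b ≠ 0) :
    twConv N (s j) (selfPart N τ x s0 s j) (fun _ => 1) a b
      = -(C N a b * s0 * s j (a + b))
        - ∑ k with k ≠ j, (∑ c : Idx N with c ≠ 0 ∧ c ≠ cls N a ∧ c ≠ cls N (-b),
          C N (rep c) (a - b) * s j (a - rep c) * s k (b + rep c)
            * varphi N τ (b + rep c) (x j - x k)
          - C N a b * s j 0 * s k (a + b) * varphi N τ (a + b) (x j - x k)
          + C N a b * s k 0 * s j (a + b) * E1 τ (x j - x k))
        - twConv N (s j) (fun g => s j g * varphiConst N τ g) (fun _ => 1) a b := by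
  have h1c : ClassFun N fun _ => (1 : ℂ) := fun _ _ => rfl
  have e : twConv N (s j) (selfPart N τ x s0 s j) (fun _ => 1) a b
      = -twConv N (s j) (fun a => if cls N a = 0 then sgn N a * s0 else 0) (fun _ => 1) a b
        - ∑ k with k ≠ j, twConv N (s j) (fun a => s k a * varphiE N τ a (x j - x k))
            (fun _ => 1) a b
        - twConv N (s j) (fun g => s j g * varphiConst N τ g) (fun _ => 1) a b := by
    unfold twConv
    rw [Finset.sum_comm, ← Finset.sum_neg_distrib, ← Finset.sum_sub_distrib,
      ← Finset.sum_sub_distrib]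
    refine Finset.sum_congr rfl fun c _ => ?_
    unfold twTerm selfPart
    have : ∑ k with k ≠ j, C N (rep c) (a - b) * s j (a - rep c)
          * (s k (b + rep c) * varphiE N τ (b + rep c) (x j - x k)) * 1
        = C N (rep c) (a - b) * s j (a - rep c)
          * ∑ k with k ≠ j, s k (b + rep c) * varphiE N τ (b + rep c) (x j - x k) := by
      rw [Finset.mul_sum]
      exact Finset.sum_congr rfl fun k _ => by ring
    rw [this]
    ring
  -- This factor is supported on the zero class, so only `γ = -β` contributes.
  have e0 : twConv N (s j) (fun a => if cls N a = 0 then sgn N a * s0 else 0) (fun _ => 1) a b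
      = C N a b * s0 * s j (a + b) := by
    rw [twConv_eq_filter (hs j) (twisted_zeroPart s0) h1c ha hb, Finset.sum_eq_zero]
    · rw [if_pos cls_zero, sgn_zero]
      split_ifs with h
      · rw [C_eq_zero_of_add h]; ring
      · ring
    · intro c hc
      obtain ⟨-, -, hcb⟩ := (Finset.mem_filter.1 hc).2
      unfold twTerm
      have : cls N (b + rep c) ≠ 0 := by
        rw [cls_add, cls_rep]
        intro h
        exact hcb (by rw [cls_neg, eq_neg_iff_add_eq_zero, add_comm, h])
      simp only [if_neg this]
      ring
  rw [e, e0]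
  congr 2
  refine Finset.sum_congr rfl fun k _ => ?_
  rw [twConv_eq_filter (hs j) ((hs k).mul_classFun (classFun_varphiE _)) h1c ha hb,
    varphiE_of_eq cls_zero]
  have e1 : C N a b * varphiE N τ (a + b) (x j - x k)
      = C N a b * varphi N τ (a + b) (x j - x k) := by
    by_cases h : cls N (a + b) = 0
    · rw [C_eq_zero_of_add h, zero_mul, zero_mul]
    · rw [varphiE_of_ne h]
  have e2 : ∑ c : Idx N with c ≠ 0 ∧ c ≠ cls N a ∧ c ≠ cls N (-b),
        twTerm N (s j) (fun a => s k a * varphiE N τ a (x j - x k)) (fun _ => 1) a b (rep c)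
      = ∑ c : Idx N with c ≠ 0 ∧ c ≠ cls N a ∧ c ≠ cls N (-b),
          C N (rep c) (a - b) * s j (a - rep c) * s k (b + rep c)
            * varphi N τ (b + rep c) (x j - x k) := by
    refine Finset.sum_congr rfl fun c hc => ?_
    obtain ⟨-, -, hcb⟩ := (Finset.mem_filter.1 hc).2
    have : cls N (b + rep c) ≠ 0 := by
      rw [cls_add, cls_rep]
      intro h
      exact hcb (by rw [cls_neg, eq_neg_iff_add_eq_zero, add_comm, h])
    unfold twTerm
    simp only [varphiE_of_ne this]
    ring
  rw [e2]
  linear_combination -(s j 0 * s k (a + b)) * e1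

lemma rhsSame_eq (hτ : 0 < τ.im) (k : Fin n) {a b : ℤ × ℤ} (ha : cls N a ≠ 0)
    (hb : cls N b ≠ 0) (p : Phase n N) :
    rhsSame τ x k a b p = coeffSS N τ x (S0 p) (fun j a => S j a p) k k a b := by
  unfold coeffSS
  rw [if_pos rfl, twConv_selfPart (S0 p) (fun j => twisted_S p j) k ha hb]
  have h := twConv_varphiConst hτ (twisted_S p k) ha hb
  simp only [S_zero] at h ⊢
  unfold rhsSame
  rw [Finset.sum_add_distrib, Finset.sum_sub_distrib, Finset.sum_sub_distrib]
  have e1 : ∑ j with j ≠ k, C N a b * S0j k p * S j (a + b) p * varphi N τ (a + b) (x k - x j)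
      = C N a b * ∑ j with j ≠ k, S0j k p * S j (a + b) p * varphi N τ (a + b) (x k - x j) := by
    rw [Finset.mul_sum]
    exact Finset.sum_congr rfl fun j _ => by ring
  have e2 : ∑ j with j ≠ k, C N a b * S0j j p * S k (a + b) p * E1 τ (x k - x j)
      = C N a b * ∑ j with j ≠ k, S0j j p * S k (a + b) p * E1 τ (x k - x j) := by
    rw [Finset.mul_sum]
    exact Finset.sum_congr rfl fun j _ => by ring
  rw [e1, e2]
  linear_combination -h

lemma coeffPair_eq_filter (p : Phase n N) (m k : Fin n) {b : ℤ × ℤ} :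
    coeffPair N τ x (fun j a => S j a p) m k b
      = ∑ c : Idx N with c ≠ 0 ∧ c ≠ cls N b,
        C N (rep c) b * S k (b - rep c) p * S m (rep c) p * varphi N τ (rep c) (x k - x m) := by
  unfold coeffPair twConv
  rw [Finset.sum_filter]
  refine Finset.sum_congr rfl fun c _ => ?_
  unfold twTerm
  rw [sub_zero]
  simp only [zero_add]
  split_ifs with h
  · rw [varphi0_of_ne (by rw [cls_rep]; exact h.1)]
  · rw [not_and_or, not_not, not_not] at h
    rcases h with h | h
    · rw [h, rep_zero, C_zero_left]; ring
    · rw [C_of_cls_eq (by rw [cls_rep, h])]; ring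

/-- The substitution is `γ ↦ γ - β` when `j = k` and `γ ↦ -γ` otherwise. It maps the excluded
classes to those of `coeffPair_eq_filter`; the summand is first extended by zero to make it a class
function on all indices. -/
lemma rhsS0jS_eq (j k : Fin n) {b : ℤ × ℤ} (p : Phase n N) :
    rhsS0jS τ x j k b p = coeffS0jS N τ x (fun j a => S j a p) j k b := by
  have hfilter : ∀ {g : ℤ × ℤ → ℂ}, ClassFun N g → ∀ d : ℤ × ℤ,
      ∑ c : Idx N with c ≠ 0 ∧ c ≠ cls N (-b), g (rep c)
        = ∑ c : Idx N,
          (fun e => if cls N e ≠ 0 ∧ cls N e ≠ cls N (-b) then g e else 0) (rep c) := by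
    intro g hg d
    rw [Finset.sum_filter]
    simp only [cls_rep]
  have hcf : ∀ {g : ℤ × ℤ → ℂ}, ClassFun N g →
      ClassFun N fun e => if cls N e ≠ 0 ∧ cls N e ≠ cls N (-b) then g e else 0 := by
    intro g hg e v
    simp only [cls_shift, hg e v]
  have h0c : ClassFun N fun _ => (1 : ℂ) := fun _ _ => rfl
  unfold rhsS0jS coeffS0jS
  split_ifs with hjk
  · rw [← Finset.sum_neg_distrib]
    refine Finset.sum_congr rfl fun m _ => ?_
    have hg := classFun_twTerm (twisted_S p k)
      ((twisted_S p m).mul_classFun (classFun_varphi (τ := τ) (x k - x m))) h0c 0 b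
    have e1 : ∀ c : Idx N, C N (rep c) (-b) * S k (-rep c) p * S m (b + rep c) p
        * varphi N τ (b + rep c) (x k - x m)
        = twTerm N (fun a => S k a p) (fun a => S m a p * varphi N τ a (x k - x m)) (fun _ => 1) 0 b
          (rep c) := by
      intro c
      unfold twTerm
      rw [zero_sub, zero_sub]
      ring
    simp_rw [e1]
    rw [hfilter hg 0, ← sum_rep_add_right (hcf hg) (-b), coeffPair_eq_filter, Finset.sum_filter,
      ← Finset.sum_neg_distrib]
    refine Finset.sum_congr rfl fun c _ => ?_
    have h1 : cls N (rep c + -b) ≠ 0 ↔ c ≠ cls N b := by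
      rw [cls_add, cls_neg, cls_rep, ne_eq, add_neg_eq_zero]
    have h2 : cls N (rep c + -b) ≠ cls N (-b) ↔ c ≠ 0 := by
      rw [cls_add, cls_neg, cls_rep, ne_eq, add_eq_right]
    simp only [h1, h2, and_comm (a := c ≠ cls N b)]
    split_ifs
    · unfold twTerm
      rw [zero_sub, zero_sub, C_congr_neg (a' := rep c) (b' := b)
        (by simp [cross]; ring), show -(rep c + -b) = b - rep c by abel,
        show b + (rep c + -b) = rep c by abel]
      ring
    · simp
  · have hg := classFun_twTerm (twisted_S p j) (twisted_S p k)
      (classFun_varphi (τ := τ) (x j - x k)) 0 b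
    have e1 : ∀ c : Idx N, C N (rep c) (-b) * S j (-rep c) p * S k (b + rep c) p
        * varphi N τ (rep c) (x j - x k)
        = twTerm N (fun a => S j a p) (fun a => S k a p) (fun g => varphi N τ g (x j - x k)) 0 b
          (rep c) := by
      intro c
      unfold twTerm
      rw [zero_sub, zero_sub]
    simp_rw [e1]
    rw [hfilter hg 0, ← sum_rep_neg (hcf hg), coeffPair_eq_filter, Finset.sum_filter,
      ← Finset.sum_neg_distrib]
    refine Finset.sum_congr rfl fun c _ => ?_
    have h1 : cls N (-rep c) ≠ 0 ↔ c ≠ 0 := by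
      rw [cls_neg, cls_rep, neg_ne_zero]
    have h2 : cls N (-rep c) ≠ cls N (-b) ↔ c ≠ cls N b := by
      rw [cls_neg, cls_neg, cls_rep, ne_eq, neg_inj]
    simp only [h1, h2]
    split_ifs
    · unfold twTerm
      have : varphi N τ (-rep c) (x j - x k) = -varphi N τ (rep c) (x k - x j) := by
        rw [← neg_sub (x k) (x j), varphi_neg_neg]
      simp only [this]
      rw [zero_sub, zero_sub, neg_neg, C_neg_left, C_neg_right, ← sub_eq_add_neg]
      ring
    · simp

lemma rhsS0S_eq (k : Fin n) {a : ℤ × ℤ} (p : Phase n N) :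
    rhsS0S τ x k a p = coeffS0S N τ x (fun j a => S j a p) k a := by
  unfold rhsS0S coeffS0S twConv
  rw [Finset.sum_comm, ← Finset.sum_neg_distrib, ← Finset.sum_add_distrib, Finset.sum_filter]
  refine Finset.sum_congr rfl fun c _ => ?_
  unfold twTerm
  simp only [sub_zero, zero_add]
  have e : ∑ m with m ≠ k, C N (rep c) a * S k (a - rep c) p * S m (rep c) p
        * fFun N τ (rep c) (x k - x m)
      = C N (rep c) a * ∑ m with m ≠ k, S m (rep c) p * S k (a - rep c) p
        * fFun N τ (rep c) (x k - x m) := by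
    rw [Finset.mul_sum]
    exact Finset.sum_congr rfl fun j _ => by ring
  rw [e]
  split_ifs with h
  · rw [C_swap (rep c) a]
    ring
  · rw [not_and_or, not_not, not_not] at h
    have : C N (rep c) a = 0 := by
      rcases h with h | h
      · rw [h, rep_zero, C_zero_left]
      · rw [C_of_cls_eq (by rw [cls_rep, h])]
    rw [this]
    ring

end Compare

/-! ### Poles of the Lax matrix -/

section Residues

variable {N : ℕ} [NeZero N] {τ : ℂ}

lemma tendsto_theta_div (hτ : 0 < τ.im) :
    Tendsto (fun t => theta τ t / t) (𝓝[≠] 0) (𝓝 (deriv (theta τ) 0)) := by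
  have h := hasDerivAt_iff_tendsto_slope.1 (differentiable_theta hτ 0).hasDerivAt
  refine h.congr fun t => ?_
  rw [slope_def_field, theta_zero, sub_zero, sub_zero]

/-- Every `φ_a`, and `E₁` likewise, has residue `1` at the origin; all cases reduce to `θ(t)/t →
θ'(0)`. -/
lemma tendsto_mul_varphiE (hτ : 0 < τ.im) (a : ℤ × ℤ) :
    Tendsto (fun t => t * varphiE N τ a t) (𝓝[≠] 0) (𝓝 1) := by
  have hθ := differentiable_theta hτ
  have hd := deriv_theta_zero_ne_zero hτ
  have h1 := (tendsto_theta_div hτ).inv₀ hd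
  have hne : ∀ᶠ t in 𝓝[≠] (0 : ℂ), t ≠ 0 := self_mem_nhdsWithin
  by_cases ha : cls N a = 0
  · have hc : Tendsto (deriv (theta τ)) (𝓝[≠] 0) (𝓝 (deriv (theta τ) 0)) :=
      ((hθ.contDiff (n := 2)).differentiable_deriv_two.continuous.tendsto 0).mono_left
        nhdsWithin_le_nhds
    have h := hc.mul h1
    rw [mul_inv_cancel₀ hd] at h
    refine h.congr' (hne.mono fun t ht => ?_)
    simp only [varphiE_of_eq ha, E1, inv_div]
    ring
  · have hu := theta_ne_zero hτ (not_inLattice_breve hτ ha)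
    have hc : Tendsto (fun t => eN N (a.2 * t) * (theta τ (breve N τ a + t) * deriv (theta τ) 0
        / theta τ (breve N τ a))) (𝓝[≠] 0) (𝓝 (eN N (a.2 * 0)
          * (theta τ (breve N τ a + 0) * deriv (theta τ) 0 / theta τ (breve N τ a)))) := by
      have hcont : Continuous fun t => eN N (a.2 * t) * (theta τ (breve N τ a + t)
          * deriv (theta τ) 0 / theta τ (breve N τ a)) := by
        have := hθ.continuous
        unfold eN
        fun_prop
      exact (hcont.tendsto 0).mono_left nhdsWithin_le_nhds
    have h := hc.mul h1
    have e : eN N (a.2 * 0) * (theta τ (breve N τ a + 0) * deriv (theta τ) 0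
        / theta τ (breve N τ a)) * (deriv (theta τ) 0)⁻¹ = 1 := by
      rw [mul_zero, add_zero, eN, mul_zero, Complex.exp_zero]
      field_simp
    rw [e] at h
    refine h.congr' (hne.mono fun t ht => ?_)
    simp only [varphiE_of_ne ha, varphi, phi, inv_div]
    simp only [div_eq_mul_inv, mul_inv]
    ring

lemma continuousAt_varphiE (hτ : 0 < τ.im) (a : ℤ × ℤ) {t : ℂ} (ht : ¬ InLattice τ t) :
    ContinuousAt (varphiE N τ a) t := by
  have hθ := (differentiable_theta hτ).continuous
  by_cases ha : cls N a = 0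
  · have : varphiE N τ a = E1 τ := funext fun z => varphiE_of_eq ha z
    rw [this]
    exact (differentiableAt_E1 hτ ht).continuousAt
  · have : varphiE N τ a = varphi N τ a := funext fun z => varphiE_of_ne ha z
    rw [this]
    have hu := theta_ne_zero hτ (not_inLattice_breve hτ ha)
    have h0 := theta_ne_zero hτ ht
    unfold varphi phi eN
    refine ContinuousAt.mul (by fun_prop) (ContinuousAt.div (by fun_prop) (by fun_prop) ?_)
    exact mul_ne_zero hu h0

/-- A countable exceptional set must be allowed because relations in several parameters hold only
when their differences avoid the lattice. -/
lemma countable_bad {n : ℕ} (τ : ℂ) (x : Fin n → ℂ) {bad : Set ℂ} (hbad : bad.Countable) :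
    {z | z ∉ bad ∧ ∀ j, ¬ InLattice τ (z - x j)}ᶜ.Countable := by
  have : {z | z ∉ bad ∧ ∀ j, ¬ InLattice τ (z - x j)}ᶜ
      = bad ∪ ⋃ j, {z | InLattice τ (z - x j)} := by
    ext z
    simp only [Set.mem_compl_iff, Set.mem_ofPred_eq, Set.mem_union, Set.mem_iUnion]
    by_cases h : z ∈ bad <;> simp [h]
  rw [this]
  exact hbad.union (Set.countable_iUnion fun j =>
    countable_inLattice_of_injective τ sub_left_injective)

lemma dense_good {n : ℕ} (τ : ℂ) (x : Fin n → ℂ) {bad : Set ℂ} (hbad : bad.Countable) :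
    Dense {z | z ∉ bad ∧ ∀ j, ¬ InLattice τ (z - x j)} := by
  have := (countable_bad τ x hbad).dense_compl ℝ
  rwa [compl_compl] at this

/-- The functions `1` and `φ_a(z - x_j)` (`E₁(z - x_j)` if `a = 0`) are linearly independent. -/
lemma eq_zero_of_sum_varphiE (hτ : 0 < τ.im) {n : ℕ} {x : Fin n → ℂ}
    (hx : ∀ j k, j ≠ k → ¬ InLattice τ (x j - x k)) (a : ℤ × ℤ) {bad : Set ℂ}
    (hbad : bad.Countable) (d : ℂ) (c : Fin n → ℂ)
    (h : ∀ z, z ∉ bad → (∀ j, ¬ InLattice τ (z - x j)) →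
      d + ∑ j, varphiE N τ a (z - x j) * c j = 0) : d = 0 ∧ ∀ j, c j = 0 := by
  have hdense := dense_good τ x hbad
  have hc : ∀ j, c j = 0 := by
    intro j
    set G := {z | z ∉ bad ∧ ∀ j, ¬ InLattice τ (z - x j)} with hG
    -- The good parameters accumulate at `x_j`; multiplying the relation by `z - x_j` and letting `z
    -- → x_j` among them isolates `c_j`.
    have : (𝓝[G] (x j)).NeBot := mem_closure_iff_nhdsWithin_neBot.1 (hdense (x j))
    have hle : 𝓝[G] (x j) ≤ 𝓝[≠] (x j) := by
      refine nhdsWithin_mono _ fun z hz => ?_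
      rintro rfl
      exact hz.2 j (by rw [sub_self]; exact inLattice_zero τ)
    have hmap : Tendsto (fun z => z - x j) (𝓝[≠] (x j)) (𝓝[≠] 0) := by
      refine tendsto_nhdsWithin_iff.2 ⟨?_, ?_⟩
      · have : Tendsto (fun z => z - x j) (𝓝 (x j)) (𝓝 (x j - x j)) :=
          (continuous_id.sub continuous_const).tendsto _
        rw [sub_self] at this
        exact this.mono_left nhdsWithin_le_nhds
      · filter_upwards [self_mem_nhdsWithin] with z hz
        exact sub_ne_zero.2 hz
    have hlim0 : Tendsto (fun z => z - x j) (𝓝[≠] (x j)) (𝓝 0) :=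
      hmap.mono_right nhdsWithin_le_nhds
    have h1 : Tendsto (fun z => (z - x j) * d + ∑ k, (z - x j) * varphiE N τ a (z - x k) * c k)
        (𝓝[≠] (x j)) (𝓝 (0 * d + ∑ k, if k = j then c k else 0)) := by
      refine (hlim0.mul_const d).add (tendsto_finsetSum _ fun k _ => ?_)
      split_ifs with hkj
      · subst hkj
        simpa using ((tendsto_mul_varphiE hτ a).comp hmap).mul_const (c k)
      · have hcont : Tendsto (fun z => varphiE N τ a (z - x k)) (𝓝[≠] (x j))
            (𝓝 (varphiE N τ a (x j - x k))) := by
          have h2 : ContinuousAt (fun z => varphiE N τ a (z - x k)) (x j) :=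
            ContinuousAt.comp (f := fun z => z - x k)
              (continuousAt_varphiE hτ a (hx j k (Ne.symm hkj))) (by fun_prop)
          exact h2.tendsto.mono_left nhdsWithin_le_nhds
        simpa using (hlim0.mul hcont).mul_const (c k)
    have h2 : Tendsto (fun z => (z - x j) * d + ∑ k, (z - x j) * varphiE N τ a (z - x k) * c k)
        (𝓝[G] (x j)) (𝓝 0) := by
      refine tendsto_const_nhds.congr' ?_
      filter_upwards [self_mem_nhdsWithin] with z hz
      have := h z hz.1 hz.2
      simp_rw [mul_assoc]
      rw [← Finset.mul_sum, ← mul_add, this, mul_zero]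
    have := tendsto_nhds_unique (h1.mono_left hle) h2
    simpa using this
  refine ⟨?_, hc⟩
  obtain ⟨z, hz⟩ := hdense.nonempty
  simpa [hc] using h z hz.1 hz.2

end Residues

/-! ### Coordinates on the phase space -/

section Coordinates

open Classical

variable {n N : ℕ} [NeZero N]

/-- The indices of the coordinates: `none` for `S₀` and `some (j, c)` for `S^j_c`. -/
abbrev CoordIdx (n N : ℕ) : Type := Option (Fin n × Idx N)

/-- The coordinate functionals of the phase space. -/
def coord : CoordIdx n N → (Phase n N →L[ℂ] ℂ)
  | none => (ContinuousLinearMap.fst ℂ ℂ (Fin n → Idx N → ℂ)).comp (Phase n N).subtypeL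
  | some (j, c) => (ContinuousLinearMap.proj (R := ℂ) (φ := fun _ : Idx N => ℂ) c).comp
      ((ContinuousLinearMap.proj (R := ℂ) (φ := fun _ : Fin n => Idx N → ℂ) j).comp
        ((ContinuousLinearMap.snd ℂ ℂ (Fin n → Idx N → ℂ)).comp (Phase n N).subtypeL))

lemma coord_none_apply (p : Phase n N) : coord none p = S0 p := rfl

lemma coord_some_apply (j : Fin n) (c : Idx N) (p : Phase n N) :
    coord (some (j, c)) p = p.1.2 j c := rfl

/-- Vectors dual to the coordinate functionals, up to the relation `∑_j S^j_0 = 0`. -/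
def coordVec : CoordIdx n N → Phase n N
  | none => ⟨(1, 0), by simp [Phase]⟩
  | some (j, c) => ⟨(0, fun k d => (if k = j ∧ d = c then 1 else 0)
      - if c = 0 ∧ d = 0 then (1 / n : ℂ) else 0), by
        change ∑ k : Fin n, ((if k = j ∧ (0 : Idx N) = c then (1 : ℂ) else 0)
          - if c = 0 ∧ (0 : Idx N) = 0 then (1 / n : ℂ) else 0) = 0
        have hn : (n : ℂ) ≠ 0 := Nat.cast_ne_zero.2 (Fin.pos j).ne'
        by_cases hc : c = 0
        · simp [hc, hn]
        · simp [hc, Ne.symm hc]⟩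

/-- In the zero class `coordVec` is a basis vector projected to sum zero along the constants. The
correction `-1/n` pairs to zero with families whose zero-class part sums to zero. -/
lemma sum_coord_coordVec (h : CoordIdx n N → ℂ) (h0 : ∑ j, h (some (j, 0)) = 0)
    (i : CoordIdx n N) : ∑ i', coord i (coordVec i') * h i' = h i := by
  rw [Fintype.sum_option, Fintype.sum_prod_type]
  match i with
  | none =>
    have h1 : coord (none : CoordIdx n N) (coordVec none) = 1 := rfl
    have h2 : ∀ j c, coord (none : CoordIdx n N) (coordVec (some (j, c))) = 0 := fun _ _ => rfl
    simp [h1, h2]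
  | some (j, c) =>
    have h1 : coord (some (j, c)) (coordVec none) = 0 := rfl
    have h2 : ∀ k d, coord (some (j, c)) (coordVec (some (k, d)))
        = (if j = k ∧ c = d then 1 else 0) - if d = 0 ∧ c = 0 then (1 / n : ℂ) else 0 :=
      fun _ _ => rfl
    simp_rw [h1, h2, sub_mul, Finset.sum_sub_distrib, zero_mul, zero_add]
    have e1 : ∑ k, ∑ d, (if j = k ∧ c = d then (1 : ℂ) else 0) * h (some (k, d))
        = h (some (j, c)) := by
      rw [Finset.sum_eq_single j, Finset.sum_eq_single c]
      · simp
      · intro d _ hd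
        simp [Ne.symm hd]
      · simp
      · intro k _ hk
        simp [Ne.symm hk]
      · simp
    have e2 : ∑ k, ∑ d, (if d = 0 ∧ c = 0 then (1 / n : ℂ) else 0) * h (some (k, d)) = 0 := by
      by_cases hc : c = 0
      · simp only [hc, and_true, ite_mul, zero_mul, Finset.sum_ite_eq', Finset.mem_univ, if_true]
        rw [← Finset.mul_sum, h0, mul_zero]
      · simp [hc]
    rw [e1, e2, sub_zero]

lemma sum_coord_smul_coordVec (p : Phase n N) : ∑ i, coord i p • coordVec i = p := by
  have key : ∀ i', coord i' (∑ i, coord i p • coordVec i) = coord i' p := by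
    intro i'
    rw [map_sum]
    simp_rw [map_smul, smul_eq_mul, mul_comm (coord _ p)]
    exact sum_coord_coordVec (fun i => coord i p) p.2 i'
  refine Subtype.ext (Prod.ext (key none) ?_)
  funext j c
  exact key (some (j, c))

lemma eq_sum_coord (ξ : Phase n N →L[ℂ] ℂ) : ξ = ∑ i, ξ (coordVec i) • coord i := by
  ext p
  nth_rewrite 1 [← sum_coord_smul_coordVec p]
  simp [map_sum, mul_comm]

/-- Linear maps on the dual of the phase space that agree on the coordinates are equal. -/
lemma ext_coord {M : Type*} [AddCommGroup M] [Module ℂ M]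
    {Φ Ψ : (Phase n N →L[ℂ] ℂ) →ₗ[ℂ] M} (h : ∀ i, Φ (coord i) = Ψ (coord i)) : Φ = Ψ := by
  ext ξ
  rw [eq_sum_coord ξ]
  simp [map_sum, h]

/-- The coordinate functional `S^j_a` for a pair of integers `a`. -/
def coordS (j : Fin n) (a : ℤ × ℤ) : Phase n N →L[ℂ] ℂ := sgn N a • coord (some (j, cls N a))

lemma coe_coordS (j : Fin n) (a : ℤ × ℤ) : ⇑(coordS (N := N) j a) = S j a := rfl

lemma coordS_rep (j : Fin n) (c : Idx N) : coordS j (rep c) = coord (some (j, c)) := by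
  rw [coordS, sgn_rep, one_smul, cls_rep]

lemma coe_coord_none : ⇑(coord (none : CoordIdx n N)) = S0 := rfl

lemma coe_coord_zero (j : Fin n) : ⇑(coord (some (j, (0 : Idx N)))) = S0j j := rfl

/-- The coefficient of `T_a` in the Lax matrix, as a linear functional. -/
def laxForm (τ : ℂ) (x : Fin n → ℂ) (z : ℂ) (a : ℤ × ℤ) : Phase n N →L[ℂ] ℂ :=
  (if cls N a = 0 then sgn N a • coord none else 0)
    + ∑ j, varphiE N τ a (z - x j) • coordS j a

lemma laxForm_apply (τ : ℂ) (x : Fin n → ℂ) (z : ℂ) (a : ℤ × ℤ) (p : Phase n N) :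
    laxForm τ x z a p = laxCoeff N τ x (S0 p) (fun j a => S j a p) z a := by
  have h : ∀ j : Fin n, coordS j a p = S j a p := fun j => rfl
  unfold laxForm laxCoeff
  split_ifs
  · simp [h, mul_comm, coord_none_apply]
  · simp [h, mul_comm]

/-- A linear form on the dual of the phase space that vanishes on the coefficients of `L(z)` for
all `z` off a countable set vanishes. -/
lemma eq_zero_of_laxForm {τ : ℂ} (hτ : 0 < τ.im) {x : Fin n → ℂ}
    (hx : ∀ j k, j ≠ k → ¬ InLattice τ (x j - x k)) {bad : Set ℂ} (hbad : bad.Countable)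
    {Φ : (Phase n N →L[ℂ] ℂ) →ₗ[ℂ] ℂ}
    (h : ∀ z, z ∉ bad → (∀ j, ¬ InLattice τ (z - x j)) → ∀ c : Idx N,
      Φ (laxForm τ x z (rep c)) = 0) : Φ = 0 := by
  have key : ∀ c : Idx N, (if c = 0 then Φ (coord none) else 0) = 0
      ∧ ∀ j, Φ (coord (some (j, c))) = 0 := by
    intro c
    refine eq_zero_of_sum_varphiE (N := N) hτ hx (rep c) hbad _ (fun j => Φ (coord (some (j, c))))
      fun z hz hz' => ?_
    refine Eq.trans ?_ (h z hz hz' c)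
    rw [laxForm, map_add, map_sum, cls_rep, sgn_rep, one_smul]
    simp_rw [map_smul, coordS_rep, smul_eq_mul]
    split_ifs <;> simp
  refine ext_coord fun i => ?_
  match i with
  | none => simpa using (key 0).1
  | some (j, c) => simpa using (key c).2 j

end Coordinates

/-! ### The canonical bivector -/

section Bivector

open Classical

variable {n N : ℕ} [NeZero N] {τ : ℂ} {x : Fin n → ℂ}

/-- The matrix of the quadratic brackets of the coordinates. -/
def bracketMatrix (τ : ℂ) (x : Fin n → ℂ) (p : Phase n N) : CoordIdx n N → CoordIdx n N → ℂ
  | none, none => 0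
  | none, some (k, d) => if d = 0 then 0 else coeffS0S N τ x (fun j a => S j a p) k (rep d)
  | some (j, c), none => if c = 0 then 0 else -coeffS0S N τ x (fun j a => S j a p) j (rep c)
  | some (j, c), some (k, d) =>
    if c = 0 then
      if d = 0 then 0 else coeffS0jS N τ x (fun j a => S j a p) j k (rep d)
    else
      if d = 0 then -coeffS0jS N τ x (fun j a => S j a p) k j (rep c)
      else coeffSS N τ x (S0 p) (fun j a => S j a p) j k (rep c) (rep d)

/-- The bivector with the quadratic brackets. -/
def quadBivector (τ : ℂ) (x : Fin n → ℂ) (p : Phase n N) :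
    (Phase n N →L[ℂ] ℂ) →ₗ[ℂ] (Phase n N →L[ℂ] ℂ) →ₗ[ℂ] ℂ :=
  LinearMap.mk₂ ℂ (fun ξ η => ∑ i, ∑ i', ξ (coordVec i) * (η (coordVec i')
      * bracketMatrix τ x p i i'))
    (fun ξ ξ' η => by simp [add_mul, Finset.sum_add_distrib])
    (fun c ξ η => by
      simp only [Finset.smul_sum]
      refine Finset.sum_congr rfl fun i _ => Finset.sum_congr rfl fun i' _ => ?_
      simp only [_root_.smul_apply, smul_eq_mul]
      ring)
    (fun ξ η η' => by simp [add_mul, mul_add, Finset.sum_add_distrib])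
    (fun c ξ η => by
      simp only [Finset.smul_sum]
      refine Finset.sum_congr rfl fun i _ => Finset.sum_congr rfl fun i' _ => ?_
      simp only [_root_.smul_apply, smul_eq_mul]
      ring)

lemma sum_bracketMatrix_left (p : Phase n N) (i : CoordIdx n N) :
    ∑ j, bracketMatrix τ x p (some (j, 0)) i = 0 := by
  match i with
  | none => simp [bracketMatrix]
  | some (k, d) =>
    by_cases hd : d = 0
    · simp [bracketMatrix, hd]
    · simp only [bracketMatrix, hd, if_true, if_false]
      exact sum_coeffS0jS k (rep d)

lemma sum_bracketMatrix_right (p : Phase n N) (i : CoordIdx n N) :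
    ∑ j, bracketMatrix τ x p i (some (j, 0)) = 0 := by
  match i with
  | none => simp [bracketMatrix]
  | some (k, d) =>
    by_cases hd : d = 0
    · simp [bracketMatrix, hd]
    · simp only [bracketMatrix, hd, if_true, if_false, Finset.sum_neg_distrib]
      rw [sum_coeffS0jS k (rep d), neg_zero]

/-- The coordinates are linearly dependent, so this needs the vanishing of the row and column sums
over the zero class. -/
lemma quadBivector_coord (p : Phase n N) (i i' : CoordIdx n N) :
    quadBivector τ x p (coord i) (coord i') = bracketMatrix τ x p i i' := by
  change ∑ m, ∑ m', coord i (coordVec m) * (coord i' (coordVec m') * bracketMatrix τ x p m m') = _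
  simp_rw [← Finset.mul_sum]
  have h : ∀ m, ∑ m', coord i' (coordVec m') * bracketMatrix τ x p m m'
      = bracketMatrix τ x p m i' := fun m =>
    sum_coord_coordVec (fun m' => bracketMatrix τ x p m m') (sum_bracketMatrix_right p m) i'
  simp_rw [h]
  exact sum_coord_coordVec (fun m => bracketMatrix τ x p m i') (sum_bracketMatrix_left p i') i

/-- The exchange relation in components, at the point `p`. -/
def ComponentExchange (τ : ℂ) (x : Fin n → ℂ) (p : Phase n N)
    (B : (Phase n N →L[ℂ] ℂ) →ₗ[ℂ] (Phase n N →L[ℂ] ℂ) →ₗ[ℂ] ℂ) : Prop :=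
  ∀ z w : ℂ, (∀ j, ¬ InLattice τ (z - x j)) → (∀ j, ¬ InLattice τ (w - x j)) →
    ¬ InLattice τ (z - w) → ∀ c d : Idx N,
      B (laxForm τ x z (rep c)) (laxForm τ x w (rep d))
        = exchCoeff N τ x (S0 p) (fun j a => S j a p) z w (rep c) (rep d)

lemma laxForm_rep_of_ne (z : ℂ) {c : Idx N} (hc : c ≠ 0) :
    laxForm τ x z (rep c) = ∑ j, varphi N τ (rep c) (z - x j) • coord (some (j, c)) := by
  have hc' : cls N (rep c) ≠ 0 := by rwa [cls_rep]
  unfold laxForm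
  rw [if_neg hc', zero_add]
  simp_rw [varphiE_of_ne hc', coordS_rep]

lemma laxForm_rep_zero (z : ℂ) :
    laxForm (N := N) τ x z (rep (0 : Idx N))
      = coord none + ∑ j, E1 τ (z - x j) • coord (some (j, (0 : Idx N))) := by
  have hc' : cls N (rep (0 : Idx N)) = 0 := cls_rep 0
  unfold laxForm
  rw [if_pos hc', sgn_rep, one_smul]
  simp_rw [varphiE_of_eq hc', coordS_rep]

/-- Bilinear expansion of the two Lax coefficients reproduces the partial fractions of `exchCoeff`.
The case of a zero second index follows from the opposite one by antisymmetry. -/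
theorem componentExchange_quadBivector (hτ : 0 < τ.im)
    (hx : ∀ j k, j ≠ k → ¬ InLattice τ (x j - x k)) (p : Phase n N) :
    ComponentExchange τ x p (quadBivector τ x p) := by
  intro z w hz hw hzw c d
  have hs := twisted_S p
  have h0 := sumZero_S p
  have zero_left : ∀ z w : ℂ, (∀ j, ¬ InLattice τ (z - x j)) → (∀ j, ¬ InLattice τ (w - x j)) →
      ¬ InLattice τ (z - w) → ∀ d : Idx N, d ≠ 0 →
      exchCoeff N τ x (S0 p) (fun j a => S j a p) z w (rep (0 : Idx N)) (rep d)
        = ∑ k, varphi N τ (rep d) (w - x k) * (bracketMatrix τ x p none (some (k, d))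
          + ∑ j, E1 τ (z - x j) * bracketMatrix τ x p (some (j, 0)) (some (k, d))) := by
    intro z w hz hw hzw d hd
    rw [rep_zero, exchCoeff_zero_eq_sum hτ hx hs h0 hz hw hzw (by rwa [cls_rep])]
    simp [bracketMatrix, hd]
  by_cases hc : c = 0
  · subst hc
    by_cases hd : d = 0
    · subst hd
      rw [laxForm_rep_zero, laxForm_rep_zero, rep_zero, exchCoeff_zero_zero]
      simp [quadBivector_coord, bracketMatrix]
    · rw [zero_left z w hz hw hzw d hd, laxForm_rep_zero, laxForm_rep_of_ne w hd]
      simp only [map_add, map_sum, map_smul, LinearMap.add_apply, LinearMap.sum_apply,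
        LinearMap.smul_apply, smul_eq_mul, quadBivector_coord]
  · by_cases hd : d = 0
    · subst hd
      rw [exchCoeff_swap hs, zero_left w z hw hz (by rwa [inLattice_sub_comm]) c hc,
        laxForm_rep_zero, laxForm_rep_of_ne z hc]
      simp only [map_add, map_sum, map_smul, LinearMap.sum_apply,
        LinearMap.smul_apply, smul_eq_mul, quadBivector_coord]
      simp only [bracketMatrix, hc, if_true, if_false, mul_neg, Finset.sum_neg_distrib]
      rw [← Finset.sum_neg_distrib]
      simp only [mul_add, Finset.mul_sum, Finset.sum_add_distrib, neg_add,
        Finset.sum_neg_distrib]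
      congr 2
      rw [Finset.sum_comm]
      exact Finset.sum_congr rfl fun j _ => Finset.sum_congr rfl fun k _ => by ring
    · rw [exchCoeff_eq_sum_coeffSS hτ hx hs h0 hz hw hzw (by rwa [cls_rep]) (by rwa [cls_rep]),
        laxForm_rep_of_ne z hc, laxForm_rep_of_ne w hd]
      simp only [map_sum, map_smul, LinearMap.sum_apply, LinearMap.smul_apply, smul_eq_mul,
        quadBivector_coord]
      simp only [bracketMatrix, hc, hd, if_false, Finset.mul_sum]
      rw [Finset.sum_comm]
      exact Finset.sum_congr rfl fun j _ => Finset.sum_congr rfl fun k _ => by ring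

/-- The exchange relation determines the bivector. -/
theorem ComponentExchange.eq_quadBivector (hτ : 0 < τ.im)
    (hx : ∀ j k, j ≠ k → ¬ InLattice τ (x j - x k)) {p : Phase n N}
    {B : (Phase n N →L[ℂ] ℂ) →ₗ[ℂ] (Phase n N →L[ℂ] ℂ) →ₗ[ℂ] ℂ}
    (h : ComponentExchange τ x p B) : B = quadBivector τ x p := by
  have h' := componentExchange_quadBivector hτ hx p
  -- The parameters are used up one at a time: for fixed `w` the excluded `z` form a countable set,
  -- so the first argument becomes arbitrary, and then `w` is varied.
  have step : ∀ w, (∀ j, ¬ InLattice τ (w - x j)) → ∀ d : Idx N,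
      (B - quadBivector τ x p).flip (laxForm τ x w (rep d)) = 0 := by
    intro w hw d
    refine eq_zero_of_laxForm hτ hx
      (countable_inLattice_of_injective τ (f := fun z => z - w) sub_left_injective)
      fun z hz hz' c => ?_
    rw [LinearMap.flip_apply, LinearMap.sub_apply, LinearMap.sub_apply, h z w hz' hw hz c d,
      h' z w hz' hw hz c d, sub_self]
  rw [← sub_eq_zero]
  refine LinearMap.ext fun ξ => ?_
  refine eq_zero_of_laxForm (N := N) hτ hx Set.countable_empty (Φ := (B - quadBivector τ x p) ξ)
    fun w _ hw d => ?_
  have := LinearMap.congr_fun (step w hw d) ξ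
  simpa using this

end Bivector

/-! ### The quadratic brackets determine the bivector -/

lemma HolomorphicPoisson.bracket_clm {E : Type*} [NormedAddCommGroup E] [NormedSpace ℂ E]
    [FiniteDimensional ℂ E] (P : HolomorphicPoisson E) (ξ η : E →L[ℂ] ℂ) (p : E) :
    P.bracket ξ η p = P.bivector p ξ η := by
  rw [HolomorphicPoisson.bracket, bivectorBracket, ξ.fderiv, η.fderiv]

lemma swap_of_alternating {V : Type*} [AddCommGroup V] [Module ℂ V] {B : V →ₗ[ℂ] V →ₗ[ℂ] ℂ}
    (hB : ∀ ξ, B ξ ξ = 0) (ξ η : V) : B ξ η = -B η ξ := by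
  have h := hB (ξ + η)
  simp only [map_add, LinearMap.add_apply, hB, zero_add, add_zero] at h
  exact eq_neg_of_add_eq_zero_right h

lemma HolomorphicPoisson.ext_bivector {E : Type*} [NormedAddCommGroup E] [NormedSpace ℂ E]
    [FiniteDimensional ℂ E] {P P' : HolomorphicPoisson E}
    (h : ∀ p, P.bivector p = P'.bivector p) : P = P' := by
  cases P
  cases P'
  congr
  exact funext h

lemma Twisted.eq_sgn_mul {N : ℕ} [NeZero N] {f : ℤ × ℤ → ℂ} (hf : Twisted N f) (a : ℤ × ℤ) :
    f a = sgn N a * f (rep (cls N a)) :=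
  hf.ext_rep (twisted_sgn_mul (N := N) fun c => f (rep c))
    (fun c => by rw [sgn_rep, cls_rep, one_mul]) a

section Brackets

open Classical

variable {n N : ℕ} [NeZero N] {τ : ℂ} {x : Fin n → ℂ} {s0 : ℂ} {s : Fin n → ℤ × ℤ → ℂ}

lemma twisted_selfPart (hτ : 0 < τ.im) (hs : ∀ j, Twisted N (s j)) (j : Fin n) :
    Twisted N (selfPart N τ x s0 s j) := by
  have h := ((twisted_zeroPart (N := N) s0).add ((Twisted.sum (Finset.univ.filter (· ≠ j))
    fun k => (hs k).mul_classFun (classFun_varphiE (τ := τ) (x j - x k))).add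
      ((hs j).mul_classFun (classFun_varphiConst hτ)))).const_mul (-1)
  simp only [neg_one_mul] at h
  exact h

lemma twisted_coeffSS_left (hs : ∀ j, Twisted N (s j)) (j k : Fin n) (b : ℤ × ℤ) :
    Twisted N fun a => coeffSS N τ x s0 s j k a b := by
  unfold coeffSS
  split_ifs
  · exact (twisted_twConv_left (hs j) b).add (twisted_twConv_left (hs j) b)
  · exact twisted_twConv_left (hs j) b

lemma twisted_coeffSS_right (hτ : 0 < τ.im) (hs : ∀ j, Twisted N (s j)) (j k : Fin n)
    (a : ℤ × ℤ) : Twisted N fun b => coeffSS N τ x s0 s j k a b := by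
  unfold coeffSS
  split_ifs
  · exact (twisted_twConv_right (hs j) (twisted_selfPart hτ hs j) (fun _ _ => rfl) a).add
      (twisted_twConv_right (hs j) (hs j) (classFun_varphiConst hτ) a)
  · exact twisted_twConv_right (hs j) (hs k) (classFun_varphi0 _) a

lemma twisted_coeffS0jS (hs : ∀ j, Twisted N (s j)) (j k : Fin n) :
    Twisted N fun b => coeffS0jS N τ x s j k b := by
  unfold coeffS0jS coeffPair
  split_ifs
  · exact Twisted.sum _ fun m => twisted_twConv_left (hs k) 0
  · simpa only [neg_one_mul] using
      (twisted_twConv_left (t := s j) (k := fun g => varphi0 N τ g (x k - x j)) (hs k) 0).const_mul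
        (-1)

lemma twisted_coeffS0S (hs : ∀ j, Twisted N (s j)) (k : Fin n) :
    Twisted N fun b => coeffS0S N τ x s k b := by
  unfold coeffS0S
  refine Twisted.add ?_ (Twisted.sum _ fun m => twisted_twConv_left (hs k) 0)
  simpa only [neg_one_mul] using
    (twisted_twConv_left (t := s k) (k := fun g => E2 τ (breve N τ g)) (hs k) 0).const_mul (-1)

/-- Both sides are twisted in each index, so the equality at standard representatives propagates to
all integer ones. -/
lemma quadBivector_coordS (hτ : 0 < τ.im) (p : Phase n N) (j k : Fin n) {a b : ℤ × ℤ}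
    (ha : cls N a ≠ 0) (hb : cls N b ≠ 0) :
    quadBivector τ x p (coordS j a) (coordS k b)
      = coeffSS N τ x (S0 p) (fun j a => S j a p) j k a b := by
  rw [(twisted_coeffSS_left (twisted_S p) j k b).eq_sgn_mul a,
    (twisted_coeffSS_right hτ (twisted_S p) j k _).eq_sgn_mul b]
  simp only [coordS, map_smul, LinearMap.smul_apply, smul_eq_mul, quadBivector_coord]
  simp only [bracketMatrix, ha, hb, if_false]
  ring

lemma quadBivector_coord_zero_coordS (p : Phase n N) (j k : Fin n) {b : ℤ × ℤ}
    (hb : cls N b ≠ 0) :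
    quadBivector τ x p (coord (some (j, 0))) (coordS k b)
      = coeffS0jS N τ x (fun j a => S j a p) j k b := by
  rw [(twisted_coeffS0jS (twisted_S p) j k).eq_sgn_mul b]
  simp only [coordS, map_smul, smul_eq_mul, quadBivector_coord]
  simp only [bracketMatrix, hb, if_false, if_true]

lemma quadBivector_coord_none_coordS (p : Phase n N) (k : Fin n) {b : ℤ × ℤ}
    (hb : cls N b ≠ 0) :
    quadBivector τ x p (coord none) (coordS k b) = coeffS0S N τ x (fun j a => S j a p) k b := by
  rw [(twisted_coeffS0S (twisted_S p) k).eq_sgn_mul b]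
  simp only [coordS, map_smul, smul_eq_mul, quadBivector_coord]
  simp only [bracketMatrix, hb, if_false]

lemma coeffSS_self_of_ne {j k : Fin n} (hjk : j ≠ k) (a : ℤ × ℤ) :
    coeffSS N τ x s0 s j k a a = 0 := by
  rw [coeffSS, if_neg hjk]
  refine Finset.sum_eq_zero fun c _ => ?_
  rw [twTerm, C_swap, sub_self, C_zero_left]
  ring

/-- Brackets of linear functionals are pointwise values of the bivector, and the coordinate
functionals span the dual. The values at standard representatives therefore fix the bivector, the
missing orders of arguments coming from antisymmetry. -/
theorem hasQuadraticBrackets_iff (hτ : 0 < τ.im) (P : HolomorphicPoisson (Phase n N)) :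
    HasQuadraticBrackets τ x P ↔ ∀ p, P.bivector p = quadBivector τ x p := by
  constructor
  · intro h p
    have hnj : ∀ j, P.bivector p (coord none) (coord (some (j, 0))) = 0 := fun j => by
      rw [← P.bracket_clm]
      exact congrFun (h.S0_S0j j) p
    have hjk : ∀ j k, P.bivector p (coord (some (j, 0))) (coord (some (k, 0))) = 0 := fun j k => by
      rw [← P.bracket_clm]
      exact congrFun (h.S0j_S0k j k) p
    have hrep : ∀ {c : Idx N}, c ≠ 0 → cls N (rep c) ≠ 0 := fun hc => by rwa [cls_rep]
    have hnS : ∀ k (d : Idx N), d ≠ 0 → P.bivector p (coord none) (coord (some (k, d)))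
        = coeffS0S N τ x (fun j a => S j a p) k (rep d) := fun k d hd => by
      rw [← coordS_rep, ← P.bracket_clm, ← rhsS0S_eq]
      exact congrFun (h.S0_S k (rep d) (hrep hd)) p
    have hjS : ∀ j k (d : Idx N), d ≠ 0 →
        P.bivector p (coord (some (j, 0))) (coord (some (k, d)))
        = coeffS0jS N τ x (fun j a => S j a p) j k (rep d) := fun j k d hd => by
      rw [← coordS_rep k d, ← P.bracket_clm, ← rhsS0jS_eq]
      exact congrFun (h.S0j_S j k (rep d) (hrep hd)) p
    refine ext_coord fun i => ext_coord fun i' => ?_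
    rw [quadBivector_coord]
    match i, i' with
    | none, none => exact P.alternating p _
    | none, some (k, d) =>
      by_cases hd : d = 0
      · simp [bracketMatrix, hd, hnj]
      · simp [bracketMatrix, hd, hnS]
    | some (j, c), none =>
      rw [swap_of_alternating (P.alternating p)]
      by_cases hd : c = 0
      · simp [bracketMatrix, hd, hnj]
      · simp [bracketMatrix, hd, hnS]
    | some (j, c), some (k, d) =>
      by_cases hc : c = 0
      · by_cases hd : d = 0
        · simp [bracketMatrix, hc, hd, hjk]
        · subst hc
          simp [bracketMatrix, hd, hjS]
      · by_cases hd : d = 0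
        · subst hd
          rw [swap_of_alternating (P.alternating p)]
          simp [bracketMatrix, hc, hjS]
        · simp only [bracketMatrix, hc, hd, if_false]
          rw [← coordS_rep, ← coordS_rep, ← P.bracket_clm]
          by_cases hk : j = k
          · subst hk
            rw [← rhsSame_eq hτ j (hrep hc) (hrep hd)]
            exact congrFun (h.S_S_same j _ _ (hrep hc) (hrep hd)) p
          · rw [← rhsDiff_eq hk (hrep hc) (hrep hd)]
            exact congrFun (h.S_S_diff j k hk _ _ (hrep hc) (hrep hd)) p
  · intro h
    constructor
    · intro j
      funext p
      rw [← coe_coord_none, ← coe_coord_zero, P.bracket_clm, h, quadBivector_coord]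
      simp [bracketMatrix]
    · intro j k
      funext p
      rw [← coe_coord_zero, ← coe_coord_zero, P.bracket_clm, h, quadBivector_coord]
      simp [bracketMatrix]
    · intro j k a ha
      funext p
      rw [← coe_coordS, ← coe_coordS, P.bracket_clm]
      by_cases hjk : j = k
      · subst hjk
        exact P.alternating p _
      · rw [h, quadBivector_coordS hτ p j k ha ha]
        exact coeffSS_self_of_ne hjk a
    · intro k a ha
      funext p
      rw [← coe_coord_none, ← coe_coordS, P.bracket_clm, h, quadBivector_coord_none_coordS p k ha,
        rhsS0S_eq]
    · intro k a b ha hb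
      funext p
      rw [← coe_coordS, ← coe_coordS, P.bracket_clm, h, quadBivector_coordS hτ p k k ha hb,
        rhsSame_eq hτ k ha hb]
    · intro j k hjk a b ha hb
      funext p
      rw [← coe_coordS, ← coe_coordS, P.bracket_clm, h, quadBivector_coordS hτ p j k ha hb,
        rhsDiff_eq hjk ha hb]
    · intro j k b hb
      funext p
      rw [← coe_coord_zero, ← coe_coordS, P.bracket_clm, h,
        quadBivector_coord_zero_coordS p j k hb, rhsS0jS_eq]

end Brackets

/-! ### The matrices `T_a` -/

section Matrices

variable {N : ℕ} [NeZero N]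

/-- Computes integer powers of `Q` and `Λ` from a guessed homomorphism `f`; `f (-1)` supplies the
inverse. -/
lemma zpow_eq_of_add {m : Type*} [Fintype m] [DecidableEq m] (f : ℤ → Matrix m m ℂ)
    (h0 : f 0 = 1) (hadd : ∀ a b, f (a + b) = f a * f b) (k : ℤ) : f 1 ^ k = f k := by
  have h1 : f 1 * f (-1) = 1 := by rw [← hadd, add_neg_cancel, h0]
  have hdet : IsUnit (f 1).det := Matrix.isUnit_det_of_right_inverse h1
  have hinv : (f 1)⁻¹ = f (-1) := Matrix.inv_eq_right_inv h1
  induction k using Int.induction_on with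
  | zero => rw [zpow_zero, h0]
  | succ k ih => rw [Matrix.zpow_add_one hdet, ih, ← hadd]
  | pred k ih => rw [Matrix.zpow_sub_one hdet, ih, hinv, ← hadd, sub_eq_add_neg]

lemma eN_int (m : ℤ) : eN N m = ZMod.stdAddChar (m : ZMod N) := by
  rw [ZMod.stdAddChar_coe, eN]
  ring_nf

lemma Q_zpow (k : ℤ) :
    Q N ^ k = Matrix.diagonal fun j => ZMod.stdAddChar ((k : ZMod N) * j) := by
  have h := zpow_eq_of_add (fun k : ℤ => Matrix.diagonal fun j : ZMod N =>
    ZMod.stdAddChar ((k : ZMod N) * j)) (by simp) (fun a b => by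
      rw [Matrix.diagonal_mul_diagonal]
      congr 1
      funext j
      rw [Int.cast_add, add_mul, AddChar.map_add_eq_mul]) k
  rw [← h]
  congr 1
  unfold Q
  congr 1
  funext j
  have := eN_int (N := N) j.val
  push_cast at this
  rw [this]
  simp

lemma Lam_zpow (k : ℤ) :
    Lam N ^ k = Matrix.of fun i j => if j = i + (k : ZMod N) then 1 else 0 := by
  have h := zpow_eq_of_add (fun k : ℤ => Matrix.of fun i j : ZMod N =>
    if j = i + (k : ZMod N) then (1 : ℂ) else 0) (by
      ext i j
      simp [Matrix.one_apply, eq_comm]) (fun a b => by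
      ext i j
      simp only [Matrix.mul_apply, Matrix.of_apply]
      rw [Finset.sum_eq_single (i + (a : ZMod N))]
      · simp [add_assoc]
      · intro m _ hm
        simp [hm]
      · simp) k
  rw [← h]
  simp [Lam]

lemma T_apply (a : ℤ × ℤ) (i j : ZMod N) :
    T N a i j = (N : ℂ) / (2 * Real.pi * I) * eN N (a.1 * a.2 / 2)
      * (ZMod.stdAddChar ((a.1 : ZMod N) * i) * if j = i + (a.2 : ZMod N) then 1 else 0) := by
  unfold T
  rw [Matrix.smul_apply, Q_zpow, Lam_zpow, Matrix.diagonal_mul, Matrix.of_apply, smul_eq_mul]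

/-- Moving `Λ^{a₂}` past `Q^{b₁}` costs the phase `e_N(a₂ b₁)`, and the symmetric normalization
`e_N(a₁ a₂ / 2)` leaves half the symplectic form of it. -/
lemma T_mul_T (a b : ℤ × ℤ) :
    T N a * T N b = ((N : ℂ) / (2 * Real.pi * I) * eN N (-(cross a b) / 2)) • T N (a + b) := by
  ext i j
  rw [Matrix.mul_apply, Matrix.smul_apply, smul_eq_mul, T_apply,
    Finset.sum_eq_single (i + (a.2 : ZMod N))]
  · rw [T_apply, T_apply, if_pos rfl]
    have e1 : ZMod.stdAddChar (((a + b).1 : ZMod N) * i)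
        * (ZMod.stdAddChar ((b.1 * a.2 : ℤ) : ZMod N) : ℂ)
        = ZMod.stdAddChar ((a.1 : ZMod N) * i)
          * ZMod.stdAddChar ((b.1 : ZMod N) * (i + (a.2 : ZMod N))) := by
      rw [← AddChar.map_add_eq_mul, ← AddChar.map_add_eq_mul]
      congr 1
      push_cast [Prod.fst_add]
      ring
    rw [← eN_int] at e1
    have e2 : eN N (-(cross a b) / 2) * eN N ((a + b).1 * (a + b).2 / 2)
        = eN N (a.1 * a.2 / 2) * eN N (b.1 * b.2 / 2) * eN N ((b.1 * a.2 : ℤ) : ℂ) := by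
      rw [← eN_add, ← eN_add, ← eN_add]
      congr 1
      simp only [cross, Prod.fst_add, Prod.snd_add]
      push_cast
      ring
    have e3 : (j = i + (a.2 : ZMod N) + (b.2 : ZMod N)) ↔ j = i + ((a + b).2 : ZMod N) := by
      rw [Prod.snd_add, Int.cast_add, add_assoc]
    simp only [e3]
    split_ifs
    · linear_combination (-((N : ℂ) / (2 * Real.pi * I)) ^ 2 * eN N (a.1 * a.2 / 2)
        * eN N (b.1 * b.2 / 2)) * e1 - ((N : ℂ) / (2 * Real.pi * I)) ^ 2
        * ZMod.stdAddChar (((a + b).1 : ZMod N) * i) * e2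
    · ring
  · intro m _ hm
    rw [T_apply, if_neg hm]
    ring
  · simp

lemma twisted_T (i j : ZMod N) : Twisted N fun a => T N a i j := by
  intro a v
  have hN : (N : ℂ) ≠ 0 := Nat.cast_ne_zero.2 (NeZero.ne N)
  simp only [T_apply]
  have h1 : ((a + (N : ℤ) • v).1 : ZMod N) = a.1 := by simp
  have h2 : ((a + (N : ℤ) • v).2 : ZMod N) = a.2 := by simp
  have h3 : eN N ((a + (N : ℤ) • v).1 * (a + (N : ℤ) • v).2 / 2)
      = (-1) ^ shiftExp N a v * eN N (a.1 * a.2 / 2) := by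
    rw [← exp_pi_mul_int]
    unfold eN
    rw [← Complex.exp_add]
    congr 1
    simp only [shiftExp, Prod.fst_add, Prod.snd_add, Prod.smul_fst, Prod.smul_snd, smul_eq_mul]
    push_cast
    field_simp
    ring
  rw [h1, h2, h3]
  ring

/-- The matrices `T_a` are linearly independent. -/
lemma eq_zero_of_sum_T {u : Idx N → ℂ} (h : ∀ i j, ∑ c, u c * T N (rep c) i j = 0) (c : Idx N) :
    u c = 0 := by
  obtain ⟨c₁, c₂⟩ := c
  have hκ : (N : ℂ) / (2 * Real.pi * I) ≠ 0 :=
    div_ne_zero (Nat.cast_ne_zero.2 (NeZero.ne N)) Complex.two_pi_I_ne_zero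
  -- The second index `c₂` selects a cyclic diagonal, along which the entries are the discrete
  -- Fourier transform of `Φ`; injectivity of the transform finishes.
  let Φ : ZMod N → ℂ := fun d => u (d, c₂) * ((N : ℂ) / (2 * Real.pi * I)
    * eN N ((rep (d, c₂)).1 * (rep (d, c₂)).2 / 2))
  have hΦ : Φ = 0 := by
    apply (ZMod.dft (N := N) (E := ℂ)).injective
    rw [map_zero]
    funext k
    rw [ZMod.dft_apply, Pi.zero_apply, ← h (-k) (-k + c₂), Fintype.sum_prod_type]
    refine Finset.sum_congr rfl fun d _ => ?_
    rw [Finset.sum_eq_single c₂]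
    · rw [T_apply]
      have e1 : (((rep (d, c₂) : ℤ × ℤ).1 : ℤ) : ZMod N) = d := by simp [rep]
      have e2 : (((rep (d, c₂) : ℤ × ℤ).2 : ℤ) : ZMod N) = c₂ := by simp [rep]
      rw [e1, e2, if_pos rfl, mul_neg, smul_eq_mul]
      ring
    · intro e _ he
      have e2 : (((rep (d, e) : ℤ × ℤ).2 : ℤ) : ZMod N) = e := by simp [rep]
      rw [T_apply, e2, if_neg (fun h => he (add_left_cancel h).symm)]
      ring
    · simp
  have := congrFun hΦ c₁
  simpa [Φ, hκ, eN] using this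

lemma eq_zero_of_sum_T_T {u : Idx N → Idx N → ℂ}
    (h : ∀ i j k l, ∑ c, ∑ d, u c d * T N (rep c) i j * T N (rep d) k l = 0) (c d : Idx N) :
    u c d = 0 := by
  refine eq_zero_of_sum_T (u := u c) (fun k l => ?_) d
  refine eq_zero_of_sum_T (u := fun c => ∑ d, u c d * T N (rep d) k l) (fun i j => ?_) c
  rw [← h i j k l]
  refine Finset.sum_congr rfl fun c _ => ?_
  rw [Finset.sum_mul]
  exact Finset.sum_congr rfl fun d _ => by ring

open Matrix in
/-- The commutator of `T_γ ⊗ T_{-γ}` with `T_α ⊗ T_β`. -/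
lemma commutator_T (g a b : ℤ × ℤ) :
    (-(2 * Real.pi * I / N)) •
      (Matrix.kronecker (T N g) (T N (-g)) * Matrix.kronecker (T N a) (T N b)
        - Matrix.kronecker (T N a) (T N b) * Matrix.kronecker (T N g) (T N (-g)))
      = C N g (a - b) • Matrix.kronecker (T N (a + g)) (T N (b - g)) := by
  have hN : (N : ℂ) ≠ 0 := Nat.cast_ne_zero.2 (NeZero.ne N)
  have hπ : (Real.pi : ℂ) ≠ 0 := by exact_mod_cast Real.pi_ne_zero
  unfold Matrix.kronecker
  rw [← Matrix.mul_kronecker_mul, ← Matrix.mul_kronecker_mul, T_mul_T, T_mul_T, T_mul_T, T_mul_T,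
    add_comm g a, neg_add_eq_sub, ← sub_eq_add_neg, Matrix.smul_kronecker, Matrix.smul_kronecker,
    Matrix.kronecker_smul, Matrix.kronecker_smul, smul_smul, smul_smul, ← sub_smul, smul_smul]
  congr 1
  -- The two orders of multiplication give opposite phases, whose difference is the sine in `C`.
  have e1 : eN N (-(cross g a) / 2) * eN N (-(cross (-g) b) / 2)
      = Complex.exp (-(Real.pi / N * (cross g (a - b) : ℂ)) * I) := by
    rw [← eN_add, eN]
    congr 1
    simp only [cross, Prod.fst_neg, Prod.snd_neg, Prod.fst_sub, Prod.snd_sub]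
    push_cast
    ring
  have e2 : eN N (-(cross a g) / 2) * eN N (-(cross b (-g)) / 2)
      = Complex.exp (Real.pi / N * (cross g (a - b) : ℂ) * I) := by
    rw [← eN_add, eN]
    congr 1
    simp only [cross, Prod.fst_neg, Prod.snd_neg, Prod.fst_sub, Prod.snd_sub]
    push_cast
    ring
  rw [mul_mul_mul_comm, e1, mul_mul_mul_comm, e2, C_eq, sinN, Complex.sin]
  have hI : I ≠ 0 := Complex.I_ne_zero
  field_simp
  ring_nf
  simp only [Complex.I_sq]
  ring

end Matrices

/-! ### The exchange relation in components -/

section Exchange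

open Classical

variable {n N : ℕ} [NeZero N] {τ : ℂ} {x : Fin n → ℂ}

lemma Lax_eq_sum (z : ℂ) (p : Phase n N) :
    Lax τ x z p = ∑ c : Idx N, laxForm τ x z (rep c) p • T N (rep c) := by
  rw [← Finset.add_sum_erase _ _ (Finset.mem_univ (0 : Idx N)), ← Finset.filter_ne', Lax,
    Finset.sum_comm]
  congr 1
  · rw [laxForm_rep_zero, rep_zero]
    simp [coord_none_apply, coord_some_apply, S0j, mul_comm]
  · refine Finset.sum_congr rfl fun c hc => ?_
    rw [laxForm_rep_of_ne z (Finset.mem_filter.1 hc).2, ← Finset.sum_smul]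
    congr 1
    simp [coord_some_apply, S_rep, mul_comm]

lemma rMatrix_eq_sum (z : ℂ) : rMatrix N τ z = ∑ c : Idx N, varphi0 N τ (rep c) z
    • Matrix.kronecker (T N (rep c)) (T N (-rep c)) := by
  rw [rMatrix, Finset.sum_filter]
  refine Finset.sum_congr rfl fun c _ => ?_
  unfold varphi0
  rw [cls_rep]
  by_cases hc : c = 0 <;> simp [hc]

lemma kronecker_sum (u v : Idx N → ℂ) :
    Matrix.kronecker (∑ c, u c • T N (rep c)) (∑ c, v c • T N (rep c))
      = ∑ c, ∑ d, (u c * v d) • Matrix.kronecker (T N (rep c)) (T N (rep d)) := by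
  ext ⟨i, k⟩ ⟨j, l⟩
  simp only [Matrix.kronecker, Matrix.kroneckerMap_apply, Matrix.sum_apply, Matrix.smul_apply,
    smul_eq_mul, Finset.sum_mul_sum]
  exact Finset.sum_congr rfl fun c _ => Finset.sum_congr rfl fun d _ => by ring

/-- Each triple of basis elements contributes to `T_{α+γ} ⊗ T_{β-γ}`; shifting `α` by `-γ` and `β`
by `γ` collects the coefficients into a convolution. The shifts preserve `C(γ, α - β)` because γ
pairs to zero with itself. -/
lemma commutator_eq_sum {A B k : ℤ × ℤ → ℂ} (hA : Twisted N A) (hB : Twisted N B)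
    (i j l m : ZMod N) :
    ((-(2 * Real.pi * I / N)) •
      ((∑ g : Idx N, k (rep g) • Matrix.kronecker (T N (rep g)) (T N (-rep g)))
          * Matrix.kronecker (∑ c : Idx N, A (rep c) • T N (rep c))
            (∑ c : Idx N, B (rep c) • T N (rep c))
        - Matrix.kronecker (∑ c : Idx N, A (rep c) • T N (rep c))
            (∑ c : Idx N, B (rep c) • T N (rep c))
          * ∑ g : Idx N, k (rep g) • Matrix.kronecker (T N (rep g)) (T N (-rep g)))) (i, l) (j, m)
      = ∑ c : Idx N, ∑ d : Idx N, twConv N A B k (rep c) (rep d) * T N (rep c) i j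
        * T N (rep d) l m := by
  have h1 : (-(2 * Real.pi * I / N)) •
      ((∑ g : Idx N, k (rep g) • Matrix.kronecker (T N (rep g)) (T N (-rep g)))
          * Matrix.kronecker (∑ c : Idx N, A (rep c) • T N (rep c))
            (∑ c : Idx N, B (rep c) • T N (rep c))
        - Matrix.kronecker (∑ c : Idx N, A (rep c) • T N (rep c))
            (∑ c : Idx N, B (rep c) • T N (rep c))
          * ∑ g : Idx N, k (rep g) • Matrix.kronecker (T N (rep g)) (T N (-rep g)))
      = ∑ g : Idx N, ∑ c : Idx N, ∑ d : Idx N, (k (rep g) * (A (rep c) * B (rep d))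
        * C N (rep g) (rep c - rep d))
          • Matrix.kronecker (T N (rep c + rep g)) (T N (rep d - rep g)) := by
    rw [kronecker_sum, Finset.sum_mul, Finset.mul_sum, ← Finset.sum_sub_distrib, Finset.smul_sum]
    refine Finset.sum_congr rfl fun g _ => ?_
    rw [Finset.mul_sum, Finset.sum_mul, ← Finset.sum_sub_distrib, Finset.smul_sum]
    refine Finset.sum_congr rfl fun c _ => ?_
    rw [Finset.mul_sum, Finset.sum_mul, ← Finset.sum_sub_distrib, Finset.smul_sum]
    refine Finset.sum_congr rfl fun d _ => ?_
    rw [mul_smul (k (rep g) * _), ← commutator_T, smul_mul_smul_comm, smul_mul_smul_comm,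
      mul_comm (A (rep c) * B (rep d)) (k (rep g)), ← smul_sub, smul_comm]
  rw [h1]
  simp only [Matrix.sum_apply, Matrix.smul_apply, Matrix.kronecker, Matrix.kroneckerMap_apply,
    smul_eq_mul]
  -- The shifted index leaves the standard representatives, so the summand must be a class function:
  -- the signs of `C`, `A` and `T` cancel.
  have h2 : ∀ g b : ℤ × ℤ, ∑ c : Idx N, k g * (A (rep c) * B b) * C N g (rep c - b)
        * (T N (rep c + g) i j * T N (b - g) l m)
      = ∑ c : Idx N, k g * (A (rep c - g) * B b) * C N g (rep c - b)
        * (T N (rep c) i j * T N (b - g) l m) := by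
    intro g b
    have hf : ClassFun N fun a => k g * (A a * B b) * C N g (a - b)
        * (T N (a + g) i j * T N (b - g) l m) := by
      intro a v
      simp only
      have hT := twisted_T i j (a + g) v
      simp only at hT
      rw [show a + (N : ℤ) • v - b = a - b + (N : ℤ) • v by abel, C_shift_right, hA,
        show a + (N : ℤ) • v + g = a + g + (N : ℤ) • v by abel, hT]
      have h : (-1 : ℂ) ^ cross v g * (-1) ^ shiftExp N a v * (-1) ^ shiftExp N (a + g) v = 1 := by
        rw [← zpow_add₀ (by norm_num), ← zpow_add₀ (by norm_num)]
        refine Even.neg_one_zpow ⟨shiftExp N a v + v.1 * g.2, ?_⟩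
        simp only [cross, shiftExp, Prod.fst_add, Prod.snd_add]
        ring
      linear_combination k g * (A a * B b) * C N g (a - b)
        * (T N (a + g) i j * T N (b - g) l m) * h
    rw [← sum_rep_add_right hf (-g)]
    refine Finset.sum_congr rfl fun c _ => ?_
    rw [neg_add_cancel_right, ← sub_eq_add_neg,
      C_congr (a := g) (b := rep c - g - b) (a' := g) (b' := rep c - b) (by simp [cross]; ring)]
  have h3 : ∀ g a : ℤ × ℤ, ∑ d : Idx N, k g * (A (a - g) * B (rep d)) * C N g (a - rep d)
        * (T N a i j * T N (rep d - g) l m)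
      = ∑ d : Idx N, k g * (A (a - g) * B (rep d + g)) * C N g (a - rep d)
        * (T N a i j * T N (rep d) l m) := by
    intro g a
    have hf : ClassFun N fun b => k g * (A (a - g) * B b) * C N g (a - b)
        * (T N a i j * T N (b - g) l m) := by
      intro b v
      simp only
      have hT := twisted_T l m (b - g) v
      simp only at hT
      rw [show a - (b + (N : ℤ) • v) = a - b + (N : ℤ) • (-v) by rw [smul_neg]; abel,
        C_shift_right, hB, show b + (N : ℤ) • v - g = b - g + (N : ℤ) • v by abel, hT]
      have h : (-1 : ℂ) ^ cross (-v) g * (-1) ^ shiftExp N b v * (-1) ^ shiftExp N (b - g) v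
          = 1 := by
        rw [← zpow_add₀ (by norm_num), ← zpow_add₀ (by norm_num)]
        refine Even.neg_one_zpow ⟨shiftExp N b v - v.1 * g.2, ?_⟩
        simp only [cross, shiftExp, Prod.fst_sub, Prod.snd_sub, Prod.fst_neg, Prod.snd_neg]
        ring
      linear_combination k g * (A (a - g) * B b) * C N g (a - b)
        * (T N a i j * T N (b - g) l m) * h
    rw [← sum_rep_add_right hf g]
    refine Finset.sum_congr rfl fun d _ => ?_
    rw [add_sub_cancel_right,
      C_congr (a := g) (b := a - (rep d + g)) (a' := g) (b' := a - rep d) (by simp [cross]; ring)]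
  calc _ = ∑ g : Idx N, ∑ d : Idx N, ∑ c : Idx N, k (rep g) * (A (rep c) * B (rep d))
        * C N (rep g) (rep c - rep d) * (T N (rep c + rep g) i j * T N (rep d - rep g) l m) :=
        Finset.sum_congr rfl fun g _ => Finset.sum_comm
    _ = ∑ g : Idx N, ∑ c : Idx N, ∑ d : Idx N, k (rep g) * (A (rep c - rep g) * B (rep d))
        * C N (rep g) (rep c - rep d) * (T N (rep c) i j * T N (rep d - rep g) l m) := by
        refine Finset.sum_congr rfl fun g _ => ?_
        rw [Finset.sum_congr rfl fun d _ => h2 (rep g) (rep d), Finset.sum_comm]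
    _ = ∑ g : Idx N, ∑ c : Idx N, ∑ d : Idx N, k (rep g) * (A (rep c - rep g) * B (rep d + rep g))
        * C N (rep g) (rep c - rep d) * (T N (rep c) i j * T N (rep d) l m) :=
        Finset.sum_congr rfl fun g _ => Finset.sum_congr rfl fun c _ => h3 (rep g) (rep c)
    _ = _ := by
        rw [Finset.sum_comm]
        refine Finset.sum_congr rfl fun c _ => ?_
        rw [Finset.sum_comm]
        refine Finset.sum_congr rfl fun d _ => ?_
        rw [twConv, Finset.sum_mul, Finset.sum_mul]
        refine Finset.sum_congr rfl fun g _ => ?_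
        rw [twTerm]
        ring

/-- The exchange relation, in components. -/
theorem satisfiesExchange_iff (P : HolomorphicPoisson (Phase n N)) :
    SatisfiesExchange τ x P ↔ ∀ p, ComponentExchange τ x p (P.bivector p) := by
  have hL : ∀ z : ℂ, ∀ i j : ZMod N, (fun q : Phase n N => Lax τ x z q i j)
      = ⇑(∑ c : Idx N, T N (rep c) i j • laxForm (n := n) τ x z (rep c)) := by
    intro z i j
    funext q
    rw [Lax_eq_sum]
    simp [Matrix.sum_apply, mul_comm]
  have hleft : ∀ (z w : ℂ) (p : Phase n N) (i j l m : ZMod N),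
      P.bracket (fun q => Lax τ x z q i j) (fun q => Lax τ x w q l m) p
        = ∑ c : Idx N, ∑ d : Idx N, P.bivector p (laxForm τ x z (rep c)) (laxForm τ x w (rep d))
          * T N (rep c) i j * T N (rep d) l m := by
    intro z w p i j l m
    rw [hL, hL, P.bracket_clm]
    simp only [map_sum, map_smul, LinearMap.sum_apply, LinearMap.smul_apply, smul_eq_mul,
      Finset.mul_sum]
    rw [Finset.sum_comm]
    exact Finset.sum_congr rfl fun c _ => Finset.sum_congr rfl fun d _ => by ring
  have hright : ∀ (z w : ℂ) (p : Phase n N) (i j l m : ZMod N),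
      ((-(2 * Real.pi * Complex.I / N)) •
          (rMatrix N τ (z - w) * Matrix.kronecker (Lax τ x z p) (Lax τ x w p)
            - Matrix.kronecker (Lax τ x z p) (Lax τ x w p) * rMatrix N τ (z - w))) (i, l) (j, m)
        = ∑ c : Idx N, ∑ d : Idx N,
          exchCoeff N τ x (S0 p) (fun j a => S j a p) z w (rep c) (rep d)
          * T N (rep c) i j * T N (rep d) l m := by
    intro z w p i j l m
    have h := commutator_eq_sum (k := fun g => varphi0 N τ g (z - w))
      (twisted_laxCoeff (τ := τ) (x := x) (s0 := S0 p) (twisted_S p) z)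
      (twisted_laxCoeff (τ := τ) (x := x) (s0 := S0 p) (twisted_S p) w) i j l m
    rw [rMatrix_eq_sum, Lax_eq_sum, Lax_eq_sum]
    simp_rw [laxForm_apply]
    exact h
  constructor
  · intro h p z w hz hw hzw c d
    rw [← sub_eq_zero]
    refine eq_zero_of_sum_T_T (u := fun c d => P.bivector p (laxForm τ x z (rep c))
      (laxForm τ x w (rep d)) - exchCoeff N τ x (S0 p) (fun j a => S j a p) z w (rep c) (rep d))
      (fun i j l m => ?_) c d
    simp only [sub_mul, Finset.sum_sub_distrib]
    rw [← hleft, ← hright, sub_eq_zero, ← h z w hz hw hzw p, Matrix.of_apply]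
  · intro h z w hz hw hzw p
    ext ⟨i, l⟩ ⟨j, m⟩
    rw [Matrix.of_apply, hright, hleft]
    exact Finset.sum_congr rfl fun c _ => Finset.sum_congr rfl fun d _ => by
      rw [h p z w hz hw hzw c d]

/-- The quadratic brackets are equivalent to the exchange relation. -/
theorem hasQuadraticBrackets_iff_satisfiesExchange (hτ : 0 < τ.im)
    (hx : ∀ j k, j ≠ k → ¬ InLattice τ (x j - x k)) (P : HolomorphicPoisson (Phase n N)) :
    HasQuadraticBrackets τ x P ↔ SatisfiesExchange τ x P := by
  rw [hasQuadraticBrackets_iff hτ, satisfiesExchange_iff]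
  refine forall_congr' fun p => ⟨fun h => ?_, fun h => h.eq_quadBivector hτ hx⟩
  rw [h]
  exact componentExchange_quadBivector hτ hx p

end Exchange

/-! ### Holomorphic functions of several variables -/

section Holomorphic

open Metric MeasureTheory

variable {E : Type*} [NormedAddCommGroup E] [NormedSpace ℂ E]

lemma hasDerivAt_line {F : E → ℂ} {q v : E} {t : ℂ} (hF : DifferentiableAt ℂ F (q + t • v)) :
    HasDerivAt (fun t : ℂ => F (q + t • v)) (fderiv ℂ F (q + t • v) v) t := by
  have h : HasDerivAt (fun t : ℂ => q + t • v) v t := by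
    simpa using ((hasDerivAt_id t).smul_const v).const_add q
  exact hF.hasFDerivAt.comp_hasDerivAt t h

/-- Cauchy's estimate on the complex line through `q` in direction `v`, on the disc of radius `R /
‖v‖`. -/
lemma norm_fderiv_le {F : E → ℂ} {q : E} {R M : ℝ} (hR : 0 < R)
    (hF : ∀ y ∈ closedBall q R, DifferentiableAt ℂ F y) (hM : ∀ y ∈ closedBall q R, ‖F y‖ ≤ M) :
    ‖fderiv ℂ F q‖ ≤ M / R := by
  have hM0 : 0 ≤ M := (norm_nonneg _).trans (hM q (mem_closedBall_self hR.le))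
  refine ContinuousLinearMap.opNorm_le_bound _ (div_nonneg hM0 hR.le) fun v => ?_
  by_cases hv : v = 0
  · simp [hv]
  have hv' : 0 < ‖v‖ := norm_pos_iff.2 hv
  have hmem : ∀ t ∈ closedBall (0 : ℂ) (R / ‖v‖), q + t • v ∈ closedBall q R := by
    intro t ht
    rw [mem_closedBall_zero_iff] at ht
    rw [mem_closedBall, dist_eq_norm, add_sub_cancel_left, norm_smul]
    calc ‖t‖ * ‖v‖ ≤ R / ‖v‖ * ‖v‖ := by gcongr
      _ = R := div_mul_cancel₀ _ hv'.ne'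
  have hd : deriv (fun t : ℂ => F (q + t • v)) 0 = fderiv ℂ F q v := by
    have := (hasDerivAt_line (F := F) (q := q) (v := v) (t := 0)
      (by simpa using hF q (mem_closedBall_self hR.le))).deriv
    simpa using this
  rw [← hd]
  refine (Complex.norm_deriv_le_of_forall_mem_sphere_norm_le (div_pos hR hv') ?_
    fun t ht => hM _ (hmem t (sphere_subset_closedBall ht))).trans_eq ?_
  · refine DifferentiableOn.diffContOnCl_ball (U := closedBall 0 (R / ‖v‖)) ?_ subset_rfl
    exact fun t ht =>
      (hasDerivAt_line (hF _ (hmem t ht))).differentiableAt.differentiableWithinAt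
  · field_simp

variable [FiniteDimensional ℂ E]

/-- The derivative of a holomorphic function of several variables is holomorphic. -/
lemma differentiableAt_fderiv_apply {U : Set E} (hU : IsOpen U) {F : E → ℂ}
    (hF : DifferentiableOn ℂ F U) {p : E} (hp : p ∈ U) (v : E) :
    DifferentiableAt ℂ (fun q => fderiv ℂ F q v) p := by
  have hFd : ∀ y ∈ U, DifferentiableAt ℂ F y := fun y hy => hF.differentiableAt (hU.mem_nhds hy)
  -- The radii are nested: `F` is bounded on radius `4R`, so its derivative is bounded on `3R`, and
  -- the circles of radius `ρ` in direction `v` about points of radius `R` stay inside `3R`.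
  obtain ⟨R, hR, hRU⟩ : ∃ R > 0, ∀ y ∈ ball p (4 * R), y ∈ U ∧ ‖F y‖ ≤ ‖F p‖ + 1 := by
    have h1 : ∀ᶠ y in 𝓝 p, y ∈ U ∧ ‖F y‖ < ‖F p‖ + 1 :=
      (hU.eventually_mem hp).and
        ((hFd p hp).continuousAt.norm.eventually_lt_const (lt_add_one _))
    obtain ⟨ε, hε, h⟩ := Metric.eventually_nhds_iff_ball.1 h1
    refine ⟨ε / 4, by positivity, fun y hy => ?_⟩
    rw [mul_div_cancel₀ _ (by norm_num)] at hy
    exact ⟨(h y hy).1, (h y hy).2.le⟩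
  set M := ‖F p‖ + 1
  have hbound : ∀ y ∈ ball p (3 * R), ‖fderiv ℂ F y‖ ≤ M / (R / 2) := by
    intro y hy
    have hsub : ∀ y' ∈ closedBall y (R / 2), y' ∈ ball p (4 * R) := by
      intro y' hy'
      rw [mem_ball] at hy ⊢
      rw [mem_closedBall] at hy'
      linarith [dist_triangle y' y p]
    exact norm_fderiv_le (by positivity) (fun y' hy' => hFd y' (hRU y' (hsub y' hy')).1)
      fun y' hy' => (hRU y' (hsub y' hy')).2
  obtain ⟨ρ, hρ, hρv⟩ : ∃ ρ > 0, ρ * ‖v‖ ≤ R :=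
    ⟨R / (‖v‖ + 1), by positivity, by
      rw [div_mul_eq_mul_div, div_le_iff₀ (by positivity)]
      nlinarith [norm_nonneg v]⟩
  have hmem : ∀ q ∈ ball p R, ∀ t ∈ closedBall (0 : ℂ) ρ, q + t • v ∈ ball p (3 * R) := by
    intro q hq t ht
    rw [mem_closedBall_zero_iff] at ht
    rw [mem_ball, dist_eq_norm] at hq ⊢
    have h1 : ‖t • v‖ ≤ R := by
      rw [norm_smul]
      exact (mul_le_mul_of_nonneg_right ht (norm_nonneg v)).trans hρv
    calc ‖q + t • v - p‖ = ‖(q - p) + t • v‖ := by congr 1; abel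
      _ ≤ ‖q - p‖ + ‖t • v‖ := norm_add_le _ _
      _ < 3 * R := by linarith
  have hdiff : ∀ q ∈ ball p R, ∀ t ∈ closedBall (0 : ℂ) ρ, DifferentiableAt ℂ F (q + t • v) :=
    fun q hq t ht => hFd _ (hRU _ (ball_subset_ball (by linarith) (hmem q hq t ht))).1
  let Φ : ℝ → ℂ := fun θ => deriv (circleMap 0 ρ) θ * ((circleMap 0 ρ θ - 0) ^ 2)⁻¹
  have hΦ : Continuous Φ := by
    have h1 : Continuous (circleMap 0 ρ) := continuous_circleMap 0 ρ
    simp only [Φ, deriv_circleMap]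
    refine (h1.mul continuous_const).mul (Continuous.inv₀ (by fun_prop) fun θ => ?_)
    rw [sub_zero]
    exact pow_ne_zero 2 (circleMap_ne_center hρ.ne')
  have hcirc : ∀ θ, circleMap 0 ρ θ ∈ closedBall (0 : ℂ) ρ :=
    fun θ => circleMap_mem_closedBall 0 hρ.le θ
  -- Cauchy's formula writes the directional derivative as an integral of values of `F`, which can
  -- be differentiated in `q` under the integral sign.
  have hcauchy : ∀ q ∈ ball p R, fderiv ℂ F q v
      = (2 * Real.pi * I : ℂ)⁻¹ * ∫ θ in (0 : ℝ)..2 * Real.pi,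
        Φ θ * F (q + circleMap 0 ρ θ • v) := by
    intro q hq
    have h0 : (0 : ℂ) ∈ closedBall (0 : ℂ) ρ := mem_closedBall_self hρ.le
    have hd : deriv (fun t : ℂ => F (q + t • v)) 0 = fderiv ℂ F q v := by
      have := (hasDerivAt_line (hdiff q hq 0 h0)).deriv
      simpa using this
    have hopen : IsOpen ((fun t : ℂ => q + t • v) ⁻¹' ball p (4 * R)) :=
      isOpen_ball.preimage (by fun_prop)
    have h := Complex.two_pi_I_inv_smul_circleIntegral_sub_sq_inv_smul_of_differentiable hopen
      (c := 0) (R := ρ) (w₀ := 0) (f := fun t : ℂ => F (q + t • v))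
      (fun t ht => ball_subset_ball (by linarith) (hmem q hq t ht))
      (fun t ht => (hasDerivAt_line
        (hFd _ (hRU _ ht).1)).differentiableAt.differentiableWithinAt) (mem_ball_self hρ)
    rw [← hd, ← h, circleIntegral]
    simp only [smul_eq_mul, Φ, mul_assoc]
  borelize E
  have hmain := intervalIntegral.hasFDerivAt_integral_of_dominated_of_fderiv_le (𝕜 := ℂ)
    (μ := volume) (a := 0) (b := 2 * Real.pi) (s := ball p R) (x₀ := p)
    (F := fun q θ => Φ θ * F (q + circleMap 0 ρ θ • v))
    (F' := fun q θ => Φ θ • fderiv ℂ F (q + circleMap 0 ρ θ • v))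
    (bound := fun θ => ‖Φ θ‖ * (M / (R / 2))) (ball_mem_nhds p hR)
    (by
      filter_upwards [ball_mem_nhds p hR] with q hq
      refine Continuous.aestronglyMeasurable (hΦ.mul ?_)
      rw [continuous_iff_continuousAt]
      intro θ
      have h1 : Continuous fun θ : ℝ => q + circleMap 0 ρ θ • v := by
        have := continuous_circleMap 0 ρ
        fun_prop
      exact ContinuousAt.comp (f := fun θ : ℝ => q + circleMap 0 ρ θ • v)
        (hdiff q hq _ (hcirc θ)).continuousAt h1.continuousAt)
    (by
      refine Continuous.intervalIntegrable (hΦ.mul ?_) _ _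
      rw [continuous_iff_continuousAt]
      intro θ
      have h1 : Continuous fun θ : ℝ => p + circleMap 0 ρ θ • v := by
        have := continuous_circleMap 0 ρ
        fun_prop
      exact ContinuousAt.comp (f := fun θ : ℝ => p + circleMap 0 ρ θ • v)
        (hdiff p (mem_ball_self hR) _ (hcirc θ)).continuousAt h1.continuousAt)
    (by
      have h1 : Measurable fun θ : ℝ => p + circleMap 0 ρ θ • v := by
        have := continuous_circleMap 0 ρ
        exact Continuous.measurable (by fun_prop)
      have h2 : Measurable fun θ : ℝ => fderiv ℂ F (p + circleMap 0 ρ θ • v) :=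
        (measurable_fderiv ℂ F).comp h1
      exact (hΦ.measurable.smul h2).aestronglyMeasurable)
    (Eventually.of_forall fun θ _ q hq => by
      rw [norm_smul]
      exact mul_le_mul_of_nonneg_left (hbound _ (hmem q hq _ (hcirc θ))) (norm_nonneg _))
    (Continuous.intervalIntegrable (by fun_prop) _ _)
    (Eventually.of_forall fun θ _ q hq => by
      have h1 := (hdiff q hq _ (hcirc θ)).hasFDerivAt
      have h2 : HasFDerivAt (fun q : E => q + circleMap 0 ρ θ • v)
        (ContinuousLinearMap.id ℂ E) q := (hasFDerivAt_id q).add_const _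
      have h3 := (h1.comp q h2).const_mul (Φ θ)
      rwa [ContinuousLinearMap.comp_id] at h3)
  refine ((hmain.differentiableAt.const_mul (2 * Real.pi * I : ℂ)⁻¹)).congr_of_eventuallyEq ?_
  filter_upwards [ball_mem_nhds p hR] with q hq using hcauchy q hq

/-- The coordinate functionals of a basis. -/
def dualCoord (i : Fin (Module.finrank ℂ E)) : E →L[ℂ] ℂ :=
  LinearMap.toContinuousLinearMap ((Module.finBasis ℂ E).coord i)

lemma sum_apply_basis_smul_dualCoord (ξ : E →L[ℂ] ℂ) :
    ∑ i, ξ (Module.finBasis ℂ E i) • dualCoord i = ξ := by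
  ext v
  conv_rhs => rw [← (Module.finBasis ℂ E).sum_repr v, map_sum]
  simp [dualCoord, mul_comm]

lemma differentiableAt_fderiv {U : Set E} (hU : IsOpen U) {F : E → ℂ}
    (hF : DifferentiableOn ℂ F U) {p : E} (hp : p ∈ U) :
    DifferentiableAt ℂ (fderiv ℂ F) p := by
  have h : fderiv ℂ F = fun q => ∑ i, fderiv ℂ F q (Module.finBasis ℂ E i) • dualCoord i :=
    funext fun q => (sum_apply_basis_smul_dualCoord _).symm
  rw [h]
  exact DifferentiableAt.fun_sum fun i _ =>
    (differentiableAt_fderiv_apply hU hF hp _).smul_const _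

lemma fderiv_fderiv_symm {U : Set E} (hU : IsOpen U) {F : E → ℂ}
    (hF : DifferentiableOn ℂ F U) {p : E} (hp : p ∈ U) (v w : E) :
    fderiv ℂ (fderiv ℂ F) p v w = fderiv ℂ (fderiv ℂ F) p w v := by
  refine second_derivative_symmetric_of_eventually (𝕜 := ℂ) (f := F) ?_
    (differentiableAt_fderiv hU hF hp).hasFDerivAt v w
  filter_upwards [hU.mem_nhds hp] with q hq
  exact (hF.differentiableAt (hU.mem_nhds hq)).hasFDerivAt

end Holomorphic

/-! ### The Jacobi identity from linear functionals -/

section Jacobi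

variable {E : Type*} [NormedAddCommGroup E] [NormedSpace ℂ E] [FiniteDimensional ℂ E]
  {π : E → (E →L[ℂ] ℂ) →ₗ[ℂ] (E →L[ℂ] ℂ) →ₗ[ℂ] ℂ}

/-- The vector `π_p(·, η)`. -/
def contraction (π : E → (E →L[ℂ] ℂ) →ₗ[ℂ] (E →L[ℂ] ℂ) →ₗ[ℂ] ℂ) (p : E) (η : E →L[ℂ] ℂ) : E :=
  ∑ i, π p (dualCoord i) η • Module.finBasis ℂ E i

lemma apply_contraction (p : E) (ξ η : E →L[ℂ] ℂ) : ξ (contraction π p η) = π p ξ η := by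
  conv_rhs => rw [← sum_apply_basis_smul_dualCoord ξ]
  simp [contraction, map_sum, mul_comm]

lemma apply_apply_eq_sum (p : E) (ξ η : E →L[ℂ] ℂ) :
    π p ξ η = ∑ i, ∑ j, ξ (Module.finBasis ℂ E i) * η (Module.finBasis ℂ E j)
      * π p (dualCoord i) (dualCoord j) := by
  conv_lhs => rw [← sum_apply_basis_smul_dualCoord ξ, ← sum_apply_basis_smul_dualCoord η]
  simp only [map_sum, map_smul, LinearMap.sum_apply, LinearMap.smul_apply, smul_eq_mul,
    Finset.mul_sum]
  rw [Finset.sum_comm]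
  exact Finset.sum_congr rfl fun i _ => Finset.sum_congr rfl fun j _ => by ring

/-- The product rule in a basis: the bivector varies, or one of the differentials does, and the
latter terms are Hessians contracted with a Hamiltonian vector. Antisymmetry gives the minus sign.
-/
lemma fderiv_bivectorBracket (hπ : ∀ ξ η, Differentiable ℂ fun p => π p ξ η)
    (halt : ∀ p ξ, π p ξ ξ = 0) {U : Set E} (hU : IsOpen U) {F G : E → ℂ}
    (hF : DifferentiableOn ℂ F U) (hG : DifferentiableOn ℂ G U) {p : E} (hp : p ∈ U) :
    fderiv ℂ (bivectorBracket π F G) p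
      = fderiv ℂ (fun q => π q (fderiv ℂ F p) (fderiv ℂ G p)) p
        + (fderiv ℂ (fderiv ℂ F) p).flip (contraction π p (fderiv ℂ G p))
        - (fderiv ℂ (fderiv ℂ G) p).flip (contraction π p (fderiv ℂ F p)) := by
  set b := Module.finBasis ℂ E
  have hF' := (differentiableAt_fderiv hU hF hp).hasFDerivAt
  have hG' := (differentiableAt_fderiv hU hG hp).hasFDerivAt
  have h1 : bivectorBracket π F G = fun q => ∑ i, ∑ j, fderiv ℂ F q (b i) * fderiv ℂ G q (b j)
      * π q (dualCoord i) (dualCoord j) := funext fun q => apply_apply_eq_sum q _ _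
  have h2 : (fun q => π q (fderiv ℂ F p) (fderiv ℂ G p)) = fun q => ∑ i, ∑ j,
      fderiv ℂ F p (b i) * fderiv ℂ G p (b j) * π q (dualCoord i) (dualCoord j) :=
    funext fun q => apply_apply_eq_sum q _ _
  have e1 : ∀ i, HasFDerivAt (fun q => fderiv ℂ F q (b i))
      ((fderiv ℂ (fderiv ℂ F) p).flip (b i)) p :=
    fun i => by simpa using hF'.clm_apply (hasFDerivAt_const (b i) p)
  have e2 : ∀ i, HasFDerivAt (fun q => fderiv ℂ G q (b i))
      ((fderiv ℂ (fderiv ℂ G) p).flip (b i)) p :=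
    fun i => by simpa using hG'.clm_apply (hasFDerivAt_const (b i) p)
  have e3 : ∀ i j, HasFDerivAt (fun q => π q (dualCoord i) (dualCoord j))
      (fderiv ℂ (fun q => π q (dualCoord i) (dualCoord j)) p) p := fun i j =>
    (hπ _ _ p).hasFDerivAt
  have d1 := (HasFDerivAt.fun_sum fun i (_ : i ∈ Finset.univ) =>
    HasFDerivAt.fun_sum fun j (_ : j ∈ Finset.univ) => ((e1 i).mul (e2 j)).mul (e3 i j)).fderiv
  have d2 := (HasFDerivAt.fun_sum fun i (_ : i ∈ Finset.univ) =>
    HasFDerivAt.fun_sum fun j (_ : j ∈ Finset.univ) =>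
      (e3 i j).const_mul (fderiv ℂ F p (b i) * fderiv ℂ G p (b j))).fderiv
  simp only [Pi.mul_apply] at d1
  rw [h1, h2, d1, d2]
  ext v
  have c1 : fderiv ℂ (fderiv ℂ F) p v (contraction π p (fderiv ℂ G p))
      = ∑ i, ∑ j, fderiv ℂ (fderiv ℂ F) p v (b i) * fderiv ℂ G p (b j)
        * π p (dualCoord i) (dualCoord j) := by
    rw [apply_contraction, apply_apply_eq_sum]
  have c2 : fderiv ℂ (fderiv ℂ G) p v (contraction π p (fderiv ℂ F p))
      = -∑ i, ∑ j, fderiv ℂ F p (b i) * fderiv ℂ (fderiv ℂ G) p v (b j)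
        * π p (dualCoord i) (dualCoord j) := by
    rw [apply_contraction, swap_of_alternating (halt p), apply_apply_eq_sum]
  simp only [_root_.sub_apply, _root_.add_apply, ContinuousLinearMap.flip_apply, c1, c2,
    _root_.sum_apply, _root_.smul_apply, smul_eq_mul]
  rw [sub_neg_eq_add, ← Finset.sum_add_distrib, ← Finset.sum_add_distrib]
  refine Finset.sum_congr rfl fun i _ => ?_
  rw [← Finset.sum_add_distrib, ← Finset.sum_add_distrib]
  exact Finset.sum_congr rfl fun j _ => by ring

/-- The Jacobi identity for linear functionals implies it for all holomorphic functions. -/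
theorem jacobi_of_linear (hπ : ∀ ξ η, Differentiable ℂ fun p => π p ξ η)
    (halt : ∀ p ξ, π p ξ ξ = 0)
    (hlin : ∀ p (ξ η ζ : E →L[ℂ] ℂ), π p (fderiv ℂ (fun q => π q ξ η) p) ζ
      + π p (fderiv ℂ (fun q => π q η ζ) p) ξ + π p (fderiv ℂ (fun q => π q ζ ξ) p) η = 0)
    {U : Set E} (hU : IsOpen U) {F G H : E → ℂ} (hF : DifferentiableOn ℂ F U)
    (hG : DifferentiableOn ℂ G U) (hH : DifferentiableOn ℂ H U) {p : E} (hp : p ∈ U) :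
    bivectorBracket π (bivectorBracket π F G) H p + bivectorBracket π (bivectorBracket π G H) F p
      + bivectorBracket π (bivectorBracket π H F) G p = 0 := by
  have key : ∀ {F G : E → ℂ}, DifferentiableOn ℂ F U → DifferentiableOn ℂ G U → ∀ H : E → ℂ,
      bivectorBracket π (bivectorBracket π F G) H p
      = π p (fderiv ℂ (fun q => π q (fderiv ℂ F p) (fderiv ℂ G p)) p) (fderiv ℂ H p)
        + fderiv ℂ (fderiv ℂ F) p (contraction π p (fderiv ℂ H p)) (contraction π p (fderiv ℂ G p))
        - fderiv ℂ (fderiv ℂ G) p (contraction π p (fderiv ℂ H p))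
          (contraction π p (fderiv ℂ F p)) := by
    intro F G hF hG H
    rw [bivectorBracket, fderiv_bivectorBracket hπ halt hU hF hG hp]
    simp only [map_add, map_sub, LinearMap.add_apply, LinearMap.sub_apply]
    congr 1
    · congr 1
      rw [← apply_contraction, ContinuousLinearMap.flip_apply]
    · rw [← apply_contraction, ContinuousLinearMap.flip_apply]
  -- Each Hessian occurs twice in the cyclic sum, with opposite signs and exchanged arguments, so
  -- symmetry cancels it.
  rw [key hF hG, key hG hH, key hH hF, fderiv_fderiv_symm hU hF hp,
    fderiv_fderiv_symm hU hG hp, fderiv_fderiv_symm hU hH hp]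
  linear_combination hlin p (fderiv ℂ F p) (fderiv ℂ G p) (fderiv ℂ H p)

end Jacobi

/-! ### Double sums over representatives -/

section DoubleSums

variable {N : ℕ}

/-- Functions of two pairs of integers that depend on their classes modulo `N` only. -/
def ClassFun₂ (N : ℕ) (F : ℤ × ℤ → ℤ × ℤ → ℂ) : Prop :=
  (∀ h, ClassFun N fun g => F g h) ∧ ∀ g, ClassFun N fun h => F g h

lemma ClassFun₂.congr {F : ℤ × ℤ → ℤ × ℤ → ℂ} (hF : ClassFun₂ N F) {g g' h h' : ℤ × ℤ}
    (hg : cls N g = cls N g') (hh : cls N h = cls N h') : F g h = F g' h' :=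
  ((hF.1 h).congr hg).trans ((hF.2 g').congr hh)

lemma ClassFun₂.sum_comp [NeZero N] {F : ℤ × ℤ → ℤ × ℤ → ℂ} (hF : ClassFun₂ N F)
    (e : Idx N × Idx N → Idx N × Idx N) (he : Function.Injective e)
    (u v : ℤ × ℤ → ℤ × ℤ → ℤ × ℤ)
    (huv : ∀ c d : Idx N, (cls N (u (rep c) (rep d)), cls N (v (rep c) (rep d))) = e (c, d)) :
    ∑ c : Idx N, ∑ d : Idx N, F (rep c) (rep d)
      = ∑ c : Idx N, ∑ d : Idx N, F (u (rep c) (rep d)) (v (rep c) (rep d)) := by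
  rw [← Fintype.sum_prod_type', ← Fintype.sum_prod_type']
  refine (Fintype.sum_bijective e (Finite.injective_iff_bijective.1 he) _ _ fun q => ?_).symm
  have h := huv q.1 q.2
  refine hF.congr ?_ ?_
  · rw [cls_rep, ← h]
  · rw [cls_rep, ← h]

variable [NeZero N] {s t r k l : ℤ × ℤ → ℂ}

lemma twisted_twTerm_left (hs : Twisted N s) (b g : ℤ × ℤ) :
    Twisted N fun a => twTerm N s t k a b g := by
  intro a v
  simp only [twTerm]
  rw [show a + (N : ℤ) • v - b = a - b + (N : ℤ) • v by abel, C_shift_right,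
    show a + (N : ℤ) • v - g = a - g + (N : ℤ) • v by abel, hs]
  have h : (-1 : ℂ) ^ cross v g * (-1) ^ shiftExp N (a - g) v = (-1) ^ shiftExp N a v := by
    rw [← zpow_add₀ (by norm_num)]
    refine neg_one_zpow_congr ⟨-(v.2 * g.1), ?_⟩
    simp only [cross, shiftExp, Prod.fst_sub, Prod.snd_sub]
    ring
  linear_combination (C N g (a - b) * s (a - g) * t (b + g) * k g) * h

/-- The summand of `twConv (fun a' => twConv s r l a' c) t k a b`. -/
def nestLeft (N : ℕ) (s t r k l : ℤ × ℤ → ℂ) (a b c g h : ℤ × ℤ) : ℂ :=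
  twTerm N (fun a' => twTerm N s r l a' c h) t k a b g

/-- The summand of `twConv s (fun b' => twConv t r l b' c) k a b`. -/
def nestRight (N : ℕ) (s t r k l : ℤ × ℤ → ℂ) (a b c g h : ℤ × ℤ) : ℂ :=
  twTerm N s (fun b' => twTerm N t r l b' c h) k a b g

lemma classFun₂_nestLeft (hs : Twisted N s) (ht : Twisted N t) (hr : Twisted N r)
    (hk : ClassFun N k) (hl : ClassFun N l) (a b c : ℤ × ℤ) :
    ClassFun₂ N (nestLeft N s t r k l a b c) := by
  refine ⟨fun h => classFun_twTerm (twisted_twTerm_left hs c h) ht hk a b, fun g h v => ?_⟩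
  have := classFun_twTerm hs hr hl (a - g) c h v
  simp only [nestLeft, twTerm] at this ⊢
  rw [this]

lemma classFun₂_nestRight (hs : Twisted N s) (ht : Twisted N t) (hr : Twisted N r)
    (hk : ClassFun N k) (hl : ClassFun N l) (a b c : ℤ × ℤ) :
    ClassFun₂ N (nestRight N s t r k l a b c) := by
  refine ⟨fun h => classFun_twTerm hs (twisted_twTerm_left ht c h) hk a b, fun g h v => ?_⟩
  have := classFun_twTerm ht hr hl (b + g) c h v
  simp only [nestRight, twTerm] at this ⊢
  rw [this]

lemma twConv_twConv_left (a b c : ℤ × ℤ) :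
    twConv N (fun a' => twConv N s r l a' c) t k a b
      = ∑ g : Idx N, ∑ h : Idx N, nestLeft N s t r k l a b c (rep g) (rep h) := by
  unfold twConv nestLeft
  refine Finset.sum_congr rfl fun g _ => ?_
  unfold twTerm
  rw [Finset.mul_sum, Finset.sum_mul, Finset.sum_mul]

lemma twConv_twConv_right (a b c : ℤ × ℤ) :
    twConv N s (fun b' => twConv N t r l b' c) k a b
      = ∑ g : Idx N, ∑ h : Idx N, nestRight N s t r k l a b c (rep g) (rep h) := by
  unfold twConv nestRight
  refine Finset.sum_congr rfl fun g _ => ?_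
  unfold twTerm
  rw [Finset.mul_sum, Finset.sum_mul]

end DoubleSums

/-! ### The Jacobi identity for the coefficients of the Lax matrix -/

section Coefficients

variable {N : ℕ} {τ : ℂ}

/-- By the addition theorem the difference factors through `sin(t × s)`. In the Jacobi sum both
resulting sines are, up to sign, common to all three pairs of terms, leaving only a relation among
products of `φ`. -/
lemma C_mul_C_sub (X Y s t : ℤ × ℤ) :
    C N s X * C N t (Y + s) - C N t Y * C N s (X + t)
      = (N / Real.pi) ^ 2 * (sinN N (cross t s) * sinN N (cross s X + cross t Y)) := by
  simp only [C_eq]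
  rw [show cross t (Y + s) = cross t Y + cross t s by simp [cross]; ring,
    show cross s (X + t) = cross s X - cross t s by simp [cross]; ring]
  unfold sinN
  push_cast
  rw [mul_add, mul_sub, mul_add, Complex.sin_add, Complex.sin_sub, Complex.sin_add]
  ring

variable [NeZero N]

lemma sinN_cross_eq_zero {s t : ℤ × ℤ} (h : cls N s = 0) : sinN N (cross t s) = 0 := by
  obtain ⟨v, rfl⟩ := exists_shift_of_cls_eq (N := N) (a := s) (b := 0) (by rw [h, cls_zero])
  rw [show cross t (0 + (N : ℤ) • v) = N * cross t v by simp [cross]; ring, sinN_mul]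

/-- The Fay identity in cyclic form. -/
lemma varphi_cyclic (hτ : 0 < τ.im) {z₁ z₂ z₃ : ℂ} (h12 : ¬ InLattice τ (z₁ - z₂))
    (h13 : ¬ InLattice τ (z₁ - z₃)) (h23 : ¬ InLattice τ (z₂ - z₃)) {r s t : ℤ × ℤ}
    (hrst : r + s + t = 0) :
    sinN N (cross t s) * (varphi0 N τ (-s) (z₁ - z₂) * varphi0 N τ (-t) (z₁ - z₃)
      + varphi0 N τ r (z₁ - z₂) * varphi0 N τ (-t) (z₂ - z₃) * (-1)
      + varphi0 N τ r (z₁ - z₃) * varphi0 N τ s (z₂ - z₃)) = 0 := by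
  have hr : r = -(s + t) := by
    rw [eq_neg_iff_add_eq_zero, ← hrst]
    abel
  -- If one of the three indices is in the zero class, where Fay's identity is not available, the
  -- sine factor vanishes.
  by_cases hs0 : cls N s = 0
  · rw [sinN_cross_eq_zero hs0, zero_mul]
  by_cases ht0 : cls N t = 0
  · rw [show cross t s = -cross s t by simp [cross]; ring, sinN_neg,
      sinN_cross_eq_zero ht0, neg_zero, zero_mul]
  by_cases hr0 : cls N r = 0
  · rw [show cross t s = -cross t r by rw [hr]; simp [cross]; ring, sinN_neg,
      sinN_cross_eq_zero hr0, neg_zero, zero_mul]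
  have hst : cls N (s + t) ≠ 0 := by
    rw [hr, cls_neg, neg_eq_zero] at hr0
    exact hr0
  have h := varphi_mul_varphi (N := N) hτ hs0 ht0 hst (z := z₂ - z₁) (w := z₃ - z₁)
    (by rwa [inLattice_sub_comm]) (by rwa [inLattice_sub_comm])
    (by rwa [sub_sub_sub_cancel_right])
  rw [sub_sub_sub_cancel_right, sub_sub_sub_cancel_right] at h
  have e : ∀ (g : ℤ × ℤ) (z w : ℂ), varphi N τ (-g) (z - w) = -varphi N τ g (w - z) := by
    intro g z w
    rw [← neg_sub w z, varphi_neg_neg]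
  have hs0' : cls N (-s) ≠ 0 := by rwa [cls_neg, neg_ne_zero]
  have ht0' : cls N (-t) ≠ 0 := by rwa [cls_neg, neg_ne_zero]
  rw [varphi0_of_ne hs0, varphi0_of_ne hs0', varphi0_of_ne ht0', varphi0_of_ne ht0',
    varphi0_of_ne hr0, varphi0_of_ne hr0, hr, e, e, e, e, e]
  linear_combination sinN N (cross t s) * h

/-- The sum of the terms of the Jacobi identity with a fixed monomial. -/
lemma nest_cyclic (hτ : 0 < τ.im) {z₁ z₂ z₃ : ℂ} (h12 : ¬ InLattice τ (z₁ - z₂))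
    (h13 : ¬ InLattice τ (z₁ - z₃)) (h23 : ¬ InLattice τ (z₂ - z₃)) (L₁ L₂ L₃ : ℤ × ℤ → ℂ)
    (a b c : ℤ × ℤ) {r s t : ℤ × ℤ} (hrst : r + s + t = 0) :
    nestLeft N L₁ L₂ L₃ (fun g => varphi0 N τ g (z₁ - z₂)) (fun g => varphi0 N τ g (z₁ - z₃))
        a b c (-s) (-t)
      + nestRight N L₁ L₂ L₃ (fun g => varphi0 N τ g (z₁ - z₂)) (fun g => varphi0 N τ g (z₂ - z₃))
        a b c r (-t)
      + (nestLeft N L₂ L₃ L₁ (fun g => varphi0 N τ g (z₂ - z₃)) (fun g => varphi0 N τ g (z₂ - z₁))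
        b c a (-t) (-r)
      + nestRight N L₂ L₃ L₁ (fun g => varphi0 N τ g (z₂ - z₃)) (fun g => varphi0 N τ g (z₃ - z₁))
        b c a s (-r))
      + (nestLeft N L₃ L₁ L₂ (fun g => varphi0 N τ g (z₃ - z₁)) (fun g => varphi0 N τ g (z₃ - z₂))
        c a b (-r) (-s)
      + nestRight N L₃ L₁ L₂ (fun g => varphi0 N τ g (z₃ - z₁)) (fun g => varphi0 N τ g (z₁ - z₂))
        c a b t (-s)) = 0 := by
  have hfay := varphi_cyclic (N := N) hτ h12 h13 h23 hrst
  have hr : r = -s - t := by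
    rw [← sub_eq_zero, ← hrst]
    abel
  have e : ∀ (g : ℤ × ℤ) (z w : ℂ), varphi0 N τ (-g) (z - w) = -varphi0 N τ g (w - z) := by
    intro g z w
    rw [← neg_sub w z, varphi0_neg_neg]
  have e' : varphi0 N τ t (z₃ - z₁) = -varphi0 N τ (-t) (z₁ - z₃) := by rw [e, neg_neg]
  -- The six terms pair up according to their product of two `φ`; one instance handles each pair.
  have hP := C_mul_C_sub (N := N) (a - b) (a - c) s t
  have hQ := C_mul_C_sub (N := N) (b - a) (b - c) r t
  have hR := C_mul_C_sub (N := N) (c - a) (c - b) r s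
  rw [show cross t r = -cross t s by rw [hr]; simp [cross]; ring, sinN_neg,
    show cross r (b - a) + cross t (b - c) = cross s (a - b) + cross t (a - c) by
      rw [hr]; simp [cross]; ring] at hQ
  rw [show cross s r = cross t s by rw [hr]; simp [cross]; ring,
    show cross r (c - a) + cross s (c - b) = cross s (a - b) + cross t (a - c) by
      rw [hr]; simp [cross]; ring] at hR
  simp only [nestLeft, nestRight, twTerm]
  rw [show a - -s - -t = a - r by rw [hr]; abel, show c + -t = c - t by abel,
    show b + -s = b - s by abel, show b + r - -t = b - s by rw [hr]; abel,
    show b - -t - -r = b - s by rw [hr]; abel, show a + -r = a - r by abel,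
    show c + s - -r = c - t by rw [hr]; abel,
    show c - -r - -s = c - t by rw [hr]; abel, show a + t - -s = a - r by rw [hr]; abel,
    show a - -s - c = a - c + s by abel, show b + r - c = b - c + r by abel,
    show b - -t - a = b - a + t by abel, show c + s - a = c - a + s by abel,
    show c - -r - b = c - b + r by abel, show a + t - b = a - b + t by abel,
    e r z₂ z₁, e r z₃ z₁, e s z₃ z₂, e']
  simp only [C_neg_left]
  rw [C_congr (a := r) (b := a - b) (a' := -r) (b' := b - a) (by simp [cross]; ring),
    C_congr (a := t) (b := c - a) (a' := -t) (b' := a - c) (by simp [cross]; ring),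
    C_congr (a := s) (b := b - c) (a' := -s) (b' := c - b) (by simp [cross]; ring)]
  simp only [C_neg_left]
  linear_combination L₁ (a - r) * L₂ (b - s) * L₃ (c - t)
    * (varphi0 N τ (-s) (z₁ - z₂) * varphi0 N τ (-t) (z₁ - z₃) * hP
      + varphi0 N τ r (z₁ - z₂) * varphi0 N τ (-t) (z₂ - z₃) * hQ
      + varphi0 N τ r (z₁ - z₃) * varphi0 N τ s (z₂ - z₃) * hR
      + (N / Real.pi) ^ 2 * sinN N (cross s (a - b) + cross t (a - c)) * hfay)

/-- The Jacobi identity for the exchange relation. -/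
theorem twConv_jacobi (hτ : 0 < τ.im) {z₁ z₂ z₃ : ℂ} (h12 : ¬ InLattice τ (z₁ - z₂))
    (h13 : ¬ InLattice τ (z₁ - z₃)) (h23 : ¬ InLattice τ (z₂ - z₃)) {L₁ L₂ L₃ : ℤ × ℤ → ℂ}
    (hL₁ : Twisted N L₁) (hL₂ : Twisted N L₂) (hL₃ : Twisted N L₃) (a b c : ℤ × ℤ) :
    twConv N (fun a' => twConv N L₁ L₃ (fun g => varphi0 N τ g (z₁ - z₃)) a' c) L₂
        (fun g => varphi0 N τ g (z₁ - z₂)) a b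
      + twConv N L₁ (fun b' => twConv N L₂ L₃ (fun g => varphi0 N τ g (z₂ - z₃)) b' c)
        (fun g => varphi0 N τ g (z₁ - z₂)) a b
      + (twConv N (fun a' => twConv N L₂ L₁ (fun g => varphi0 N τ g (z₂ - z₁)) a' a) L₃
        (fun g => varphi0 N τ g (z₂ - z₃)) b c
      + twConv N L₂ (fun b' => twConv N L₃ L₁ (fun g => varphi0 N τ g (z₃ - z₁)) b' a)
        (fun g => varphi0 N τ g (z₂ - z₃)) b c)
      + (twConv N (fun a' => twConv N L₃ L₂ (fun g => varphi0 N τ g (z₃ - z₂)) a' b) L₁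
        (fun g => varphi0 N τ g (z₃ - z₁)) c a
      + twConv N L₃ (fun b' => twConv N L₁ L₂ (fun g => varphi0 N τ g (z₁ - z₂)) b' b)
        (fun g => varphi0 N τ g (z₃ - z₁)) c a) = 0 := by
  simp only [twConv_twConv_left, twConv_twConv_right]
  have hk := fun z => classFun_varphi0 (N := N) (τ := τ) z
  have inj : ∀ e : Idx N × Idx N → Idx N × Idx N, (∃ f, Function.LeftInverse f e) →
      Function.Injective e := fun e ⟨f, hf⟩ => hf.injective
  -- With `r = -s - t`, the substitutions bring all six double sums to the common monomial `L₁(a -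
  -- r) L₂(b - s) L₃(c - t)`.
  rw [(classFun₂_nestLeft hL₁ hL₂ hL₃ (hk _) (hk _) a b c).sum_comp (fun q => (-q.1, -q.2))
      (inj _ ⟨fun q => (-q.1, -q.2), fun q => by simp⟩) (fun s _ => -s) (fun _ t => -t)
      (fun c d => by simp [cls_neg, cls_rep]),
    (classFun₂_nestRight hL₁ hL₂ hL₃ (hk _) (hk _) a b c).sum_comp
      (fun q => (-q.1 - q.2, -q.2)) (inj _ ⟨fun q => (-q.1 + q.2, -q.2), fun q => by simp⟩)
      (fun s t => -s - t) (fun _ t => -t) (fun c d => by simp [cls_neg, cls_sub, cls_rep]),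
    (classFun₂_nestLeft hL₂ hL₃ hL₁ (hk _) (hk _) b c a).sum_comp
      (fun q => (-q.2, -(-q.1 - q.2))) (inj _ ⟨fun q => (q.1 + q.2, -q.1), fun q => by simp⟩)
      (fun _ t => -t) (fun s t => -(-s - t)) (fun c d => by simp [cls_neg, cls_add, cls_rep]),
    (classFun₂_nestRight hL₂ hL₃ hL₁ (hk _) (hk _) b c a).sum_comp
      (fun q => (q.1, -(-q.1 - q.2))) (inj _ ⟨fun q => (q.1, q.2 - q.1), fun q => by simp⟩)
      (fun s _ => s) (fun s t => -(-s - t)) (fun c d => by simp [cls_add, cls_rep]),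
    (classFun₂_nestLeft hL₃ hL₁ hL₂ (hk _) (hk _) c a b).sum_comp
      (fun q => (-(-q.1 - q.2), -q.1)) (inj _ ⟨fun q => (-q.2, q.1 + q.2), fun q => by simp⟩)
      (fun s t => -(-s - t)) (fun s _ => -s) (fun c d => by simp [cls_neg, cls_add, cls_rep]),
    (classFun₂_nestRight hL₃ hL₁ hL₂ (hk _) (hk _) c a b).sum_comp
      (fun q => (q.2, -q.1)) (inj _ ⟨fun q => (-q.2, q.1), fun q => by simp⟩)
      (fun _ t => t) (fun s _ => -s) (fun c d => by simp [cls_neg, cls_rep])]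
  simp only [← Finset.sum_add_distrib]
  exact Finset.sum_eq_zero fun c' _ => Finset.sum_eq_zero fun d' _ =>
    nest_cyclic hτ h12 h13 h23 L₁ L₂ L₃ a b c (by abel)

end Coefficients

/-! ### The quadratic Poisson structure -/

section Jacobiator

variable {E : Type*} [NormedAddCommGroup E] [NormedSpace ℂ E]
  {π : E → (E →L[ℂ] ℂ) →ₗ[ℂ] (E →L[ℂ] ℂ) →ₗ[ℂ] ℂ}

/-- The differential of `q ↦ π_q (ξ, η)` at `p`, as a bilinear map. -/
def bivectorDeriv (hπ : ∀ ξ η, Differentiable ℂ fun p => π p ξ η) (p : E) :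
    (E →L[ℂ] ℂ) →ₗ[ℂ] (E →L[ℂ] ℂ) →ₗ[ℂ] (E →L[ℂ] ℂ) :=
  LinearMap.mk₂ ℂ (fun ξ η => fderiv ℂ (fun q => π q ξ η) p)
    (fun ξ ξ' η => by
      simp only [map_add, LinearMap.add_apply]
      exact fderiv_fun_add (hπ _ _ p) (hπ _ _ p))
    (fun c ξ η => by
      simp only [map_smul, LinearMap.smul_apply, smul_eq_mul]
      exact fderiv_const_mul (hπ _ _ p) c)
    (fun ξ η η' => by
      simp only [map_add]
      exact fderiv_fun_add (hπ _ _ p) (hπ _ _ p))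
    (fun c ξ η => by
      simp only [map_smul, smul_eq_mul]
      exact fderiv_const_mul (hπ _ _ p) c)

/-- The cyclic sum in the Jacobi identity, as a linear form in the first argument. -/
def jacobiator (hπ : ∀ ξ η, Differentiable ℂ fun p => π p ξ η) (p : E) (η ζ : E →L[ℂ] ℂ) :
    (E →L[ℂ] ℂ) →ₗ[ℂ] ℂ :=
  (π p).flip ζ ∘ₗ (bivectorDeriv hπ p).flip η + π p (bivectorDeriv hπ p η ζ)
    + (π p).flip η ∘ₗ bivectorDeriv hπ p ζ

lemma jacobiator_apply (hπ : ∀ ξ η, Differentiable ℂ fun p => π p ξ η) (p : E)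
    (ξ η ζ : E →L[ℂ] ℂ) : jacobiator hπ p η ζ ξ = π p (fderiv ℂ (fun q => π q ξ η) p) ζ
      + π p (fderiv ℂ (fun q => π q η ζ) p) ξ + π p (fderiv ℂ (fun q => π q ζ ξ) p) η := rfl

/-- Rotates any of the three arguments into the slot where linearity is available. -/
lemma jacobiator_cyclic (hπ : ∀ ξ η, Differentiable ℂ fun p => π p ξ η) (p : E)
    (ξ η ζ : E →L[ℂ] ℂ) : jacobiator hπ p η ζ ξ = jacobiator hπ p ζ ξ η := by
  rw [jacobiator_apply, jacobiator_apply]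
  ring

end Jacobiator

section Existence

open Classical

variable {n N : ℕ} [NeZero N] {τ : ℂ} {x : Fin n → ℂ}

lemma laxForm_eq_sgn_smul (z : ℂ) (a : ℤ × ℤ) :
    laxForm (n := n) (N := N) τ x z a = sgn N a • laxForm τ x z (rep (cls N a)) := by
  ext p
  rw [_root_.smul_apply, smul_eq_mul, laxForm_apply, laxForm_apply]
  exact (twisted_laxCoeff (twisted_S p) z).eq_sgn_mul a

/-- Arbitrary integer indices are needed because the convolution shifts `a` and `b` away from the
standard representatives. -/
lemma quadBivector_laxForm (hτ : 0 < τ.im) (hx : ∀ j k, j ≠ k → ¬ InLattice τ (x j - x k))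
    (p : Phase n N) {z w : ℂ} (hz : ∀ j, ¬ InLattice τ (z - x j))
    (hw : ∀ j, ¬ InLattice τ (w - x j)) (hzw : ¬ InLattice τ (z - w)) (a b : ℤ × ℤ) :
    quadBivector τ x p (laxForm τ x z a) (laxForm τ x w b)
      = exchCoeff N τ x (S0 p) (fun j a => S j a p) z w a b := by
  have h1 := twisted_laxCoeff (τ := τ) (x := x) (s0 := S0 p) (twisted_S p) z
  have h2 := twisted_laxCoeff (τ := τ) (x := x) (s0 := S0 p) (twisted_S p) w
  have e1 : Twisted N fun a => exchCoeff N τ x (S0 p) (fun j a => S j a p) z w a b :=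
    twisted_twConv_left h1 b
  have e2 : Twisted N fun b => exchCoeff N τ x (S0 p) (fun j a => S j a p) z w
      (rep (cls N a)) b := twisted_twConv_right h1 h2 (classFun_varphi0 _) _
  rw [laxForm_eq_sgn_smul, laxForm_eq_sgn_smul w, e1.eq_sgn_mul a, e2.eq_sgn_mul b,
    ← componentExchange_quadBivector hτ hx p z w hz hw hzw]
  simp only [map_smul, LinearMap.smul_apply, smul_eq_mul]
  ring

lemma differentiable_S (j : Fin n) (a : ℤ × ℤ) : Differentiable ℂ (S (N := N) j a) := by
  rw [← coe_coordS]
  exact (coordS j a).differentiable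

lemma differentiable_S0 : Differentiable ℂ (S0 : Phase n N → ℂ) := by
  rw [← coe_coord_none]
  exact (coord none).differentiable

lemma differentiable_twConv {E : Type*} [NormedAddCommGroup E] [NormedSpace ℂ E]
    {s t : E → ℤ × ℤ → ℂ} (hs : ∀ a, Differentiable ℂ fun p => s p a)
    (ht : ∀ a, Differentiable ℂ fun p => t p a) (k : ℤ × ℤ → ℂ) (a b : ℤ × ℤ) :
    Differentiable ℂ fun p => twConv N (s p) (t p) k a b := by
  unfold twConv twTerm
  exact Differentiable.fun_sum fun c _ =>
    (((hs _).const_mul _).mul (ht _)).mul_const _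

lemma differentiable_selfPart (j : Fin n) (a : ℤ × ℤ) :
    Differentiable ℂ fun p : Phase n N => selfPart N τ x (S0 p) (fun j a => S j a p) j a := by
  unfold selfPart
  refine Differentiable.fun_neg (Differentiable.fun_add ?_ (Differentiable.fun_add
    (Differentiable.fun_sum fun k _ => (differentiable_S k a).mul_const _)
    ((differentiable_S j a).mul_const _)))
  split_ifs
  · exact differentiable_S0.const_mul _
  · exact differentiable_const _

lemma differentiable_twConv_S (j k : Fin n) (w : ℤ × ℤ → ℂ) (a b : ℤ × ℤ) :
    Differentiable ℂ fun p : Phase n N => twConv N (fun a => S j a p) (fun a => S k a p) w a b :=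
  differentiable_twConv (s := fun p a => S j a p) (t := fun p a => S k a p) (differentiable_S j)
    (differentiable_S k) w a b

lemma differentiable_coeffS0S (k : Fin n) (b : ℤ × ℤ) :
    Differentiable ℂ fun p : Phase n N => coeffS0S N τ x (fun j a => S j a p) k b := by
  unfold coeffS0S
  exact (differentiable_twConv_S k k _ _ _).fun_neg.fun_add
    (Differentiable.fun_sum fun m _ => differentiable_twConv_S k m _ _ _)

lemma differentiable_coeffS0jS (j k : Fin n) (b : ℤ × ℤ) :
    Differentiable ℂ fun p : Phase n N => coeffS0jS N τ x (fun j a => S j a p) j k b := by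
  unfold coeffS0jS coeffPair
  split_ifs
  · exact Differentiable.fun_sum fun m _ => differentiable_twConv_S k m _ _ _
  · exact (differentiable_twConv_S k j _ _ _).fun_neg

lemma differentiable_coeffSS (j k : Fin n) (a b : ℤ × ℤ) :
    Differentiable ℂ fun p : Phase n N =>
      coeffSS N τ x (S0 p) (fun j a => S j a p) j k a b := by
  unfold coeffSS
  split_ifs
  · exact (differentiable_twConv (s := fun p a => S j a p)
      (t := fun p => selfPart N τ x (S0 p) (fun j a => S j a p) j) (differentiable_S j)
      (differentiable_selfPart j) _ _ _).fun_add (differentiable_twConv_S j j _ _ _)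
  · exact differentiable_twConv_S j k _ _ _

lemma differentiable_bracketMatrix (i i' : CoordIdx n N) :
    Differentiable ℂ fun p => bracketMatrix τ x p i i' := by
  match i, i' with
  | none, none => exact differentiable_const _
  | none, some (k, d) =>
    simp only [bracketMatrix]
    split_ifs
    · exact differentiable_const _
    · exact differentiable_coeffS0S _ _
  | some (j, c), none =>
    simp only [bracketMatrix]
    split_ifs
    · exact differentiable_const _
    · exact (differentiable_coeffS0S _ _).fun_neg
  | some (j, c), some (k, d) =>
    simp only [bracketMatrix]
    split_ifs
    · exact differentiable_const _
    · exact differentiable_coeffS0jS _ _ _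
    · exact (differentiable_coeffS0jS _ _ _).fun_neg
    · exact differentiable_coeffSS _ _ _ _

lemma differentiable_quadBivector (ξ η : Phase n N →L[ℂ] ℂ) :
    Differentiable ℂ fun p => quadBivector τ x p ξ η := by
  change Differentiable ℂ fun p => ∑ i, ∑ i', ξ (coordVec i) * (η (coordVec i')
      * bracketMatrix τ x p i i')
  exact Differentiable.fun_sum fun i _ => Differentiable.fun_sum fun i' _ =>
    ((differentiable_bracketMatrix i i').const_mul _).const_mul _

/-- Minus the transpose satisfies the same exchange relation, by antisymmetry of `exchCoeff`, and
the relation has only one solution. -/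
lemma quadBivector_self (hτ : 0 < τ.im) (hx : ∀ j k, j ≠ k → ¬ InLattice τ (x j - x k))
    (p : Phase n N) (ξ : Phase n N →L[ℂ] ℂ) : quadBivector τ x p ξ ξ = 0 := by
  have h : ComponentExchange τ x p (-(quadBivector τ x p).flip) := by
    intro z w hz hw hzw c d
    rw [exchCoeff_swap (twisted_S p), LinearMap.neg_apply, LinearMap.neg_apply,
      LinearMap.flip_apply,
      componentExchange_quadBivector hτ hx p w z hw hz (by rwa [inLattice_sub_comm])]
  have h' := LinearMap.congr_fun₂ (h.eq_quadBivector hτ hx) ξ ξ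
  rw [LinearMap.neg_apply, LinearMap.neg_apply, LinearMap.flip_apply] at h'
  linear_combination -h' / 2

/-- The bracket of two Lax coefficients is again quadratic in Lax coefficients, so by Leibniz the
iterated bracket is a sum of two nested convolutions. -/
lemma quadBivector_fderiv_laxForm (hτ : 0 < τ.im)
    (hx : ∀ j k, j ≠ k → ¬ InLattice τ (x j - x k)) (p : Phase n N) {z₁ z₂ z₃ : ℂ}
    (h₁ : ∀ j, ¬ InLattice τ (z₁ - x j)) (h₂ : ∀ j, ¬ InLattice τ (z₂ - x j))
    (h₃ : ∀ j, ¬ InLattice τ (z₃ - x j)) (h12 : ¬ InLattice τ (z₁ - z₂))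
    (h13 : ¬ InLattice τ (z₁ - z₃)) (h23 : ¬ InLattice τ (z₂ - z₃)) (a b c : ℤ × ℤ) :
    quadBivector τ x p (fderiv ℂ (fun q => quadBivector τ x q (laxForm τ x z₁ a)
        (laxForm τ x z₂ b)) p) (laxForm τ x z₃ c)
      = twConv N (fun a' => twConv N (laxCoeff N τ x (S0 p) (fun j a => S j a p) z₁)
            (laxCoeff N τ x (S0 p) (fun j a => S j a p) z₃)
            (fun g => varphi0 N τ g (z₁ - z₃)) a' c)
          (laxCoeff N τ x (S0 p) (fun j a => S j a p) z₂) (fun g => varphi0 N τ g (z₁ - z₂)) a b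
        + twConv N (laxCoeff N τ x (S0 p) (fun j a => S j a p) z₁)
          (fun b' => twConv N (laxCoeff N τ x (S0 p) (fun j a => S j a p) z₂)
            (laxCoeff N τ x (S0 p) (fun j a => S j a p) z₃)
            (fun g => varphi0 N τ g (z₂ - z₃)) b' c)
          (fun g => varphi0 N τ g (z₁ - z₂)) a b := by
  have h : (fun q : Phase n N => quadBivector τ x q (laxForm τ x z₁ a) (laxForm τ x z₂ b))
      = fun q : Phase n N => ∑ d : Idx N, C N (rep d) (a - b) * laxForm τ x z₁ (a - rep d) q
        * laxForm τ x z₂ (b + rep d) q * varphi0 N τ (rep d) (z₁ - z₂) := by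
    funext q
    rw [quadBivector_laxForm hτ hx q h₁ h₂ h12]
    simp only [laxForm_apply]
    rfl
  have hd : ∀ d : Idx N, HasFDerivAt (fun q : Phase n N =>
      C N (rep d) (a - b) * laxForm τ x z₁ (a - rep d) q
        * laxForm τ x z₂ (b + rep d) q * varphi0 N τ (rep d) (z₁ - z₂))
      ((C N (rep d) (a - b) * laxForm τ x z₂ (b + rep d) p * varphi0 N τ (rep d) (z₁ - z₂))
          • laxForm τ x z₁ (a - rep d)
        + (C N (rep d) (a - b) * laxForm τ x z₁ (a - rep d) p * varphi0 N τ (rep d) (z₁ - z₂))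
          • laxForm τ x z₂ (b + rep d)) p := by
    intro d
    have h := (((laxForm τ x z₁ (a - rep d)).hasFDerivAt (x := p)).const_mul
      (C N (rep d) (a - b))).mul ((laxForm τ x z₂ (b + rep d)).hasFDerivAt (x := p))
    have h' := h.mul_const (varphi0 N τ (rep d) (z₁ - z₂))
    simp only [Pi.mul_apply] at h'
    convert! h' using 1
    ext q
    simp only [_root_.add_apply, _root_.smul_apply, smul_eq_mul]
    ring
  rw [h, (HasFDerivAt.fun_sum fun d (_ : d ∈ Finset.univ) => hd d).fderiv]
  simp only [map_sum, map_add, map_smul, LinearMap.sum_apply, LinearMap.add_apply,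
    LinearMap.smul_apply, smul_eq_mul]
  simp only [quadBivector_laxForm hτ hx p h₁ h₃ h13, quadBivector_laxForm hτ hx p h₂ h₃ h23,
    laxForm_apply]
  rw [Finset.sum_add_distrib]
  congr 1
  · refine Finset.sum_congr rfl fun d _ => ?_
    rw [twTerm, exchCoeff]
    ring
  · refine Finset.sum_congr rfl fun d _ => ?_
    rw [twTerm, exchCoeff]
    ring

/-- On Lax coefficients at pairwise incongruent parameters this is `twConv_jacobi`. The three
arguments are then made arbitrary one after the other, each time avoiding only countably many
parameters. -/
lemma quadBivector_jacobi (hτ : 0 < τ.im) (hx : ∀ j k, j ≠ k → ¬ InLattice τ (x j - x k))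
    (p : Phase n N) (ξ η ζ : Phase n N →L[ℂ] ℂ) :
    jacobiator (π := quadBivector τ x) differentiable_quadBivector p η ζ ξ = 0 := by
  have hπ := differentiable_quadBivector (n := n) (N := N) (τ := τ) (x := x)
  have hbad : ∀ w : ℂ, {z : ℂ | InLattice τ (z - w)}.Countable := fun w =>
    countable_inLattice_of_injective τ (f := fun z => z - w) sub_left_injective
  have step₁ : ∀ z₂ z₃ : ℂ, (∀ j, ¬ InLattice τ (z₂ - x j)) → (∀ j, ¬ InLattice τ (z₃ - x j)) →
      ¬ InLattice τ (z₂ - z₃) → ∀ b c : Idx N, ∀ ξ : Phase n N →L[ℂ] ℂ,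
      jacobiator hπ p (laxForm τ x z₂ (rep b)) (laxForm τ x z₃ (rep c)) ξ = 0 := by
    intro z₂ z₃ h₂ h₃ h23 b c
    refine LinearMap.congr_fun (g := 0) (eq_zero_of_laxForm hτ hx ((hbad z₂).union (hbad z₃))
      fun z₁ hz h₁ a => ?_)
    have h12 : ¬ InLattice τ (z₁ - z₂) := fun h => hz (Or.inl h)
    have h13 : ¬ InLattice τ (z₁ - z₃) := fun h => hz (Or.inr h)
    have h21 := h12
    have h31 := h13
    have h32 := h23
    rw [inLattice_sub_comm] at h21 h31 h32
    rw [jacobiator_apply, quadBivector_fderiv_laxForm hτ hx p h₁ h₂ h₃ h12 h13 h23,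
      quadBivector_fderiv_laxForm hτ hx p h₂ h₃ h₁ h23 h21 h31,
      quadBivector_fderiv_laxForm hτ hx p h₃ h₁ h₂ h31 h32 h12]
    exact twConv_jacobi hτ h12 h13 h23 (twisted_laxCoeff (twisted_S p) z₁)
      (twisted_laxCoeff (twisted_S p) z₂) (twisted_laxCoeff (twisted_S p) z₃) _ _ _
  have step₂ : ∀ z₃ : ℂ, (∀ j, ¬ InLattice τ (z₃ - x j)) → ∀ c : Idx N,
      ∀ ξ η : Phase n N →L[ℂ] ℂ, jacobiator hπ p η (laxForm τ x z₃ (rep c)) ξ = 0 := by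
    intro z₃ h₃ c ξ η
    rw [jacobiator_cyclic]
    refine LinearMap.congr_fun (g := 0) (eq_zero_of_laxForm hτ hx (hbad z₃)
      fun z₂ hz h₂ b => ?_) η
    rw [← jacobiator_cyclic]
    exact step₁ z₂ z₃ h₂ h₃ hz b c ξ
  rw [jacobiator_cyclic, jacobiator_cyclic]
  refine LinearMap.congr_fun (g := 0) (eq_zero_of_laxForm hτ hx Set.countable_empty
    fun z₃ _ h₃ c => ?_) ζ
  rw [← jacobiator_cyclic, ← jacobiator_cyclic]
  exact step₂ z₃ h₃ c ξ η

/-- The quadratic Poisson structure. -/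
def quadPoisson (hτ : 0 < τ.im) (hx : ∀ j k, j ≠ k → ¬ InLattice τ (x j - x k)) :
    HolomorphicPoisson (Phase n N) where
  bivector := quadBivector τ x
  holomorphic := differentiable_quadBivector
  alternating := quadBivector_self hτ hx
  jacobi _ hU _ _ _ hF hG hH _ hp := by
    refine jacobi_of_linear (π := quadBivector τ x) differentiable_quadBivector
      (quadBivector_self hτ hx) (fun p ξ η ζ => ?_) hU hF hG hH hp
    rw [← jacobiator_apply (π := quadBivector τ x) differentiable_quadBivector p ξ η ζ]
    exact quadBivector_jacobi hτ hx p ξ η ζ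

theorem existsUnique_hasQuadraticBrackets (hτ : 0 < τ.im)
    (hx : ∀ j k, j ≠ k → ¬ InLattice τ (x j - x k)) :
    ∃! P : HolomorphicPoisson (Phase n N), HasQuadraticBrackets τ x P :=
  ⟨quadPoisson hτ hx, (hasQuadraticBrackets_iff hτ _).2 fun _ => rfl, fun _ hP =>
    HolomorphicPoisson.ext_bivector ((hasQuadraticBrackets_iff hτ _).1 hP)⟩

end Existence

/-! ### The case of one marked point -/

section OnePoint

variable {N : ℕ} [NeZero N] {τ : ℂ} {y : Fin 1 → ℂ}

lemma S0j_one (j : Fin 1) : (S0j j : Phase 1 N → ℂ) = 0 := by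
  funext p
  have h : ∑ j : Fin 1, p.1.2 j 0 = 0 := p.2
  rw [Fin.sum_univ_one] at h
  rwa [Subsingleton.elim j 0]

lemma sum_filter_ne_one (k : Fin 1) (f : Fin 1 → ℂ) : ∑ j with j ≠ k, f j = 0 :=
  Finset.sum_eq_zero fun j hj => absurd (Subsingleton.elim j k) (Finset.mem_filter.1 hj).2

lemma rhsS0S_one (a : ℤ × ℤ) : rhsS0S (N := N) τ y 0 a = fun p =>
    ∑ c : Idx N with c ≠ 0 ∧ c ≠ cls N a,
      C N a (rep c) * S 0 (a - rep c) p * S 0 (rep c) p * E2 τ (breve N τ (rep c)) := by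
  funext p
  unfold rhsS0S
  refine Finset.sum_congr rfl fun c _ => ?_
  rw [sum_filter_ne_one]
  ring

lemma rhsSame_one (a b : ℤ × ℤ) : rhsSame (N := N) τ y 0 a b = fun p =>
    -(C N a b * S0 p * S 0 (a + b) p)
      + 1 / 2 * ∑ c : Idx N with c ≠ 0 ∧ c ≠ cls N a ∧ c ≠ cls N (-b),
        C N (rep c) (a - b) * S 0 (a - rep c) p * S 0 (b + rep c) p * fConst N τ a b (rep c) := by
  funext p
  unfold rhsSame
  rw [sum_filter_ne_one, sum_filter_ne_one, S0j_one, Pi.zero_apply]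
  ring

lemma rhsS0jS_one (j k : Fin 1) (b : ℤ × ℤ) : rhsS0jS (N := N) τ y j k b = 0 := by
  funext p
  rw [rhsS0jS, if_pos (Subsingleton.elim j k), sum_filter_ne_one, neg_zero, Pi.zero_apply]

lemma bracket_zero_left {E : Type*} [NormedAddCommGroup E] [NormedSpace ℂ E]
    [FiniteDimensional ℂ E] (P : HolomorphicPoisson E) (G : E → ℂ) : P.bracket 0 G = 0 := by
  funext p
  simp [HolomorphicPoisson.bracket, bivectorBracket]

lemma bracket_zero_right {E : Type*} [NormedAddCommGroup E] [NormedSpace ℂ E]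
    [FiniteDimensional ℂ E] (P : HolomorphicPoisson E) (F : E → ℂ) : P.bracket F 0 = 0 := by
  funext p
  simp [HolomorphicPoisson.bracket, bivectorBracket]

/-- The function `S^1_0` is identically zero, so its brackets vanish. Antisymmetry settles equal
arguments and there is no second marked point, which leaves only the two families on the right. -/
theorem hasQuadraticBrackets_iff_hasFOSBrackets (P : HolomorphicPoisson (Phase 1 N)) :
    HasQuadraticBrackets τ y P ↔ HasFOSBrackets τ P := by
  constructor
  · intro h
    exact ⟨fun a ha => (h.S0_S 0 a ha).trans (rhsS0S_one a),
      fun a b ha hb => (h.S_S_same 0 a b ha hb).trans (rhsSame_one a b)⟩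
  · intro h
    constructor
    · intro j
      rw [S0j_one, bracket_zero_right]
    · intro j k
      rw [S0j_one, bracket_zero_left]
    · intro j k a _
      rw [Subsingleton.elim j k]
      funext p
      exact P.alternating p _
    · intro k a ha
      rw [Subsingleton.elim k 0, rhsS0S_one]
      exact h.S0_S a ha
    · intro k a b ha hb
      rw [Subsingleton.elim k 0, rhsSame_one]
      exact h.S_S a b ha hb
    · intro j k hjk
      exact absurd (Subsingleton.elim j k) hjk
    · intro j k b _
      rw [S0j_one, bracket_zero_left, rhsS0jS_one]

end OnePoint

end ESS

end

theorem proposition3p1 (n N : ℕ) [NeZero N] (τ : ℂ) (hτ : 0 < τ.im) (x : Fin n → ℂ)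
    (hx : ∀ j k, j ≠ k → ¬ ESS.InLattice τ (x j - x k)) :
    (∃! P : ESS.HolomorphicPoisson (ESS.Phase n N), ESS.HasQuadraticBrackets τ x P) ∧
    (∀ P : ESS.HolomorphicPoisson (ESS.Phase n N),
      ESS.HasQuadraticBrackets τ x P ↔ ESS.SatisfiesExchange τ x P) ∧
    (∀ (y : Fin 1 → ℂ) (P : ESS.HolomorphicPoisson (ESS.Phase 1 N)),
      ESS.HasQuadraticBrackets τ y P ↔ ESS.HasFOSBrackets τ P) :=
  ⟨ESS.existsUnique_hasQuadraticBrackets hτ hx,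
    fun P => ESS.hasQuadraticBrackets_iff_satisfiesExchange hτ hx P,
    fun _ P => ESS.hasQuadraticBrackets_iff_hasFOSBrackets P⟩
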